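/- Theorem 2.6. Let $\mathcal X$ be a barreled real topological vector space with a symplectic form $\sigma$ (bilinear, antisymmetric, non-degenerate), let $\mathcal X_{\rm bulk}\subset\mathcal X$ be a linear subspace (with the subspace topology) and let $\mathcal X_{\rm bd}$ be a real topological vector space. All continuous duals $'$ carry the weak$^*$ topology. Let $\partial:\mathcal X_{\rm bulk}'\to\mathcal X_{\rm bd}'$ be a linear map such that $\mathcal X'\ni u\mapsto\partial(u\restriction\mathcal X_{\rm bulk})\in\mathcal X_{\rm bd}'$ is continuous. Let $\eta:\mathcal X\to\mathcal X'$ be linear and continuous, symmetric and strictly positive ($v\cdot\eta v>0$ for $v\ne0$), and suppose that $\eta$ is a quasi-free covariance, i.e. $|v_1\cdot\sigma v_2|\le 2\,(v_1\cdot\eta v_1)^{1/2}(v_2\cdot\eta v_2)^{1/2}$ for all $v_1,v_2\in\mathcal X$. Suppose that for all $u\in\mathcal X'$, $\partial (u\restriction\mathcal X_{\rm bulk})=0$ implies $u=0$ on $\mathcal X_{\rm bulk}$. Let $\mathcal X^{\rm cpl}$ be the completion of $\mathcal X$ for $\eta$, a real Hilbert space with scalar product $\eta^{\rm cpl}$,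 let $\sigma^{\rm cpl}$ be the bounded extension of $\sigma$, and let $b$ be the bounded operator on $\mathcal X^{\rm cpl}$ with $\sigma^{\rm cpl}=2\eta^{\rm cpl}b$. For $f\in\mathcal X_{\rm bd}$ let $\partial'f\in\mathcal X^{\rm cpl}$ be the vector with $\partial'f\cdot\eta^{\rm cpl}u=(f\cdot\partial\,\eta^{\rm cpl}u)$ for all $u\in\mathcal X^{\rm cpl}$. For a pre-symplectic space $(V,s)$ let $\mathrm{CCR}(V,s)$ be the $C^*$-algebra generated by Weyl operators $W(v)$, $v\in V$, with $W(v_1)W(v_2)=e^{-\frac i2 v_1\cdot sv_2}W(v_1+v_2)$, $W(v)^*=W(-v)$, $W(0)=1$. Let $\mathcal A_{\rm bulk}=\mathrm{CCR}(\mathcal X_{\rm bulk},\sigma)$ be the $C^*$-subalgebra of $\mathrm{CCR}(\mathcal X^{\rm cpl},\sigma^{\rm cpl})$ generated by the $W(w)$, $w\in\mathcal X_{\rm bulk}$. Assume that $\dim\ker\sigma^{\rm cpl}$ is even or infinite. Then there is a bounded operator $\mathrm j$ on $\mathcal X^{\rm cpl}$ with $\mathrm j^2=-1$, antisymmetric for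 $\eta^{\rm cpl}$, and with $b=-\mathrm j|b|$. For every such $\mathrm j$, let $\mathcal X_{\rm KW}$ be $\mathcal X^{\rm cpl}$ regarded as a complex Hilbert space with imaginary unit $\mathrm j$ and scalar product $v_1\cdot\eta^{\rm cpl}v_2-i\,v_1\cdot\eta^{\rm cpl}\mathrm jv_2$, let $\overline{\mathcal X_{\rm KW}}$ be its complex conjugate (with $-\mathrm j$ in place of $\mathrm j$), let $\mathfrak h_{\rm KW}=\mathcal X_{\rm KW}\oplus 1_{\mathbb R\setminus\{1\}}(\overline{|b|})\overline{\mathcal X_{\rm KW}}$, let $\Gamma(\mathfrak h_{\rm KW})$ be the symmetric Fock space, and let $$\phi_{\rm KW}(v)=\phi_{\rm F}\big((1+|b|)^{1/2}v\oplus(1-\overline{|b|})^{1/2}\overline v\big),\qquad \phi_{\rm F}(h)=\tfrac1{\sqrt2}(a^*(h)+a(h)),$$ for $v\in\mathcal X^{\rm cpl}$. There is a $*$-representation $\pi_{\rm KW}$ of $\mathrm{CCR}(\mathcal X^{\rm cpl},\sigma^{\rm cpl})$ on $\Gamma(\mathfrak h_{\rm KW})$ with $\pi_{\rm KW}(W(v))=e^{i\phi_{\rm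 KW}(v)}$ for all $v\in\mathcal X^{\rm cpl}$ (the Kay–Wald representation; it is unique), and $$\pi_{\rm KW}(\mathcal A_{\rm bulk})''\subset\{e^{i\phi_{\rm KW}(\partial'f)}\mid f\in\mathcal X_{\rm bd}\}'',$$ where the primes denote commutants in the bounded operators on $\Gamma(\mathfrak h_{\rm KW})$. -/

import Mathlib

open scoped InnerProductSpace

noncomputable section

/-! ### Symmetric Fock space, creation, annihilation and field operators -/

section Fock

variable (h : Type*) [NormedAddCommGroup h] [InnerProductSpace ℂ h]

/-- Algebraic finite particle vectors: formal finite linear combinations of symbols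
`x₁ ∨ ⋯ ∨ xₙ` with `n ≥ 0` and `xᵢ ∈ h`. The relations among these symbols (multilinearity and
symmetry) hold modulo vectors of norm zero, hence in the Fock space below. -/
def PreFock : Type _ := (Σ n : ℕ, Fin n → h) →₀ ℂ

instance : AddCommGroup (PreFock h) := inferInstanceAs (AddCommGroup (_ →₀ ℂ))

instance : Module ℂ (PreFock h) := inferInstanceAs (Module ℂ (_ →₀ ℂ))

variable {h}

/-- `⟨x₁ ∨ ⋯ ∨ xₙ, y₁ ∨ ⋯ ∨ yₘ⟩ = δₙₘ ∑_π ∏ᵢ ⟨x_{π i}, yᵢ⟩`. -/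
def fockKernel (s t : Σ n : ℕ, Fin n → h) : ℂ :=
  if e : s.1 = t.1 then
    Matrix.permanent (Matrix.of fun i j : Fin s.1 => ⟪s.2 i, t.2 (Fin.cast e j)⟫_ℂ)
  else 0

lemma fockKernel_conj (s t : Σ n : ℕ, Fin n → h) :
    (starRingEnd ℂ) (fockKernel t s) = fockKernel s t := by
  obtain ⟨n, x⟩ := s
  obtain ⟨m, y⟩ := t
  by_cases e : n = m
  · subst e
    simp only [fockKernel, Matrix.permanent, dite_true, Matrix.of_apply, map_sum, map_prod,
      inner_conj_symm, Fin.cast_eq_self]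
    refine Fintype.sum_equiv (Equiv.inv _) _ _ fun π => ?_
    refine Fintype.prod_equiv π _ _ fun i => ?_
    simp
  · have e' : ¬ m = n := fun h' => e h'.symm
    simp [fockKernel, e, e']

/-- The sesquilinear form on formal combinations given by the kernel. -/
def fockForm (Ψ Φ : (Σ n : ℕ, Fin n → h) →₀ ℂ) : ℂ :=
  Ψ.sum fun s c => Φ.sum fun t d => (starRingEnd ℂ) c * d * fockKernel s t

open scoped ComplexOrder in
lemma prodGram_posSemidef {ι : Type*} [Fintype ι] {n : ℕ} (x : ι → Fin n → h)
    (T : Finset (Fin n)) :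
    (Matrix.of fun a b : ι => ∏ k ∈ T, ⟪x a k, x b k⟫_ℂ).PosSemidef := by
  classical
  induction T using Finset.induction_on with
  | empty =>
    have := Matrix.posSemidef_gram ℂ (fun _ : ι => (1 : ℂ))
    have e : (Matrix.of fun a b : ι => ∏ k ∈ (∅ : Finset (Fin n)), ⟪x a k, x b k⟫_ℂ) =
        Matrix.gram ℂ (fun _ : ι => (1 : ℂ)) := by
      ext a b
      simp [Matrix.gram]
    rw [e]
    exact this
  | insert k T hk ih =>
    have h1 := Matrix.posSemidef_gram ℂ (fun a : ι => x a k)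
    have := h1.hadamard ih
    have e : (Matrix.of fun a b : ι => ∏ k ∈ insert k T, ⟪x a k, x b k⟫_ℂ) =
        (Matrix.gram ℂ fun a : ι => x a k).hadamard
          (Matrix.of fun a b : ι => ∏ k ∈ T, ⟪x a k, x b k⟫_ℂ) := by
      ext a b
      simp [Matrix.gram, Finset.prod_insert hk]
    rw [e]
    exact this

open scoped ComplexOrder in
lemma permGram_nonneg {ι : Type*} [Fintype ι] {n : ℕ} (x : ι → Fin n → h) (c : ι → ℂ) :
    0 ≤ (∑ a, ∑ b, (starRingEnd ℂ) (c a) * c b *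
      Matrix.permanent (Matrix.of fun i j : Fin n => ⟪x a i, x b j⟫_ℂ)).re := by
  classical
  have key := (prodGram_posSemidef (fun p : ι × Equiv.Perm (Fin n) => fun k => x p.1 (p.2 k))
    Finset.univ).dotProduct_mulVec_nonneg (fun p => c p.1)
  have e : star (fun p : ι × Equiv.Perm (Fin n) => c p.1) ⬝ᵥ
      (Matrix.of fun p q : ι × Equiv.Perm (Fin n) =>
        ∏ k ∈ Finset.univ, ⟪x p.1 (p.2 k), x q.1 (q.2 k)⟫_ℂ).mulVec (fun p => c p.1)
      = (n.factorial : ℂ) * ∑ a, ∑ b, (starRingEnd ℂ) (c a) * c b *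
      Matrix.permanent (Matrix.of fun i j : Fin n => ⟪x a i, x b j⟫_ℂ) := by
    have perm_eq : ∀ a b (τ : Equiv.Perm (Fin n)),
        ∑ π : Equiv.Perm (Fin n), ∏ k, ⟪x a (π k), x b (τ k)⟫_ℂ =
        Matrix.permanent (Matrix.of fun i j : Fin n => ⟪x a i, x b j⟫_ℂ) := by
      intro a b τ
      rw [Matrix.permanent]
      refine Fintype.sum_equiv (Equiv.mulRight τ⁻¹) _ _ fun π => ?_
      refine Fintype.prod_equiv τ _ _ fun k => ?_
      simp
    simp only [dotProduct, Matrix.mulVec, Matrix.of_apply, Pi.star_apply, Finset.mul_sum,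
      Fintype.sum_prod_type]
    refine Finset.sum_congr rfl fun a _ => ?_
    rw [Finset.sum_comm]
    refine Finset.sum_congr rfl fun b _ => ?_
    rw [Finset.sum_comm]
    have : ∀ τ : Equiv.Perm (Fin n), ∑ π : Equiv.Perm (Fin n),
        star (c a) * ((∏ k, ⟪x a (π k), x b (τ k)⟫_ℂ) * c b) =
        (starRingEnd ℂ) (c a) * c b *
          Matrix.permanent (Matrix.of fun i j : Fin n => ⟪x a i, x b j⟫_ℂ) := by
      intro τ
      rw [← perm_eq a b τ, Finset.mul_sum]
      refine Finset.sum_congr rfl fun π _ => ?_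
      simp only [starRingEnd_apply]
      ring
    simp only [this, Finset.sum_const, Finset.card_univ, Fintype.card_perm, Fintype.card_fin,
      nsmul_eq_mul]
  rw [e] at key
  have key' := (Complex.le_def.1 key).1
  have hn : (0 : ℝ) < n.factorial := by exact_mod_cast n.factorial_pos
  rw [Complex.zero_re, ← Complex.ofReal_natCast, Complex.re_ofReal_mul] at key'
  exact nonneg_of_mul_nonneg_right key' hn

lemma fockForm_nonneg (Ψ : (Σ n : ℕ, Fin n → h) →₀ ℂ) : 0 ≤ (fockForm Ψ Ψ).re := by
  classical
  set S : Finset (Σ n : ℕ, Fin n → h) := Ψ.support with hS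
  set c : (Σ n : ℕ, Fin n → h) → ℂ := fun s => Ψ s with hc
  have e1 : fockForm Ψ Ψ = ∑ s ∈ S, ∑ t ∈ S, (starRingEnd ℂ) (c s) * c t * fockKernel s t := rfl
  have e2 : fockForm Ψ Ψ = ∑ n ∈ S.image Sigma.fst, ∑ s ∈ S with s.1 = n, ∑ t ∈ S with t.1 = n,
      (starRingEnd ℂ) (c s) * c t * fockKernel s t := by
    rw [e1, ← Finset.sum_fiberwise_of_maps_to (t := S.image Sigma.fst) (g := Sigma.fst)
      (fun s hs => Finset.mem_image_of_mem _ hs)]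
    refine Finset.sum_congr rfl fun n _ => Finset.sum_congr rfl fun s hs => ?_
    rw [Finset.sum_filter]
    refine Finset.sum_congr rfl fun t _ => ?_
    have hs' := (Finset.mem_filter.1 hs).2
    split_ifs with ht
    · rfl
    · have : ¬ s.1 = t.1 := fun h' => ht (h' ▸ hs')
      simp [fockKernel, this]
  rw [e2, Complex.re_sum]
  refine Finset.sum_nonneg fun n _ => ?_
  set T : Finset (Σ n : ℕ, Fin n → h) := S.filter fun s => s.1 = n with hT
  have := permGram_nonneg (n := n) (ι := T)
    (fun s i => s.1.2 (Fin.cast (Finset.mem_filter.1 s.2).2.symm i)) (fun s => c s.1)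
  refine this.trans_eq ?_
  congr 1
  rw [← Finset.sum_coe_sort T]
  refine Finset.sum_congr rfl fun s _ => ?_
  rw [← Finset.sum_coe_sort T]
  refine Finset.sum_congr rfl fun t _ => ?_
  congr 1
  obtain ⟨⟨n', x⟩, hs⟩ := s
  obtain ⟨⟨m', y⟩, ht⟩ := t
  obtain rfl : n' = n := (Finset.mem_filter.1 hs).2
  obtain rfl : m' = n' := (Finset.mem_filter.1 ht).2
  simp [fockKernel]

lemma fockForm_add_left (Ψ Φ Θ : (Σ n : ℕ, Fin n → h) →₀ ℂ) :
    fockForm (Ψ + Φ) Θ = fockForm Ψ Θ + fockForm Φ Θ := by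
  refine Finsupp.sum_add_index' (fun s => by simp) fun s c d => ?_
  rw [← Finsupp.sum_add]
  refine Finset.sum_congr rfl fun t _ => ?_
  rw [map_add]
  ring

lemma fockForm_smul_left (Ψ Φ : (Σ n : ℕ, Fin n → h) →₀ ℂ) (c : ℂ) :
    fockForm (c • Ψ) Φ = (starRingEnd ℂ) c * fockForm Ψ Φ := by
  refine (Finsupp.sum_smul_index' (fun s => by simp)).trans ?_
  unfold fockForm Finsupp.sum
  rw [Finset.mul_sum]
  refine Finset.sum_congr rfl fun s _ => ?_
  rw [Finset.mul_sum]
  refine Finset.sum_congr rfl fun t _ => ?_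
  rw [smul_eq_mul, map_mul]
  ring

/-- The semi-inner product on formal combinations. -/
@[reducible]
def preFockCore : PreInnerProductSpace.Core ℂ (PreFock h) where
  inner := fockForm
  conj_inner_symm Ψ Φ := by
    unfold fockForm Finsupp.sum
    simp only [map_sum, map_mul, Complex.conj_conj, fockKernel_conj]
    rw [Finset.sum_comm]
    refine Finset.sum_congr rfl fun s _ => Finset.sum_congr rfl fun t _ => ?_
    ring
  re_inner_nonneg := fockForm_nonneg
  add_left := fockForm_add_left
  smul_left := fockForm_smul_left

instance : SeminormedAddCommGroup (PreFock h) :=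
  @InnerProductSpace.Core.toSeminormedAddCommGroup ℂ (PreFock h) _ _ _ preFockCore

instance : InnerProductSpace ℂ (PreFock h) := InnerProductSpace.ofCore preFockCore

variable (h) in
/-- The symmetric Fock space `Γ(h)`: the Hilbert space completion of the finite particle vectors. -/
abbrev Fock : Type _ := UniformSpace.Completion (PreFock h)

/-- The creation operator `a*(x) : x₁ ∨ ⋯ ∨ xₙ ↦ x ∨ x₁ ∨ ⋯ ∨ xₙ`. -/
def creation (x : h) : PreFock h →ₗ[ℂ] PreFock h :=
  Finsupp.lmapDomain ℂ ℂ fun s : Σ n : ℕ, Fin n → h => ⟨s.1 + 1, Fin.cons x s.2⟩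

/-- The symbol `x₁ ∨ ⋯ ∨ xₙ` as a finite particle vector. -/
def fockSymbol (s : Σ n : ℕ, Fin n → h) : PreFock h := Finsupp.single s (1 : ℂ)

/-- `x₁ ∨ ⋯ ∨ xₙ ↦ ∑ᵢ ⟨x, xᵢ⟩ x₁ ∨ ⋯ ∨ x̂ᵢ ∨ ⋯ ∨ xₙ`, and `Ω ↦ 0`. -/
def annihilateSymbol (x : h) : (Σ n : ℕ, Fin n → h) → PreFock h
  | ⟨0, _⟩ => 0
  | ⟨n + 1, y⟩ => ∑ i : Fin (n + 1), ⟪x, y i⟫_ℂ • fockSymbol ⟨n, fun k => y (i.succAbove k)⟩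

/-- The annihilation operator `a(x)`. -/
def annihilation (x : h) : PreFock h →ₗ[ℂ] PreFock h :=
  Finsupp.linearCombination ℂ (annihilateSymbol x)

/-- The field operator `φ_F(x) = (a*(x) + a(x)) / √2` on finite particle vectors. -/
def fieldOp (x : h) : PreFock h →ₗ[ℂ] PreFock h :=
  ((Real.sqrt 2 : ℝ) : ℂ)⁻¹ • (creation x + annihilation x)

end Fock

/-! ### Exponentials of essentially self-adjoint operators -/

section Exponential

variable {D : Type*} [SeminormedAddCommGroup D] [InnerProductSpace ℂ D]

/-- `U` is a strongly continuous one-parameter unitary group on the completion of `D` whose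
generator extends `i A`, where `A` is an operator with dense domain `D`. When `A` is essentially
self-adjoint, the generator is `i` times the closure of `A`, so that `U t = e^{i t A}`, and `U` is
unique. -/
structure IsUnitaryGroupOf (A : D →ₗ[ℂ] D)
    (U : ℝ → (UniformSpace.Completion D →L[ℂ] UniformSpace.Completion D)) : Prop where
  unitary : ∀ t, U t ∈ unitary (UniformSpace.Completion D →L[ℂ] UniformSpace.Completion D)
  map_zero : U 0 = 1
  map_add : ∀ s t, U (s + t) = U s * U t
  continuous : ∀ Ψ, Continuous fun t => U t Ψ
  generator : ∀ Ψ : D, HasDerivAt (fun t => U t (Ψ : UniformSpace.Completion D))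
    (Complex.I • ((A Ψ : D) : UniformSpace.Completion D)) 0

open Classical in
/-- `e^{i A}` for an essentially self-adjoint operator `A` with domain `D` on the completion
of `D`. -/
def expI (A : D →ₗ[ℂ] D) : UniformSpace.Completion D →L[ℂ] UniformSpace.Completion D :=
  if hU : ∃ U, IsUnitaryGroupOf A U then hU.choose 1 else 0

end Exponential

/-- The Fock space Weyl operator `W_F(x) = e^{i φ_F(x)}`. The field operators are essentially
self-adjoint on finite particle vectors, these being analytic vectors. -/
def weylF {h : Type*} [NormedAddCommGroup h] [InnerProductSpace ℂ h] (x : h) :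
    Fock h →L[ℂ] Fock h :=
  expI (fieldOp x)

/-! ### Weyl CCR algebras -/

section CCR

variable {V : Type*} [AddCommGroup V] [Module ℝ V]

lemma norm_weylPhase (r : ℝ) : ‖Complex.exp (-(Complex.I / 2) * r)‖ = 1 := by
  have e : -(Complex.I / 2) * r = ((-r / 2 : ℝ) : ℂ) * Complex.I := by
    push_cast; ring
  rw [e, Complex.norm_exp_ofReal_mul_I]

lemma weylFun_memℓp (s : V →ₗ[ℝ] V →ₗ[ℝ] ℝ) (v : V) (ψ : lp (fun _ : V => ℂ) 2) :
    Memℓp (fun w : V => Complex.exp (-(Complex.I / 2) * (s v w : ℝ)) * ψ (w - v)) 2 := by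
  have h2 : 0 < (2 : ENNReal).toReal := by norm_num
  rw [memℓp_gen_iff h2]
  have := (memℓp_gen_iff h2).1 (lp.memℓp ψ)
  refine ((Equiv.subRight v).summable_iff.2 this).congr fun w => ?_
  rw [norm_mul, norm_weylPhase, one_mul]
  rfl

/-- The Weyl operator `W(v)` of a pre-symplectic space `(V, s)`, acting on `ℓ²(V)` by
`(W(v) ψ)(w) = e^{-(i/2) s(v, w)} ψ(w - v)`. These unitaries satisfy
`W(v₁) W(v₂) = e^{-(i/2) s(v₁, v₂)} W(v₁ + v₂)`, `W(v)* = W(-v)` and `W(0) = 1`. -/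
def weylOp (s : V →ₗ[ℝ] V →ₗ[ℝ] ℝ) (v : V) :
    lp (fun _ : V => ℂ) 2 →L[ℂ] lp (fun _ : V => ℂ) 2 :=
  LinearMap.mkContinuous
    { toFun := fun ψ => ⟨_, weylFun_memℓp s v ψ⟩
      map_add' := fun ψ φ => by
        ext w
        exact mul_add _ _ _
      map_smul' := fun c ψ => by
        ext w
        exact mul_left_comm _ _ _ } 1 fun ψ => by
    have h2 : 0 < (2 : ENNReal).toReal := by norm_num
    rw [one_mul]
    refine lp.norm_le_of_tsum_le h2 (norm_nonneg _) ?_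
    rw [lp.norm_rpow_eq_tsum h2 ψ,
      ← (Equiv.subRight v).tsum_eq fun w => ‖ψ w‖ ^ (2 : ENNReal).toReal]
    refine (tsum_congr fun w => ?_).le
    simp only [LinearMap.coe_mk, AddHom.coe_mk]
    rw [norm_mul, norm_weylPhase, one_mul]
    rfl

/-- The Weyl CCR algebra `CCR(V, s)`: the `C*`-algebra generated by the Weyl operators in the
regular representation on `ℓ²(V)`. Since the discrete group `V` is abelian, hence amenable, its norm
is the largest `C*`-norm, so that every representation of the Weyl relations extends to it, also
when `s` is degenerate. -/
def CCR (s : V →ₗ[ℝ] V →ₗ[ℝ] ℝ) :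
    StarSubalgebra ℂ (lp (fun _ : V => ℂ) 2 →L[ℂ] lp (fun _ : V => ℂ) 2) :=
  (StarAlgebra.adjoin ℂ (Set.range (weylOp s))).topologicalClosure

/-- The Weyl operators as elements of the CCR algebra. -/
def CCR.W (s : V →ₗ[ℝ] V →ₗ[ℝ] ℝ) (v : V) : CCR s :=
  ⟨weylOp s v, (StarAlgebra.adjoin ℂ (Set.range (weylOp s))).le_topologicalClosure
    (StarAlgebra.subset_adjoin ℂ _ (Set.mem_range_self v))⟩

/-- The `C*`-subalgebra `CCR(Y, s)` of `CCR(V, s)` for a subspace `Y` of `V`: it is generated by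
the Weyl operators `W(y)`, `y ∈ Y`. -/
def CCR.sub (s : V →ₗ[ℝ] V →ₗ[ℝ] ℝ) (Y : Submodule ℝ V) : StarSubalgebra ℂ (CCR s) :=
  (StarAlgebra.adjoin ℂ (CCR.W s '' (Y : Set V))).topologicalClosure

end CCR

/-! ### Complex structures on real Hilbert spaces, and positive square roots -/

section RealHilbert

variable {H : Type*} [NormedAddCommGroup H] [InnerProductSpace ℝ H]

open Classical in
/-- The positive square root of a positive operator on a real Hilbert space. -/
def posSqrt (A : H →L[ℝ] H) : H →L[ℝ] H :=
  if hS : ∃ S : H →L[ℝ] H, S.IsPositive ∧ S ∘L S = A then hS.choose else 0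

lemma posSqrt_isSymmetric (A : H →L[ℝ] H) (x y : H) :
    ⟪posSqrt A x, y⟫_ℝ = ⟪x, posSqrt A y⟫_ℝ := by
  unfold posSqrt
  split_ifs with hS
  · exact hS.choose_spec.1.1 x y
  · simp

lemma posSqrt_eq_zero (A : H →L[ℝ] H) {x : H} (hx : A x = 0) : posSqrt A x = 0 := by
  have h0 : posSqrt A (posSqrt A x) = 0 := by
    unfold posSqrt
    split_ifs with hS
    · have := congrArg (fun T : H →L[ℝ] H => T x) hS.choose_spec.2
      simpa [hx] using this
    · simp
  rw [← inner_self_eq_zero (𝕜 := ℝ), posSqrt_isSymmetric, h0, inner_zero_right]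

/-- The absolute value `|b| = (b* b)^{1/2}`. -/
def opAbs [CompleteSpace H] (b : H →L[ℝ] H) : H →L[ℝ] H :=
  posSqrt (ContinuousLinearMap.adjoint b ∘L b)

variable (H) in
/-- An anti-involution `j` such that the inner product and `j` form a Kähler structure. -/
structure KahlerStructure where
  j : H →L[ℝ] H
  j_j : ∀ x, j (j x) = -x
  skew : ∀ x y, ⟪j x, y⟫_ℝ = -⟪x, j y⟫_ℝ

/-- The conjugate structure, with `j` replaced by `-j`. -/
def KahlerStructure.conj (K : KahlerStructure H) : KahlerStructure H where
  j := -K.j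
  j_j x := by simp [K.j_j]
  skew x y := by simp [K.skew]

/-- The real Hilbert space `H` as a complex Hilbert space with imaginary unit `j` and scalar
product `⟨x, y⟩ - i ⟨x, j y⟩`. -/
def KahlerStructure.Space (_K : KahlerStructure H) : Type _ := H

namespace KahlerStructure

variable (K : KahlerStructure H)

instance : NormedAddCommGroup K.Space := inferInstanceAs (NormedAddCommGroup H)

instance [CompleteSpace H] : CompleteSpace K.Space := inferInstanceAs (CompleteSpace H)

/-- The identity map from `H` to the complex Hilbert space. -/
def toC (x : H) : K.Space := x

/-- The identity map from the complex Hilbert space to `H`. -/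
def toR (x : K.Space) : H := x

instance : Module ℂ K.Space where
  smul c x := K.toC (c.re • K.toR x + c.im • K.j (K.toR x))
  one_smul x := show (1 : ℂ).re • K.toR x + (1 : ℂ).im • K.j (K.toR x) = K.toR x by simp
  mul_smul c d x := show (c * d).re • K.toR x + (c * d).im • K.j (K.toR x) =
      c.re • (d.re • K.toR x + d.im • K.j (K.toR x)) +
        c.im • K.j (d.re • K.toR x + d.im • K.j (K.toR x)) by
    simp only [Complex.mul_re, Complex.mul_im, map_add, map_smul, K.j_j]
    module
  smul_zero c := show c.re • (0 : H) + c.im • K.j (0 : H) = 0 by simp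
  smul_add c x y := show c.re • (K.toR x + K.toR y) + c.im • K.j (K.toR x + K.toR y) =
      (c.re • K.toR x + c.im • K.j (K.toR x)) + (c.re • K.toR y + c.im • K.j (K.toR y)) by
    simp only [map_add]
    module
  add_smul c d x := show (c + d).re • K.toR x + (c + d).im • K.j (K.toR x) =
      (c.re • K.toR x + c.im • K.j (K.toR x)) + (d.re • K.toR x + d.im • K.j (K.toR x)) by
    simp only [Complex.add_re, Complex.add_im]
    module
  zero_smul x := show (0 : ℂ).re • K.toR x + (0 : ℂ).im • K.j (K.toR x) = 0 by simp

lemma toR_smul (c : ℂ) (x : K.Space) :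
    K.toR (c • x) = c.re • K.toR x + c.im • K.j (K.toR x) := rfl

lemma toR_add (x y : K.Space) : K.toR (x + y) = K.toR x + K.toR y := rfl

lemma norm_toR (x : K.Space) : ‖K.toR x‖ = ‖x‖ := rfl

lemma inner_j_self (x : H) : ⟪x, K.j x⟫_ℝ = 0 := by
  have := K.skew x x
  rw [real_inner_comm] at this
  linarith

instance : InnerProductSpace ℂ K.Space where
  norm_smul_le c x := by
    have e : ‖(c • x : K.Space)‖ ^ 2 = (‖c‖ * ‖x‖) ^ 2 := by
      have h2 : ‖K.j (K.toR x)‖ ^ 2 = ‖K.toR x‖ ^ 2 := by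
        rw [← real_inner_self_eq_norm_sq, K.skew, K.j_j, inner_neg_right, neg_neg,
          real_inner_self_eq_norm_sq]
      rw [← K.norm_toR, ← K.norm_toR, K.toR_smul,
        norm_add_sq_real, norm_smul, norm_smul, mul_pow, mul_pow, h2, inner_smul_left,
        inner_smul_right, K.inner_j_self, mul_pow, Complex.sq_norm, Complex.normSq_apply,
        Real.norm_eq_abs, Real.norm_eq_abs, sq_abs, sq_abs]
      ring
    exact (abs_le_of_sq_le_sq' e.le (by positivity)).2
  inner x y := (⟪K.toR x, K.toR y⟫_ℝ : ℂ) - Complex.I * (⟪K.toR x, K.j (K.toR y)⟫_ℝ : ℂ)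
  norm_sq_eq_re_inner x := by
    rw [K.inner_j_self, real_inner_self_eq_norm_sq, K.norm_toR, Complex.ofReal_zero, mul_zero,
      sub_zero]
    exact (Complex.ofReal_re _).symm
  conj_inner_symm x y := by
    have h1 : ⟪K.toR y, K.j (K.toR x)⟫_ℝ = -⟪K.toR x, K.j (K.toR y)⟫_ℝ := by
      rw [real_inner_comm, K.skew]
    simp [h1, real_inner_comm (K.toR x) (K.toR y), sub_eq_add_neg]
  add_left x y z := by
    simp only [K.toR_add, inner_add_left]
    push_cast
    ring
  smul_left x y c := by
    apply Complex.ext <;>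
      simp [K.toR_smul, inner_add_left, inner_smul_left, K.skew, K.j_j] <;> ring

end KahlerStructure

end RealHilbert

/-! ### The abstract bulk-boundary framework -/

open scoped Topology

section Framework

/-- Restriction of continuous functionals to a subspace. -/
def restrictDual {X : Type*} [AddCommGroup X] [Module ℝ X] [TopologicalSpace X]
    (Y : Submodule ℝ X) (u : WeakDual ℝ X) : WeakDual ℝ Y :=
  StrongDual.toWeakDual ((WeakDual.toStrongDual u).comp Y.subtypeL)

/-- The data: a real topological vector space `X` with a symplectic form `σ`, a subspace
`X_bulk` of `X`, a topological vector space `Xbd`, a linear map `∂ : X_bulk' → Xbd'` whose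
restriction to `X'` is continuous (all duals carry the weak* topology), and a strictly positive
symmetric form `η : X → X'` which is a quasi-free covariance for `σ`: the last inequality is the
condition for `W(v) ↦ e^{-½ η(v, v)}` to define a state on the Weyl algebra with the relations
`W(v) W(w) = e^{-(i/2) σ(v, w)} W(v + w)`. -/
structure BulkBoundary (X Xbd : Type*) [AddCommGroup X] [Module ℝ X] [TopologicalSpace X]
    [AddCommGroup Xbd] [Module ℝ Xbd] [TopologicalSpace Xbd] where
  σ : X →ₗ[ℝ] X →ₗ[ℝ] ℝ
  σ_alt : ∀ v, σ v v = 0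
  σ_nondegenerate : ∀ v, (∀ w, σ v w = 0) → v = 0
  bulk : Submodule ℝ X
  bdry : WeakDual ℝ bulk →ₗ[ℝ] WeakDual ℝ Xbd
  bdry_continuous : Continuous fun u : WeakDual ℝ X => bdry (restrictDual bulk u)
  η : X →ₗ[ℝ] WeakDual ℝ X
  η_symm : ∀ v w, η v w = η w v
  η_pos : ∀ v, v ≠ 0 → 0 < η v v
  abs_σ_le : ∀ v w, |σ v w| ≤ 2 * (√(η v v) * √(η w w))

namespace BulkBoundary

variable {X Xbd : Type*} [AddCommGroup X] [Module ℝ X] [TopologicalSpace X]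
  [AddCommGroup Xbd] [Module ℝ Xbd] [TopologicalSpace Xbd] (F : BulkBoundary X Xbd)

/-- The space `X` with the scalar product `η`. -/
def Pre (_F : BulkBoundary X Xbd) : Type _ := X

instance : AddCommGroup F.Pre := inferInstanceAs (AddCommGroup X)

instance : Module ℝ F.Pre := inferInstanceAs (Module ℝ X)

/-- The identity map `X → F.Pre`. -/
def toPre : X ≃ₗ[ℝ] F.Pre := LinearEquiv.refl ℝ X

lemma η_self_nonneg (v : X) : 0 ≤ F.η v v := by
  by_cases hv : v = 0
  · simp [hv]
  · exact (F.η_pos v hv).le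

/-- The scalar product `η`. -/
@[reducible]
def preCore : InnerProductSpace.Core ℝ F.Pre where
  inner v w := F.η (F.toPre.symm v) (F.toPre.symm w)
  conj_inner_symm v w := F.η_symm _ _
  re_inner_nonneg v := F.η_self_nonneg _
  add_left u v w := by
    rw [map_add, map_add]
    rfl
  smul_left v w r := by
    rw [map_smul, map_smul]
    rfl
  definite v hv := by
    by_contra hne
    exact (F.η_pos v hne).ne' hv

instance : NormedAddCommGroup F.Pre :=
  @InnerProductSpace.Core.toNormedAddCommGroup ℝ F.Pre _ _ _ F.preCore

instance : InnerProductSpace ℝ F.Pre := InnerProductSpace.ofCore F.preCore.toCore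

lemma inner_toPre (v w : X) : ⟪F.toPre v, F.toPre w⟫_ℝ = F.η v w := rfl

lemma norm_toPre (v : X) : ‖F.toPre v‖ = √(F.η v v) := rfl

/-- The completion `X^cpl` of `X` with respect to `η`, a real Hilbert space whose scalar product is
the extension `η^cpl` of `η`. -/
abbrev Cpl : Type _ := UniformSpace.Completion F.Pre

/-- The embedding `X → X^cpl`. -/
def emb : X →ₗ[ℝ] F.Cpl :=
  (UniformSpace.Completion.toComplL (𝕜 := ℝ) (E := F.Pre)).toLinearMap ∘ₗ F.toPre.toLinearMap

lemma inner_emb (v w : X) : ⟪F.emb v, F.emb w⟫_ℝ = F.η v w :=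
  UniformSpace.Completion.inner_coe (𝕜 := ℝ) (F.toPre v) (F.toPre w)

lemma norm_emb (v : X) : ‖F.emb v‖ = √(F.η v v) :=
  UniformSpace.Completion.norm_coe (F.toPre v)

/-- The form `σ` as a bounded form on `(X, η)`. -/
def preσ : F.Pre →L[ℝ] F.Pre →L[ℝ] ℝ :=
  LinearMap.mkContinuous₂
    ((F.σ.compl₁₂ F.toPre.symm.toLinearMap F.toPre.symm.toLinearMap :
      F.Pre →ₗ[ℝ] F.Pre →ₗ[ℝ] ℝ)) 2 fun v w => by
    rw [mul_assoc]
    exact F.abs_σ_le (F.toPre.symm v) (F.toPre.symm w)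

/-- The bounded extension `σ^cpl` of `σ` to `X^cpl`, extending in the first argument and then in
the second. -/
def σcpl : F.Cpl →L[ℝ] F.Cpl →L[ℝ] ℝ :=
  ((F.preσ.extend (UniformSpace.Completion.toComplL (𝕜 := ℝ) (E := F.Pre))).flip.extend
    (UniformSpace.Completion.toComplL (𝕜 := ℝ) (E := F.Pre))).flip

lemma σcpl_emb (v w : X) : F.σcpl (F.emb v) (F.emb w) = F.σ v w := by
  have hd : DenseRange (UniformSpace.Completion.toComplL (𝕜 := ℝ) (E := F.Pre)) :=
    UniformSpace.Completion.denseRange_coe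
  have hu : IsUniformInducing (UniformSpace.Completion.toComplL (𝕜 := ℝ) (E := F.Pre)) :=
    UniformSpace.Completion.isUniformInducing_coe _
  have h1 := ContinuousLinearMap.extend_eq
    (F.preσ.extend (UniformSpace.Completion.toComplL (𝕜 := ℝ) (E := F.Pre))).flip hd hu (F.toPre w)
  have h2 := ContinuousLinearMap.extend_eq F.preσ hd hu (F.toPre v)
  change (ContinuousLinearMap.extend
    (F.preσ.extend (UniformSpace.Completion.toComplL (𝕜 := ℝ) (E := F.Pre))).flip
    (UniformSpace.Completion.toComplL (𝕜 := ℝ) (E := F.Pre)))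
    (UniformSpace.Completion.toComplL (𝕜 := ℝ) (E := F.Pre) (F.toPre w))
    (UniformSpace.Completion.toComplL (𝕜 := ℝ) (E := F.Pre) (F.toPre v)) = _
  rw [h1, ContinuousLinearMap.flip_apply, h2]
  rfl

/-- `σ^cpl` as a bilinear form. -/
def σform : F.Cpl →ₗ[ℝ] F.Cpl →ₗ[ℝ] ℝ := F.σcpl.toLinearMap₁₂

/-- The kernel of `σ^cpl`. -/
def kerσ : Submodule ℝ F.Cpl := LinearMap.ker F.σform

/-- The bounded operator `b` with `σ^cpl = 2 η^cpl b`, i.e. `σ^cpl(x, y) = 2 ⟨x, b y⟩`. -/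
def b : F.Cpl →L[ℝ] F.Cpl :=
  InnerProductSpace.continuousLinearMapOfBilin ((2⁻¹ : ℝ) • F.σcpl.flip)

lemma σcpl_eq (x y : F.Cpl) : F.σcpl x y = 2 * ⟪x, F.b y⟫_ℝ := by
  rw [real_inner_comm, b, InnerProductSpace.continuousLinearMapOfBilin_apply]
  simp

lemma inner_b (x y : F.Cpl) : ⟪F.b x, y⟫_ℝ = -⟪x, F.b y⟫_ℝ := by
  have key : ∀ x y : F.Cpl, F.σcpl x y = -F.σcpl y x := by
    intro x y
    refine UniformSpace.Completion.induction_on₂ x y ?_ fun v w => ?_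
    · exact isClosed_eq (by fun_prop) (by fun_prop)
    · have h1 := F.σcpl_emb (F.toPre.symm v) (F.toPre.symm w)
      have h2 := F.σcpl_emb (F.toPre.symm w) (F.toPre.symm v)
      have h3 := F.σ_alt (F.toPre.symm v + F.toPre.symm w)
      simp only [map_add, LinearMap.add_apply, F.σ_alt] at h3
      change F.σcpl (F.emb (F.toPre.symm v)) (F.emb (F.toPre.symm w)) =
        -F.σcpl (F.emb (F.toPre.symm w)) (F.emb (F.toPre.symm v))
      rw [h1, h2]
      linarith
  have h := key y x
  rw [F.σcpl_eq, F.σcpl_eq, real_inner_comm] at h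
  linarith

lemma continuous_emb [IsTopologicalAddGroup X] [BarrelledSpace ℝ X] : Continuous F.emb := by
  have hp : ∀ v : X, ((normSeminorm ℝ F.Cpl).comp F.emb) v = ‖F.emb v‖ := fun v => rfl
  have hlsc : LowerSemicontinuous ((normSeminorm ℝ F.Cpl).comp F.emb) := by
    rw [lowerSemicontinuous_iff_isClosed_preimage]
    intro a
    rcases lt_or_ge a 0 with ha | ha
    · convert! isClosed_empty
      ext v
      simp only [Set.mem_preimage, Set.mem_Iic, hp, Set.mem_empty_iff_false, iff_false, not_le]
      exact ha.trans_le (norm_nonneg _)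
    · have : ((normSeminorm ℝ F.Cpl).comp F.emb) ⁻¹' Set.Iic a =
          ⋂ w : X, {v | |F.η w v| ≤ ‖F.emb w‖ * a} := by
        ext v
        simp only [Set.mem_preimage, Set.mem_Iic, hp, Set.mem_iInter, Set.mem_ofPred_eq]
        constructor
        · intro hv w
          rw [← F.inner_emb]
          exact (abs_real_inner_le_norm _ _).trans
            (mul_le_mul_of_nonneg_left hv (norm_nonneg _))
        · intro hv
          have h1 := hv v
          rw [← F.inner_emb, real_inner_self_eq_norm_sq, abs_of_nonneg (sq_nonneg _), sq] at h1
          rcases (norm_nonneg (F.emb v)).eq_or_lt with h0 | h0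
          · rw [← h0]; exact ha
          · exact le_of_mul_le_mul_left h1 h0
      rw [this]
      refine isClosed_iInter fun w => isClosed_le ?_ continuous_const
      exact ((WeakDual.toStrongDual (F.η w)).continuous).abs
  have hc := Seminorm.continuous_of_lowerSemicontinuous _ hlsc
  refine continuous_of_continuousAt_zero F.emb.toAddMonoidHom ?_
  have h0 := hc.tendsto 0
  rw [map_zero] at h0
  change Filter.Tendsto F.emb (𝓝 0) (𝓝 (F.emb 0))
  rw [map_zero]
  exact tendsto_zero_iff_norm_tendsto_zero.2 h0

section Boundary

variable [IsTopologicalAddGroup X] [BarrelledSpace ℝ X]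

/-- The functional `η^cpl u ∈ X'`, `v ↦ η^cpl(u, v)`, for `u ∈ X^cpl`. -/
def ηcpl (u : F.Cpl) : WeakDual ℝ X :=
  StrongDual.toWeakDual ((innerSL ℝ u).comp ⟨F.emb, F.continuous_emb⟩)

/-- The functional `u ↦ (f · ∂ η^cpl u)` on `X^cpl`, for `f ∈ Xbd`. -/
def bdryFunctional (f : Xbd) : StrongDual ℝ F.Cpl where
  toFun u := F.bdry (restrictDual F.bulk (F.ηcpl u)) f
  map_add' u v := by
    have : restrictDual F.bulk (F.ηcpl (u + v)) =
        restrictDual F.bulk (F.ηcpl u) + restrictDual F.bulk (F.ηcpl v) := by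
      refine DFunLike.ext _ _ fun w => ?_
      exact inner_add_left (𝕜 := ℝ) u v (F.emb w)
    rw [this, map_add]
    rfl
  map_smul' c u := by
    have : restrictDual F.bulk (F.ηcpl (c • u)) = c • restrictDual F.bulk (F.ηcpl u) := by
      refine DFunLike.ext _ _ fun w => ?_
      exact real_inner_smul_left u (F.emb w) c
    rw [this, map_smul]
    rfl
  cont := by
    have h1 : Continuous F.ηcpl := by
      refine WeakDual.continuous_of_continuous_eval fun v => ?_
      change Continuous fun u : F.Cpl => ⟪u, F.emb v⟫_ℝ
      fun_prop
    exact (WeakDual.eval_continuous f).comp (F.bdry_continuous.comp h1)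

/-- The element `∂' f` of `X^cpl`, for `f ∈ Xbd`: it is characterized by
`η^cpl(∂' f, u) = (f · ∂ η^cpl u)` for all `u ∈ X^cpl`. -/
def bdryDual (f : Xbd) : F.Cpl := (InnerProductSpace.toDual ℝ F.Cpl).symm (F.bdryFunctional f)

lemma inner_bdryDual (f : Xbd) (u : F.Cpl) :
    ⟪F.bdryDual f, u⟫_ℝ = F.bdry (restrictDual F.bulk (F.ηcpl u)) f :=
  InnerProductSpace.toDual_symm_apply

end Boundary

/-! ### The Kay-Wald representation -/

/-- A Kähler anti-involution `j` on `X^cpl` obtained from the polar decomposition `b = -j |b|`. On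
the orthogonal complement of `ker b` it is determined by `b`, on `ker b` it is arbitrary. -/
structure KayWald extends KahlerStructure F.Cpl where
  polar : F.b = -(j ∘L opAbs F.b)

namespace KayWald

variable {F} (K : F.KayWald)

lemma abs_j (x : F.Cpl) : opAbs F.b (K.j x) = K.j (opAbs F.b x) := by
  have hb : ∀ x, F.b x = -K.j (opAbs F.b x) := fun x => by
    conv_lhs => rw [K.polar]
    rfl
  refine ext_inner_right ℝ fun y => ?_
  have h1 : ⟪K.j (opAbs F.b x), y⟫_ℝ = ⟪x, F.b y⟫_ℝ := by
    have := F.inner_b x y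
    rw [hb x, inner_neg_left] at this
    linarith
  rw [h1, hb y, inner_neg_right, ← K.skew]
  exact posSqrt_isSymmetric _ _ _

/-- The range of `1_{ℝ∖{1}}(|b|)` in the conjugate space, i.e. the orthogonal complement of the
eigenspace of `|b|` for the eigenvalue `1`. -/
def eigenOne : Submodule ℂ K.toKahlerStructure.conj.Space where
  carrier := {x | opAbs F.b (K.toKahlerStructure.conj.toR x) = K.toKahlerStructure.conj.toR x}
  add_mem' {x y} hx hy := by
    simp only [Set.mem_ofPred_eq, KahlerStructure.toR_add, map_add] at hx hy ⊢
    rw [hx, hy]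
  zero_mem' := map_zero _
  smul_mem' c x hx := by
    simp only [Set.mem_ofPred_eq, KahlerStructure.toR_smul, map_add, map_smul] at hx ⊢
    have : ∀ z, K.toKahlerStructure.conj.j z = -K.j z := fun z => rfl
    rw [this, map_neg, K.abs_j, hx]

/-- The one-particle space `X_KW ⊕ 1_{ℝ∖{1}}(|b|) X̄_KW`. -/
abbrev oneParticle : Type _ := WithLp 2 (K.toKahlerStructure.Space × K.eigenOneᗮ)

/-- The bounded operator `(1 + |b|)^{1/2}` on `X^cpl`. -/
def sqrtPlus (F : BulkBoundary X Xbd) : F.Cpl →L[ℝ] F.Cpl := posSqrt (1 + opAbs F.b)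

/-- The bounded operator `(1 - |b|)^{1/2}` on `X^cpl`. -/
def sqrtMinus (F : BulkBoundary X Xbd) : F.Cpl →L[ℝ] F.Cpl := posSqrt (1 - opAbs F.b)

lemma sqrtMinus_mem (v : F.Cpl) :
    K.toKahlerStructure.conj.toC (sqrtMinus F v) ∈ K.eigenOneᗮ := by
  have h0 : ∀ x : K.toKahlerStructure.conj.Space, x ∈ K.eigenOne →
      ⟪K.toKahlerStructure.conj.toR x, sqrtMinus F v⟫_ℝ = 0 := by
    intro x hx
    have hx' : opAbs F.b (K.toKahlerStructure.conj.toR x) = K.toKahlerStructure.conj.toR x := hx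
    rw [sqrtMinus, ← posSqrt_isSymmetric, posSqrt_eq_zero, inner_zero_left]
    simp [hx']
  rw [Submodule.mem_orthogonal]
  intro x hx
  have h1 := h0 x hx
  have h2 := h0 _ (K.eigenOne.smul_mem Complex.I hx)
  rw [KahlerStructure.toR_smul] at h2
  simp only [Complex.I_re, Complex.I_im, zero_smul, one_smul, zero_add] at h2
  rw [K.toKahlerStructure.conj.skew] at h2
  change (⟪K.toKahlerStructure.conj.toR x, sqrtMinus F v⟫_ℝ : ℂ) - Complex.I *
    (⟪K.toKahlerStructure.conj.toR x, K.toKahlerStructure.conj.j (sqrtMinus F v)⟫_ℝ : ℂ) = 0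
  rw [h1, neg_eq_zero.1 h2]
  simp

/-- The one-particle vector `(1 + |b|)^{1/2} v ⊕ (1 - |b|)^{1/2} v̄`. -/
def vec (v : F.Cpl) : K.oneParticle :=
  WithLp.toLp 2 (K.toKahlerStructure.toC (sqrtPlus F v),
    ⟨K.toKahlerStructure.conj.toC (sqrtMinus F v), K.sqrtMinus_mem v⟩)

/-- The Kay-Wald Hilbert space `Γ(X_KW ⊕ 1_{ℝ∖{1}}(|b|) X̄_KW)`. -/
abbrev Space : Type _ := Fock K.oneParticle

/-- The unitary `e^{i φ_KW(v)}`, where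
`φ_KW(v) = φ_F((1 + |b|)^{1/2} v ⊕ (1 - |b|)^{1/2} v̄)`. -/
def weyl (v : F.Cpl) : K.Space →L[ℂ] K.Space := weylF (K.vec v)

end KayWald

/-- The algebra `CCR(X^cpl, σ^cpl)`. -/
abbrev Algebra : StarSubalgebra ℂ (lp (fun _ : F.Cpl => ℂ) 2 →L[ℂ] lp (fun _ : F.Cpl => ℂ) 2) :=
  CCR F.σform

/-- The `C*`-subalgebra `CCR(X_bulk, σ)` of `CCR(X^cpl, σ^cpl)`, with `X_bulk ⊆ X ⊆ X^cpl`. -/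
def bulkAlgebra : StarSubalgebra ℂ F.Algebra := CCR.sub F.σform (F.bulk.map F.emb)

/-- The boundary von Neumann algebra `{e^{i φ_KW(∂' f)} | f ∈ Xbd}''`. -/
def boundaryVN [IsTopologicalAddGroup X] [BarrelledSpace ℝ X] {F : BulkBoundary X Xbd}
    (K : F.KayWald) : Set (K.Space →L[ℂ] K.Space) :=
  Set.centralizer (Set.centralizer (Set.range fun f : Xbd => K.weyl (F.bdryDual f)))

end BulkBoundary

end Framework

end

open scoped InnerProductSpace Topology

noncomputable section

/-! ### Square roots of positive operators on real Hilbert spaces -/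

section SquareRoot

/-! The inclusion of von Neumann algebras rests on a density statement in `F.Cpl`. If `u` is
orthogonal to every `∂' f`, then `∂` kills the restriction of `η^cpl u` to the bulk, so by
injectivity `η^cpl u` vanishes on the bulk, which means that `u` is orthogonal to the bulk. Hence
the bulk lies in the closure of the range of `∂'` (`emb_mem_closure_range_bdryDual`). Fock Weyl
operators depend strongly continuously on their one-particle vector (`continuous_weylF_apply`), so
whatever commutes with the boundary Weyl operators commutes with the bulk ones, and then with the
`C*`-algebra they generate. Taking commutants reverses the inclusion.

The remaining work constructs the objects. The anti-involution `j` is the polar part of the skew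
operator `b` off its kernel, completed on the kernel by pairing the vectors of a Hilbert basis
(`exists_polar`, `nonempty_kahlerStructure`). Square roots on a real Hilbert space come from a power
series with Catalan coefficients (`exists_isPositive_sqrt`), which also gives their commutation
properties. Field operators are symmetric and every finite particle vector is entire for them. An
iterated integral bound (`eq_zero_of_hasDerivAt`) turns this into uniqueness of the exponential, its
group law and, from the commutation relations, the Weyl relations (`IsEntireSymmetric.exp_mul_exp`).
The phase on Fock space is `σ^cpl` because the contributions of `1 + |b|` and `1 - |b|` combine to
`2 |b|` (`im_inner_vec`). Finally, a representation of the Weyl relations extends from linear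
combinations of Weyl operators to the CCR algebra because the regular representation has the largest
norm, a Følner-type argument on sets of polynomial growth
(`IsWeylRepresentation.norm_linearCombination_le`). -/

lemma sum_catalan_div_four_pow_le (N : ℕ) :
    ∑ i ∈ Finset.range N, (catalan i : ℝ) * (1 / 4) ^ i ≤ 2 := by
  set c : ℕ → ℝ := fun i => (catalan i : ℝ) * (1 / 4) ^ i with hc
  have hc0 : ∀ i, 0 ≤ c i := fun i => by positivity
  change ∑ i ∈ Finset.range N, c i ≤ 2
  induction N with
  | zero => simp
  | succ N ih =>
    -- The Catalan recursion bounds the partial sums by `s (N + 1) ≤ 1 + s N ^ 2 / 4`, and `2` is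
    -- the fixed point of `s ↦ 1 + s ^ 2 / 4`.
    have hrec : ∀ n, c (n + 1) = 1 / 4 * ∑ p ∈ Finset.HasAntidiagonal.antidiagonal n, c p.1 * c p.2 := by
      intro n
      simp only [hc, catalan_succ']
      push_cast
      rw [pow_succ, Finset.mul_sum, Finset.sum_mul]
      refine Finset.sum_congr rfl fun p hp => ?_
      rw [← Finset.HasAntidiagonal.mem_antidiagonal.1 hp, pow_add]
      ring
    have hsq : ∑ n ∈ Finset.range N, ∑ p ∈ Finset.HasAntidiagonal.antidiagonal n, c p.1 * c p.2 ≤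
        (∑ i ∈ Finset.range N, c i) * ∑ i ∈ Finset.range N, c i := by
      rw [Finset.sum_mul_sum, ← Finset.sum_product', ← Finset.sum_biUnion]
      · refine Finset.sum_le_sum_of_subset_of_nonneg ?_ fun p _ _ => mul_nonneg (hc0 _) (hc0 _)
        intro p hp
        simp only [Finset.mem_biUnion, Finset.mem_range, Finset.HasAntidiagonal.mem_antidiagonal,
          Finset.mem_product] at hp ⊢
        obtain ⟨n, hn, rfl⟩ := hp
        omega
      · intro m _ n _ hmn
        refine Finset.disjoint_left.2 fun p hp hp' => hmn ?_
        rw [← Finset.HasAntidiagonal.mem_antidiagonal.1 hp, ← Finset.HasAntidiagonal.mem_antidiagonal.1 hp']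
    have h0 : 0 ≤ ∑ i ∈ Finset.range N, c i := Finset.sum_nonneg fun i _ => hc0 i
    rw [Finset.sum_range_succ', Finset.sum_congr rfl fun n _ => hrec n, ← Finset.mul_sum]
    have : c 0 = 1 := by simp [hc]
    rw [this]
    nlinarith

lemma summable_catalan_div_four_pow : Summable fun n : ℕ => (catalan n : ℝ) * (1 / 4) ^ n :=
  summable_of_sum_range_le (fun n => by positivity) sum_catalan_div_four_pow_le

variable {H : Type*} [NormedAddCommGroup H] [InnerProductSpace ℝ H]

lemma norm_pow_le_of_norm_le {T : H →L[ℝ] H} {r : ℝ} (hT : ‖T‖ ≤ r) (n : ℕ) :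
    ‖T ^ n‖ ≤ r ^ n := by
  induction n with
  | zero => simpa using! ContinuousLinearMap.norm_id_le
  | succ n ih =>
    rw [pow_succ, pow_succ]
    exact (norm_mul_le _ _).trans (mul_le_mul ih hT (norm_nonneg _) ((norm_nonneg _).trans ih))

lemma ContinuousLinearMap.isPositive_of_isSymmetric_of_norm_le {T : H →L[ℝ] H}
    (hT : (T : H →ₗ[ℝ] H).IsSymmetric) (h1 : ‖T‖ ≤ 1) : (1 - T).IsPositive := by
  rw [ContinuousLinearMap.isPositive_iff]
  refine ⟨fun x y => ?_, fun x => ?_⟩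
  · have := hT x y
    simp only [ContinuousLinearMap.coe_coe] at this
    simp [inner_sub_left, inner_sub_right, this]
  · have h2 : ⟪T x, x⟫_ℝ ≤ ‖x‖ * ‖x‖ :=
      (real_inner_le_norm _ _).trans (mul_le_mul_of_nonneg_right
        ((T.le_opNorm x).trans (mul_le_of_le_one_left (norm_nonneg _) h1)) (norm_nonneg _))
    simp only [sub_apply, one_apply_eq_self, inner_sub_left,
      real_inner_self_eq_norm_mul_norm]
    linarith

lemma eq_zero_of_pow_three {D : H →L[ℝ] H} (hD : ∀ x y, ⟪D x, y⟫_ℝ = ⟪x, D y⟫_ℝ)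
    (h3 : ∀ x, D (D (D x)) = 0) : D = 0 := by
  have h2 : ∀ x, D (D x) = 0 := fun x => by
    rw [← inner_self_eq_zero (𝕜 := ℝ), hD, h3, inner_zero_right]
  refine ContinuousLinearMap.ext fun x => ?_
  change D x = 0
  rw [← inner_self_eq_zero (𝕜 := ℝ), hD, h2, inner_zero_right]

/-- Positivity at `x - t S x` gives a quadratic in `t` with zero constant term and linear
coefficient `-2 ‖S x‖²`; it would be negative for small `t > 0` unless `S x = 0`. -/
lemma ContinuousLinearMap.IsPositive.apply_eq_zero {S : H →L[ℝ] H} (hS : S.IsPositive) {x : H}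
    (hx : ⟪S x, x⟫_ℝ = 0) : S x = 0 := by
  rw [← inner_self_eq_zero (𝕜 := ℝ)]
  by_contra hne
  have hsym : ∀ u v, ⟪S u, v⟫_ℝ = ⟪u, S v⟫_ℝ := hS.1
  set p : ℝ := ⟪S x, S x⟫_ℝ
  set q : ℝ := ⟪S (S x), S x⟫_ℝ
  have hp : 0 < p := lt_of_le_of_ne real_inner_self_nonneg (Ne.symm hne)
  have hq : 0 ≤ q := hS.inner_nonneg_left _
  have key : ∀ t : ℝ, 0 ≤ -(2 * t * p) + t ^ 2 * q := fun t => by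
    have h := hS.inner_nonneg_left (x - t • S x)
    have e : ⟪S (S x), x⟫_ℝ = p := hsym _ _
    simp only [map_sub, map_smul, inner_sub_left, inner_sub_right, inner_smul_left,
      inner_smul_right, hx, e] at h
    change 0 ≤ 0 - t * p - t * (p - t * q) at h
    linarith
  -- The minimiser would be `p / q`; using `q + 1` also covers `q = 0`.
  have h := key (p / (q + 1))
  have hq1 : 0 < q + 1 := by linarith
  have e : -(2 * (p / (q + 1)) * p) + (p / (q + 1)) ^ 2 * q =
      -(p ^ 2 * (q + 2)) / (q + 1) ^ 2 := by
    field_simp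
    ring
  rw [e] at h
  have : -(p ^ 2 * (q + 2)) / (q + 1) ^ 2 < 0 :=
    div_neg_of_neg_of_pos (neg_neg_of_pos (by positivity)) (by positivity)
  linarith

/-- Uniqueness of positive square roots. -/
lemma ContinuousLinearMap.IsPositive.eq_of_comp_self_eq {R S : H →L[ℝ] H} (hR : R.IsPositive)
    (hS : S.IsPositive) (hRS : Commute S R) (h : S ∘L S = R ∘L R) : S = R := by
  have hc : ∀ x, S (R x) = R (S x) := fun x => congrArg (fun T : H →L[ℝ] H => T x) hRS.eq
  have h2 : ∀ x, S (S x) = R (R x) := fun x => congrArg (fun T : H →L[ℝ] H => T x) h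
  have hD : ∀ x y, ⟪(S - R) x, y⟫_ℝ = ⟪x, (S - R) y⟫_ℝ := fun x y => by
    have h3 : ⟪S x, y⟫_ℝ = ⟪x, S y⟫_ℝ := hS.1 x y
    have h4 : ⟪R x, y⟫_ℝ = ⟪x, R y⟫_ℝ := hR.1 x y
    simp [inner_sub_left, inner_sub_right, h3, h4]
  -- By commutation `(S + R)(S - R) = S² - R² = 0`. Pairing with `(S - R) x` leaves a sum of two
  -- nonnegative terms, so both vanish.
  have hsum : ∀ x, S ((S - R) x) + R ((S - R) x) = 0 := fun x => by
    simp only [sub_apply, map_sub, hc, h2]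
    abel
  have hz : ∀ x, S ((S - R) x) = 0 ∧ R ((S - R) x) = 0 := fun x => by
    have e := congrArg (fun z => ⟪z, (S - R) x⟫_ℝ) (hsum x)
    simp only [inner_add_left, inner_zero_left] at e
    have p1 := hS.inner_nonneg_left ((S - R) x)
    have p2 := hR.inner_nonneg_left ((S - R) x)
    exact ⟨hS.apply_eq_zero (by linarith), hR.apply_eq_zero (by linarith)⟩
  refine sub_eq_zero.1 (eq_zero_of_pow_three hD fun x => ?_)
  rw [sub_apply, (hz _).1, (hz _).2, sub_zero]

lemma ContinuousLinearMap.isSymmetric_tsum {f : ℕ → H →L[ℝ] H} (hf : Summable f)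
    (hs : ∀ n, (f n : H →ₗ[ℝ] H).IsSymmetric) :
    ((∑' n, f n : H →L[ℝ] H) : H →ₗ[ℝ] H).IsSymmetric := by
  intro x y
  have h1 : HasSum (fun n => ⟪f n x, y⟫_ℝ) ⟪(∑' n, f n) x, y⟫_ℝ := by
    have := (ContinuousLinearMap.apply ℝ H x).hasSum hf.hasSum
    have := (innerSL ℝ y).hasSum this
    simpa [real_inner_comm] using this
  have h2 : HasSum (fun n => ⟪x, f n y⟫_ℝ) ⟪x, (∑' n, f n) y⟫_ℝ := by
    have := (ContinuousLinearMap.apply ℝ H y).hasSum hf.hasSum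
    exact (innerSL ℝ x).hasSum this
  have e : (fun n => ⟪f n x, y⟫_ℝ) = fun n => ⟪x, f n y⟫_ℝ := funext fun n => hs n x y
  rw [e] at h1
  exact h1.unique h2

variable [CompleteSpace H]

/-- The binomial series of the square root. -/
lemma exists_isPositive_sqrt {A : H →L[ℝ] H} (hA : (A : H →ₗ[ℝ] H).IsSymmetric)
    (h1 : ‖1 - A‖ ≤ 1) : ∃ R : H →L[ℝ] H, R.IsPositive ∧ R ∘L R = A ∧
      ∀ T : H →L[ℝ] H, Commute T A → Commute T R := by
  -- The Catalan generating function `Z` satisfies `Z = 1 + Y Z²`, so `(1 - 2 Y Z)² = 1 - 4 Y (Z - Y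
  -- Z²) = 1 - 4 Y = A`. The bounds `‖Y‖ ≤ 1/4` and `‖Z‖ ≤ 2` make `2 Y Z` a contraction, whence `1
  -- - 2 Y Z` is positive.
  set Y : H →L[ℝ] H := (4⁻¹ : ℝ) • (1 - A) with hY
  have hYn : ‖Y‖ ≤ 1 / 4 := by
    rw [hY, norm_smul]
    norm_num
    linarith
  have hYs : ∀ n, ((Y ^ n : H →L[ℝ] H) : H →ₗ[ℝ] H).IsSymmetric := by
    have h0 : ∀ x y, ⟪Y x, y⟫_ℝ = ⟪x, Y y⟫_ℝ := fun x y => by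
      have := hA x y
      simp only [ContinuousLinearMap.coe_coe] at this
      simp [hY, inner_sub_left, inner_sub_right, inner_smul_left, inner_smul_right, this]
    intro n
    induction n with
    | zero => exact fun x y => rfl
    | succ n ih =>
      intro x y
      have h2 := ih (Y x) y
      simp only [ContinuousLinearMap.coe_coe] at h2
      simp only [ContinuousLinearMap.coe_coe]
      rw [pow_succ, mul_apply_eq_comp, h2, h0, ← mul_apply_eq_comp,
        ← pow_succ', ← pow_succ]
  set f : ℕ → H →L[ℝ] H := fun n => (catalan n : ℝ) • Y ^ n with hf
  have hfn : ∀ n, ‖f n‖ ≤ (catalan n : ℝ) * (1 / 4) ^ n := fun n => by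
    rw [hf, norm_smul, Real.norm_natCast]
    exact mul_le_mul_of_nonneg_left (norm_pow_le_of_norm_le hYn n) (Nat.cast_nonneg _)
  have hfs : Summable fun n => ‖f n‖ :=
    Summable.of_nonneg_of_le (fun _ => norm_nonneg _) hfn summable_catalan_div_four_pow
  set Z : H →L[ℝ] H := ∑' n, f n with hZ
  have hZn : ‖Z‖ ≤ 2 :=
    (tsum_of_norm_bounded summable_catalan_div_four_pow.hasSum hfn).trans
      (summable_catalan_div_four_pow.tsum_le_of_sum_range_le sum_catalan_div_four_pow_le)
  have hZY : Commute Y Z := Commute.tsum_right _ fun n =>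
    ((Commute.refl Y).pow_right n).smul_right _
  have hfY : ∀ n, Y * ∑ p ∈ Finset.HasAntidiagonal.antidiagonal n, f p.1 * f p.2 = f (n + 1) := by
    intro n
    simp only [hf, catalan_succ']
    push_cast
    rw [Finset.mul_sum, Finset.sum_smul]
    refine Finset.sum_congr rfl fun p hp => ?_
    rw [smul_mul_smul_comm, ← pow_add, Finset.HasAntidiagonal.mem_antidiagonal.1 hp, mul_smul_comm, pow_succ']
  have hZZ : Z = 1 + Y * (Z * Z) := by
    conv_lhs => rw [hZ, hfs.of_norm.tsum_eq_zero_add]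
    rw [hZ, tsum_mul_tsum_eq_tsum_sum_antidiagonal_of_summable_norm hfs hfs,
      ← (summable_norm_sum_mul_antidiagonal_of_summable_norm hfs hfs).of_norm.tsum_mul_left]
    simp only [hfY]
    simp [hf]
  have hYZs : ((((2 : ℝ) • (Y * Z) : H →L[ℝ] H)) : H →ₗ[ℝ] H).IsSymmetric := by
    have hZs := ContinuousLinearMap.isSymmetric_tsum hfs.of_norm fun n x y => by
      have h5 : ⟪(Y ^ n) x, y⟫_ℝ = ⟪x, (Y ^ n) y⟫_ℝ := hYs n x y
      change ⟪(catalan n : ℝ) • (Y ^ n) x, y⟫_ℝ = ⟪x, (catalan n : ℝ) • (Y ^ n) y⟫_ℝ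
      rw [real_inner_smul_left, real_inner_smul_right, h5]
    intro x y
    have h2 := hZs x (Y y)
    have h3 := hYs 1 (Z x) y
    have h4 : Z (Y y) = Y (Z y) := by
      rw [← mul_apply_eq_comp, ← mul_apply_eq_comp, hZY.eq]
    simp only [ContinuousLinearMap.coe_coe, pow_one] at h2 h3
    simp only [ContinuousLinearMap.coe_coe, smul_apply,
      mul_apply_eq_comp, inner_smul_left, inner_smul_right]
    rw [h3, h2, h4]
    rfl
  have hYZn : ‖(2 : ℝ) • (Y * Z)‖ ≤ 1 := by
    rw [norm_smul, Real.norm_ofNat]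
    have := (norm_mul_le Y Z).trans (mul_le_mul hYn hZn (norm_nonneg _) (by norm_num))
    linarith
  refine ⟨1 - (2 : ℝ) • (Y * Z), ContinuousLinearMap.isPositive_of_isSymmetric_of_norm_le hYZs hYZn,
    ?_, fun T hT => ?_⟩
  · change (1 - (2 : ℝ) • (Y * Z)) * (1 - (2 : ℝ) • (Y * Z)) = A
    have e1 : Y * Z * (Y * Z) = Y * (Z - 1) := by
      conv_rhs => rw [hZZ]
      rw [add_sub_cancel_left, mul_assoc Y Z, ← mul_assoc Z Y Z, ← hZY.eq, mul_assoc Y Z Z]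
    have e2 : A = 1 - (4 : ℝ) • Y := by
      rw [hY, smul_smul]
      norm_num
    rw [mul_sub, sub_mul, sub_mul, smul_mul_smul_comm, e1, mul_sub, e2]
    simp only [mul_one, one_mul]
    module
  · have hTY : Commute T Y := ((Commute.one_right T).sub_right hT).smul_right _
    have hTZ : Commute T Z := Commute.tsum_right _ fun n => (hTY.pow_right n).smul_right _
    exact (Commute.one_right T).sub_right ((hTY.mul_right hTZ).smul_right _)

/-- Rescaling by `c` brings `A` into the range of the binomial series. The root picked by choice
commutes with its own square `A`, hence with the series root, and so equals it by uniqueness; it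
thereby inherits commutation with everything that commutes with `A`. -/
lemma posSqrt_spec {A : H →L[ℝ] H} (hA : (A : H →ₗ[ℝ] H).IsSymmetric) {c : ℝ} (hc : 0 < c)
    (h1 : ‖1 - c⁻¹ • A‖ ≤ 1) :
    (posSqrt A).IsPositive ∧ posSqrt A ∘L posSqrt A = A ∧
      ∀ T : H →L[ℝ] H, Commute T A → Commute T (posSqrt A) := by
  obtain ⟨R, hR, hRR, hRc⟩ : ∃ R : H →L[ℝ] H, R.IsPositive ∧ R ∘L R = A ∧
      ∀ T : H →L[ℝ] H, Commute T A → Commute T R := by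
    obtain ⟨R, hR, hRR, hRc⟩ := exists_isPositive_sqrt (A := c⁻¹ • A) (fun x y => by
      have h2 : ⟪A x, y⟫_ℝ = ⟪x, A y⟫_ℝ := hA x y
      change ⟪c⁻¹ • A x, y⟫_ℝ = ⟪x, c⁻¹ • A y⟫_ℝ
      rw [real_inner_smul_left, real_inner_smul_right, h2]) h1
    refine ⟨√c • R, hR.smul_of_nonneg (Real.sqrt_nonneg c), ?_, fun T hT =>
      (hRc T (hT.smul_right _)).smul_right _⟩
    change (√c • R) * (√c • R) = A
    have h3 : R * R = c⁻¹ • A := hRR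
    rw [smul_mul_smul_comm, Real.mul_self_sqrt hc.le, h3, smul_smul, mul_inv_cancel₀ hc.ne',
      one_smul]
  have hS : ∃ S : H →L[ℝ] H, S.IsPositive ∧ S ∘L S = A := ⟨R, hR, hRR⟩
  have hspec : (posSqrt A).IsPositive ∧ posSqrt A ∘L posSqrt A = A := by
    rw [posSqrt, dif_pos hS]
    exact hS.choose_spec
  refine ⟨hspec.1, hspec.2, ?_⟩
  have hcomm : Commute (posSqrt A) A := by
    conv_rhs => rw [← hspec.2]
    exact (Commute.refl _).mul_right (Commute.refl _)
  rw [hR.eq_of_comp_self_eq hspec.1 (hRc _ hcomm) (hspec.2.trans hRR.symm)]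
  exact hRc

end SquareRoot

/-! ### Existence of Kähler structures -/

section KahlerExistence

lemma memℓp_signed_comp {ι : Type*} (τ : ι ≃ ι) (ε : ι → ℝ) (hε : ∀ i, |ε i| = 1)
    (ψ : lp (fun _ : ι => ℝ) 2) : Memℓp (fun i => ε i * ψ (τ i)) 2 := by
  have h2 : 0 < (2 : ENNReal).toReal := by norm_num
  rw [memℓp_gen_iff h2]
  refine ((τ.summable_iff).2 ((memℓp_gen_iff h2).1 (lp.memℓp ψ))).congr fun i => ?_
  rw [norm_mul, Real.norm_eq_abs (ε i), hε, one_mul]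
  rfl

/-- The isometry `(ψ_i) ↦ (ε_i ψ_{τ i})` of `ℓ²`. -/
def signedPermutation {ι : Type*} (τ : ι ≃ ι) (ε : ι → ℝ) (hε : ∀ i, |ε i| = 1) :
    lp (fun _ : ι => ℝ) 2 →ₗᵢ[ℝ] lp (fun _ : ι => ℝ) 2 where
  toFun ψ := ⟨_, memℓp_signed_comp τ ε hε ψ⟩
  map_add' ψ φ := by
    ext i
    exact mul_add _ _ _
  map_smul' c ψ := by
    ext i
    exact mul_left_comm _ _ _
  norm_map' ψ := by
    have h2 : 0 < (2 : ENNReal).toReal := by norm_num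
    rw [lp.norm_eq_tsum_rpow h2, lp.norm_eq_tsum_rpow h2,
      ← τ.tsum_eq fun i => ‖ψ i‖ ^ (2 : ENNReal).toReal]
    congr 1
    refine tsum_congr fun i => ?_
    simp only [LinearMap.coe_mk, AddHom.coe_mk]
    rw [norm_mul, Real.norm_eq_abs (ε i), hε, one_mul]

/-- A square root of `-1` which is isometric is antisymmetric. -/
def KahlerStructure.ofIsometry {N : Type*} [NormedAddCommGroup N] [InnerProductSpace ℝ N]
    (J : N →ₗᵢ[ℝ] N) (hJ : ∀ x, J (J x) = -x) : KahlerStructure N where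
  j := J.toContinuousLinearMap
  j_j := hJ
  skew x y := by
    have h := J.inner_map_map x (J y)
    rw [hJ, inner_neg_right] at h
    exact neg_eq_iff_eq_neg.1 h

/-- Split the basis into two equinumerous halves and rotate each pair by a right angle: swap the
halves with a sign on one of them. -/
lemma HilbertBasis.nonempty_kahlerStructure {N ι κ : Type*} [NormedAddCommGroup N]
    [InnerProductSpace ℝ N] (B : HilbertBasis ι ℝ N) (e : κ ⊕ κ ≃ ι) :
    Nonempty (KahlerStructure N) := by
  set ε : ι → ℝ := fun i => Sum.elim (fun _ => 1) (fun _ => -1) (e.symm i) with hε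
  set τ : ι ≃ ι := (e.symm.trans (Equiv.sumComm κ κ)).trans e with hτ
  have hε1 : ∀ i, |ε i| = 1 := fun i => by
    rcases h : e.symm i with k | k <;> simp [hε, h]
  have hεε : ∀ i, ε i * ε (τ i) = -1 := fun i => by
    rcases h : e.symm i with k | k <;> simp [hε, hτ, h]
  have hττ : ∀ i, τ (τ i) = i := fun i => by simp [hτ]
  refine ⟨KahlerStructure.ofIsometry ((B.repr.symm.toLinearIsometry.comp
    (signedPermutation τ ε hε1)).comp B.repr.toLinearIsometry) fun x => ?_⟩
  have key : ∀ ψ, signedPermutation τ ε hε1 (signedPermutation τ ε hε1 ψ) = -ψ := fun ψ => by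
    ext i
    change ε i * (ε (τ i) * ψ (τ (τ i))) = -ψ i
    rw [← mul_assoc, hεε, hττ, neg_one_mul]
  simp [key]

lemma nonempty_kahlerStructure {N : Type*} [NormedAddCommGroup N] [InnerProductSpace ℝ N]
    [CompleteSpace N] (h : Even (Module.finrank ℝ N) ∨ ¬ FiniteDimensional ℝ N) :
    Nonempty (KahlerStructure N) := by
  obtain ⟨w, B, -⟩ := exists_hilbertBasis ℝ N
  rcases finite_or_infinite w with hw | hw
  · have := Fintype.ofFinite w
    have hfd : FiniteDimensional ℝ N := B.toOrthonormalBasis.toBasis.finiteDimensional_of_finite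
    obtain ⟨m, hm⟩ := h.resolve_right (not_not.2 hfd)
    rw [Module.finrank_eq_card_basis B.toOrthonormalBasis.toBasis] at hm
    exact B.nonempty_kahlerStructure (κ := Fin m)
      (Fintype.equivOfCardEq (by rw [Fintype.card_sum, Fintype.card_fin, hm]))
  -- For an infinite index set no parity condition is needed, since `κ + κ = κ` for infinite
  -- cardinals.
  · have e : Nonempty (w ⊕ w ≃ w) := by
      rw [← Cardinal.eq, ← Cardinal.add_def]
      exact Cardinal.add_eq_self (Cardinal.aleph0_le_mk w)
    exact B.nonempty_kahlerStructure e.some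

variable {H : Type*} [NormedAddCommGroup H] [InnerProductSpace ℝ H] [CompleteSpace H]

/-- Polar decomposition of an antisymmetric operator `b` with positive part `S`: the partial
isometry `J` with `b = -J S` which vanishes on `ker b`. -/
lemma exists_polar {b S : H →L[ℝ] H} (hb : ∀ x y, ⟪b x, y⟫_ℝ = -⟪x, b y⟫_ℝ)
    (hS : ∀ x y, ⟪S x, y⟫_ℝ = ⟪x, S y⟫_ℝ) (hSS : ∀ x, S (S x) = -b (b x))
    (hSb : ∀ x, S (b x) = b (S x)) :
    ∃ J : H →L[ℝ] H, (∀ x, J (S x) = -b x) ∧ (∀ x, b x = 0 → J x = 0) ∧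
      (∀ x y, ⟪J x, y⟫_ℝ = -⟪x, J y⟫_ℝ) ∧
      ∀ x, (∀ y, b y = 0 → ⟪y, x⟫_ℝ = 0) → J (J x) = -x ∧ ∀ y, b y = 0 → ⟪y, J x⟫_ℝ = 0 := by
  -- Equality of these norms makes `S x ↦ -b x` well defined and isometric on the range of `S`, so
  -- that it extends to the closure `M`.
  have hnorm : ∀ x, ‖b x‖ = ‖S x‖ := fun x => by
    have : ‖b x‖ ^ 2 = ‖S x‖ ^ 2 := by
      rw [← real_inner_self_eq_norm_sq, ← real_inner_self_eq_norm_sq, hb, hS, hSS, inner_neg_right]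
    exact (pow_left_inj₀ (norm_nonneg _) (norm_nonneg _) two_ne_zero).1 this
  have hker : ∀ x, b x = 0 ↔ S x = 0 := fun x => by
    rw [← norm_eq_zero, hnorm, norm_eq_zero]
  set M : Submodule ℝ H := (LinearMap.range S.toLinearMap).topologicalClosure with hM
  have hMc : IsClosed (M : Set H) := Submodule.isClosed_topologicalClosure _
  have : CompleteSpace M := hMc.completeSpace_coe
  have hMker : ∀ x, x ∈ Mᗮ ↔ b x = 0 := fun x => by
    rw [hM, Submodule.orthogonal_closure, Submodule.mem_orthogonal, hker]
    constructor
    · intro h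
      rw [← inner_self_eq_zero (𝕜 := ℝ), ← hS]
      exact h _ ⟨S x, rfl⟩
    · rintro h _ ⟨y, rfl⟩
      change ⟪S y, x⟫_ℝ = 0
      rw [hS, h, inner_zero_right]
  have hMmem : ∀ x, x ∈ M ↔ ∀ y, b y = 0 → ⟪y, x⟫_ℝ = 0 := fun x => by
    rw [← Submodule.orthogonal_orthogonal M, Submodule.mem_orthogonal]
    simp only [hMker]
  set e : H →ₗ[ℝ] M := S.toLinearMap.codRestrict M fun x =>
    Submodule.le_topologicalClosure _ ⟨x, rfl⟩ with he
  have hed : DenseRange e := by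
    intro x
    rw [Metric.mem_closure_iff]
    intro r hr
    obtain ⟨_, ⟨y, rfl⟩, hy⟩ := Metric.mem_closure_iff.1 x.2 r hr
    exact ⟨e y, ⟨y, rfl⟩, hy⟩
  set J₀ : M →L[ℝ] H := (-b.toLinearMap).extendOfNorm e with hJ₀
  have hJ₀S : ∀ x, J₀ (e x) = -b x := fun x =>
    LinearMap.extendOfNorm_eq hed ⟨1, fun x => by
      change ‖-b x‖ ≤ 1 * ‖S x‖
      rw [norm_neg, hnorm, one_mul]⟩ x
  set J : H →L[ℝ] H := J₀ ∘L M.orthogonalProjectionOnto with hJ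
  have hJM : ∀ x : M, J x = J₀ x := fun x => by
    simp [hJ]
  have hJS : ∀ x, J (S x) = -b x := fun x => (hJM (e x)).trans (hJ₀S x)
  have hJ0 : ∀ x, b x = 0 → J x = 0 := fun x hx => by
    have := (hMker x).2 hx
    simp [hJ, Submodule.orthogonalProjectionOnto_apply_of_mem_orthogonal this]
  -- The identities for `J` are checked on the range of `S`, pass to `M` by density, and then to `H
  -- = M ⊕ ker b` by additivity.
  have hdense : ∀ (P : H → Prop), IsClosed {x | P x} → (∀ x, P (S x)) → ∀ x ∈ M, P x := by
    intro P hP hPS x hx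
    have : (Set.range S) ⊆ {x | P x} := by
      rintro _ ⟨y, rfl⟩
      exact hPS y
    exact closure_minimal this hP hx
  have hsplit : ∀ (P : H → Prop), (∀ x ∈ M, P x) → (∀ x, b x = 0 → P x) →
      (∀ x y, P x → P y → P (x + y)) → ∀ x, P x := by
    intro P h1 h2 h3 x
    rw [← M.starProjection_add_starProjection_orthogonal x]
    refine h3 _ _ (h1 _ (Submodule.starProjection_apply_mem _ _)) (h2 _ ?_)
    exact (hMker _).1 (Submodule.starProjection_apply_mem _ _)
  have hbM : ∀ x, b x ∈ M := fun x => (hMmem _).2 fun y hy => by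
    rw [real_inner_comm, hb, hy, inner_zero_right, neg_zero]
  have hJmem : ∀ x ∈ M, J x ∈ M := by
    refine hdense _ (hMc.preimage J.continuous) fun x => ?_
    rw [hJS]
    exact M.neg_mem (hbM x)
  -- On the range of `S` this is `J b S = J S b = -b² = S²`. It yields `J J S = -J b = -S`, which is
  -- `J² = -1` on `M`.
  have hJb : ∀ x, J (b x) = S x := by
    refine hsplit _ (hdense _ (isClosed_eq (by fun_prop) (by fun_prop)) fun x => ?_) ?_ ?_
    · rw [← hSb, hJS, hSS]
    · intro x hx
      rw [hx, (hker x).1 hx, map_zero]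
    · intro x y hx hy
      rw [map_add, map_add, map_add, hx, hy]
  refine ⟨J, hJS, hJ0, ?_, fun x hx => ?_⟩
  · have hJy : ∀ y, J y ∈ M := hsplit _ hJmem (fun y hy => by rw [hJ0 y hy]; exact M.zero_mem)
      fun y z hy hz => by rw [map_add]; exact M.add_mem hy hz
    have hzero : ∀ x, b x = 0 → ∀ y, ⟪x, J y⟫_ℝ = 0 := fun x hx y => (hMmem _).1 (hJy y) x hx
    refine hsplit _ (hdense _ ?_ fun x => ?_) (fun x hx y => ?_) fun x z hx hz y => ?_
    · simp only [Set.ofPred_forall]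
      exact isClosed_iInter fun y => isClosed_eq (by fun_prop) (by fun_prop)
    · refine hsplit _ (hdense _ (isClosed_eq (by fun_prop) (by fun_prop)) fun y => ?_)
        (fun y hy => ?_) fun y z hy hz => ?_
      · rw [hJS, hJS, inner_neg_left, inner_neg_right, neg_neg, hb, neg_neg, hS, hSb]
      · rw [real_inner_comm, hzero y hy, hJ0 y hy, inner_zero_right, neg_zero]
      · rw [map_add, inner_add_right, inner_add_right, hy, hz, neg_add]
    · rw [hJ0 x hx, inner_zero_left, hzero x hx, neg_zero]
    · rw [map_add, inner_add_left, inner_add_left, hx, hz, neg_add]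
  · rw [← hMmem] at hx
    refine ⟨?_, (hMmem _).1 (hJmem x hx)⟩
    refine hdense (fun x => J (J x) = -x) (isClosed_eq (by fun_prop) (by fun_prop)) (fun x => ?_) x
      hx
    rw [hJS, map_neg, hJb]

/-- Polar decomposition `b = -j S` with a Kähler structure `j`. -/
lemma exists_kahlerStructure_polar {b S : H →L[ℝ] H} (hb : ∀ x y, ⟪b x, y⟫_ℝ = -⟪x, b y⟫_ℝ)
    (hS : ∀ x y, ⟪S x, y⟫_ℝ = ⟪x, S y⟫_ℝ) (hSS : ∀ x, S (S x) = -b (b x))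
    (hSb : ∀ x, S (b x) = b (S x))
    (hker : Even (Module.finrank ℝ (LinearMap.ker b.toLinearMap)) ∨
      ¬ FiniteDimensional ℝ (LinearMap.ker b.toLinearMap)) :
    ∃ K : KahlerStructure H, b = -(K.j ∘L S) := by
  obtain ⟨J, hJS, hJ0, hJskew, hJJ⟩ := exists_polar hb hS hSS hSb
  set N := LinearMap.ker b.toLinearMap with hN
  have hNc : IsClosed (N : Set H) := b.isClosed_ker
  have : CompleteSpace N := hNc.completeSpace_coe
  obtain ⟨L⟩ := nonempty_kahlerStructure hker
  set P := N.orthogonalProjectionOnto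
  have hP0 : ∀ x, (∀ y, b y = 0 → ⟪y, x⟫_ℝ = 0) → P x = 0 := fun x hx =>
    Submodule.orthogonalProjectionOnto_apply_of_mem_orthogonal
      ((Submodule.mem_orthogonal _ _).2 fun y hy => hx y hy)
  have hPN : ∀ z : N, P (z : H) = z := fun z => Submodule.orthogonalProjectionOnto_mem_subspace_eq_self z
  have hq : ∀ x y, b y = 0 → ⟪y, x - (P x : H)⟫_ℝ = 0 := fun x y hy =>
    (Submodule.mem_orthogonal _ _).1 (Submodule.sub_starProjection_mem_orthogonal (K := N) x) y hy
  have hJN : ∀ z : N, J (z : H) = 0 := fun z => hJ0 _ z.2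
  have hPinner : ∀ (z : N) (y : H), ⟪(z : H), y⟫_ℝ = ⟪z, P y⟫_ℝ := fun z y => by
    have := hq y z z.2
    rw [inner_sub_right, sub_eq_zero] at this
    exact this
  -- `J` lives on the orthogonal complement of `ker b`, and `L.j` is any Kähler structure on `ker
  -- b`. The range of `S` is orthogonal to `ker b`, so the added term does not disturb the polar
  -- decomposition.
  refine ⟨⟨J + N.subtypeL ∘L L.j ∘L P, fun x => ?_, fun x y => ?_⟩, ?_⟩
  · have h1 : J x = J (x - (P x : H)) := by rw [map_sub, hJN, sub_zero]
    obtain ⟨h2, h3⟩ := hJJ _ (hq x)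
    change J (J x + (L.j (P x) : H)) + (L.j (P (J x + (L.j (P x) : H))) : H) = -x
    rw [map_add, map_add, hJN, hPN, h1, h2, hP0 _ h3, zero_add, L.j_j, add_zero]
    simp only [Submodule.coe_neg]
    abel
  · change ⟪J x + (L.j (P x) : H), y⟫_ℝ = -⟪x, J y + (L.j (P y) : H)⟫_ℝ
    have h1 : ⟪x, (L.j (P y) : H)⟫_ℝ = ⟪P x, L.j (P y)⟫_ℝ := by
      rw [real_inner_comm, hPinner, real_inner_comm]
    rw [inner_add_left, inner_add_right, hJskew, hPinner, L.skew, h1, neg_add]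
  · ext x
    have h1 : P (S x) = 0 := hP0 _ fun y hy => by
      have h2 : S y = 0 := by
        rw [← inner_self_eq_zero (𝕜 := ℝ), hS, hSS, hy, map_zero, neg_zero, inner_zero_right]
      rw [← hS, h2, inner_zero_left]
    change b x = -(J (S x) + (L.j (P (S x)) : H))
    rw [h1, map_zero, hJS]
    simp

lemma ContinuousLinearMap.isSymmetric_adjoint_comp_self (b : H →L[ℝ] H) :
    ((ContinuousLinearMap.adjoint b ∘L b : H →L[ℝ] H) : H →ₗ[ℝ] H).IsSymmetric := fun x y => by
  change ⟪ContinuousLinearMap.adjoint b (b x), y⟫_ℝ = ⟪x, ContinuousLinearMap.adjoint b (b y)⟫_ℝ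
  rw [ContinuousLinearMap.adjoint_inner_left, ContinuousLinearMap.adjoint_inner_right]

/-- Expanding, `‖x - b* b x‖² = ‖x‖² - 2 ‖b x‖² + ‖b* b x‖²`, and the last term is at most `‖b x‖²`.
-/
lemma norm_one_sub_adjoint_comp_self_le {b : H →L[ℝ] H} (hb : ‖b‖ ≤ 1) :
    ‖1 - ContinuousLinearMap.adjoint b ∘L b‖ ≤ 1 := by
  refine ContinuousLinearMap.opNorm_le_bound _ zero_le_one fun x => ?_
  have h1 : ‖ContinuousLinearMap.adjoint b (b x)‖ ≤ ‖b x‖ :=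
    (ContinuousLinearMap.le_opNorm _ _).trans
      (mul_le_of_le_one_left (norm_nonneg _) (by simpa using hb))
  have h2 : ⟪x, ContinuousLinearMap.adjoint b (b x)⟫_ℝ = ‖b x‖ ^ 2 := by
    rw [ContinuousLinearMap.adjoint_inner_right, real_inner_self_eq_norm_sq]
  have h3 : ‖x - ContinuousLinearMap.adjoint b (b x)‖ ^ 2 ≤ ‖x‖ ^ 2 := by
    rw [norm_sub_sq_real, h2]
    nlinarith [norm_nonneg (ContinuousLinearMap.adjoint b (b x)), norm_nonneg (b x)]
  rw [one_mul]
  exact (pow_le_pow_iff_left₀ (norm_nonneg _) (norm_nonneg _) two_ne_zero).1 h3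

lemma opAbs_spec {b : H →L[ℝ] H} (hb : ‖b‖ ≤ 1) :
    (opAbs b).IsPositive ∧ opAbs b ∘L opAbs b = ContinuousLinearMap.adjoint b ∘L b ∧
      ∀ T : H →L[ℝ] H, Commute T (ContinuousLinearMap.adjoint b ∘L b) → Commute T (opAbs b) :=
  posSqrt_spec b.isSymmetric_adjoint_comp_self one_pos
    (by simpa using norm_one_sub_adjoint_comp_self_le hb)

lemma norm_opAbs_apply {b : H →L[ℝ] H} (hb : ‖b‖ ≤ 1) (x : H) : ‖opAbs b x‖ = ‖b x‖ := by
  obtain ⟨h1, h2, -⟩ := opAbs_spec hb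
  have h3 : opAbs b (opAbs b x) = ContinuousLinearMap.adjoint b (b x) :=
    congrArg (fun T : H →L[ℝ] H => T x) h2
  have : ‖opAbs b x‖ ^ 2 = ‖b x‖ ^ 2 := by
    rw [← real_inner_self_eq_norm_sq, ← real_inner_self_eq_norm_sq,
      ← ContinuousLinearMap.adjoint_inner_right b, ← h3]
    exact h1.1 _ _
  exact (pow_left_inj₀ (norm_nonneg _) (norm_nonneg _) two_ne_zero).1 this

lemma norm_opAbs_le {b : H →L[ℝ] H} (hb : ‖b‖ ≤ 1) : ‖opAbs b‖ ≤ 1 :=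
  ContinuousLinearMap.opNorm_le_bound _ zero_le_one fun x => by
    rw [norm_opAbs_apply hb]
    exact b.le_of_opNorm_le hb x

end KahlerExistence

/-! ### Existence of the Kay-Wald anti-involution -/

namespace BulkBoundary

variable {X Xbd : Type*} [AddCommGroup X] [Module ℝ X] [TopologicalSpace X]
  [AddCommGroup Xbd] [Module ℝ Xbd] [TopologicalSpace Xbd] (F : BulkBoundary X Xbd)

/-- This is the quasi-free bound extended by density and tested on the pair `(b x, x)`, where the
form equals `2 ‖b x‖²`. -/
lemma norm_b_le : ‖F.b‖ ≤ 1 := by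
  have h : ∀ x y : F.Cpl, |F.σcpl x y| ≤ 2 * (‖x‖ * ‖y‖) := fun x y => by
    refine UniformSpace.Completion.induction_on₂ x y ?_ fun v w => ?_
    · exact isClosed_le (by fun_prop) (by fun_prop)
    · have h1 := F.abs_σ_le (F.toPre.symm v) (F.toPre.symm w)
      rw [← F.σcpl_emb, ← F.norm_emb, ← F.norm_emb] at h1
      exact h1
  refine ContinuousLinearMap.opNorm_le_bound _ zero_le_one fun x => ?_
  have h1 := h (F.b x) x
  rw [F.σcpl_eq, real_inner_self_eq_norm_sq, abs_of_nonneg (by positivity)] at h1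
  rcases (norm_nonneg (F.b x)).eq_or_lt with h0 | h0
  · rw [← h0]
    positivity
  · rw [one_mul]
    refine le_of_mul_le_mul_left ?_ h0
    linarith

lemma adjoint_b : ContinuousLinearMap.adjoint F.b = -F.b := by
  refine (ContinuousLinearMap.eq_adjoint_iff _ _).2 (fun x y => ?_) |>.symm
  rw [neg_apply, inner_neg_left, F.inner_b, neg_neg]

lemma ker_b : LinearMap.ker F.b.toLinearMap = F.kerσ := by
  ext x
  rw [kerσ, LinearMap.mem_ker, LinearMap.mem_ker]
  have h : ∀ y, F.σform x y = -(2 * ⟪F.b x, y⟫_ℝ) := fun y => by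
    rw [F.inner_b, mul_neg, neg_neg]
    exact F.σcpl_eq x y
  constructor
  · intro hx
    ext y
    have hx' : F.b x = 0 := hx
    simp [h, hx']
  · intro hx
    have h1 := h (F.b x)
    rw [hx, LinearMap.zero_apply] at h1
    change F.b x = 0
    rw [← inner_self_eq_zero (𝕜 := ℝ)]
    linarith

/-- Since `b* = -b`, the operator `b` commutes with `b* b` and hence with `|b|`. The polar
decomposition applies because the dimension condition on the kernel of the form is one on `ker b`.
-/
lemma nonempty_kayWald
    (hker : Even (Module.finrank ℝ F.kerσ) ∨ ¬ FiniteDimensional ℝ F.kerσ) :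
    Nonempty F.KayWald := by
  obtain ⟨h1, h2, h3⟩ := opAbs_spec F.norm_b_le
  rw [← F.ker_b] at hker
  have hc : Commute F.b (opAbs F.b) := h3 _ (by
    rw [F.adjoint_b]
    exact ((Commute.refl F.b).neg_right).mul_right (Commute.refl F.b))
  obtain ⟨K, hK⟩ := exists_kahlerStructure_polar F.inner_b h1.1
    (fun x => by
      have := congrArg (fun T : F.Cpl →L[ℝ] F.Cpl => T x) h2
      rw [F.adjoint_b] at this
      exact this)
    (fun x => (congrArg (fun T : F.Cpl →L[ℝ] F.Cpl => T x) hc.eq).symm) hker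
  exact ⟨⟨K, hK⟩⟩

end BulkBoundary

/-! ### Exponentials of symmetric operators with a dense set of entire vectors -/

section EntireVectors

open UniformSpace (Completion)

variable {D : Type*} [SeminormedAddCommGroup D] [InnerProductSpace ℂ D]

/-- `A` is symmetric and all vectors of its domain `D` are entire vectors. -/
structure IsEntireSymmetric (A : D →ₗ[ℂ] D) : Prop where
  symm : ∀ Φ Ψ, ⟪A Φ, Ψ⟫_ℂ = ⟪Φ, A Ψ⟫_ℂ
  summable : ∀ (Ψ : D) (r : ℝ), Summable fun n : ℕ => r ^ n / n.factorial * ‖(A ^ n) Ψ‖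

/-- A hierarchy of functions with `g_Ψ' = c g_{A Ψ}` and `g_Ψ(0) = 0` vanishes. -/
lemma eq_zero_of_hasDerivAt_of_nonneg {A : D →ₗ[ℂ] D} (hA : IsEntireSymmetric A) {E : Type*}
    [NormedAddCommGroup E] [NormedSpace ℂ E] {g : D → ℝ → E} {c : ℂ} (hc : ‖c‖ = 1) {C : ℝ}
    (hg : ∀ Ψ t, HasDerivAt (g Ψ) (c • g (A Ψ) t) t) (hb : ∀ Ψ t, ‖g Ψ t‖ ≤ C * ‖Ψ‖)
    (h0 : ∀ Ψ, g Ψ 0 = 0) (Ψ : D) {t : ℝ} (ht : 0 ≤ t) : g Ψ t = 0 := by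
  -- Each integration of the bound for `A Ψ` gains a factor `t / (n + 1)` for `Ψ`. Entirety of `Ψ`
  -- then sends the bound to zero as `n → ∞`.
  have key : ∀ (n : ℕ) (Ψ : D) (t : ℝ), 0 ≤ t →
      ‖g Ψ t‖ ≤ C * (t ^ n / n.factorial * ‖(A ^ n) Ψ‖) := by
    intro n
    induction n with
    | zero =>
      intro Ψ t _
      simpa using hb Ψ t
    | succ n ih =>
      intro Ψ t ht
      have hB : ∀ s : ℝ, HasDerivAt
          (fun s : ℝ => C * (s ^ (n + 1) / (n + 1).factorial * ‖(A ^ (n + 1)) Ψ‖))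
          (C * (s ^ n / n.factorial * ‖(A ^ n) (A Ψ)‖)) s := fun s => by
        have h1 := ((((hasDerivAt_pow (n + 1) s).div_const ((n + 1).factorial : ℝ)).mul_const
          ‖(A ^ (n + 1)) Ψ‖).const_mul C)
        convert! h1 using 1
        rw [pow_succ A, Module.End.mul_apply, Nat.factorial_succ, Nat.add_sub_cancel]
        push_cast
        have : (n.factorial : ℝ) ≠ 0 := by positivity
        field_simp
      refine image_norm_le_of_norm_deriv_right_le_deriv_boundary (a := 0) (b := t)
        (f' := fun s => c • g (A Ψ) s) (B' := fun s => C * (s ^ n / n.factorial * ‖(A ^ n) (A Ψ)‖))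
        (fun s _ => (hg Ψ s).continuousAt.continuousWithinAt)
        (fun s _ => (hg Ψ s).hasDerivWithinAt) ?_ hB (fun s hs => ?_) ⟨ht, le_rfl⟩
      · simp [h0]
      · rw [norm_smul, hc, one_mul]
        exact ih _ _ hs.1
  have hlim := (hA.summable Ψ t).tendsto_atTop_zero.const_mul C
  rw [mul_zero] at hlim
  exact norm_le_zero_iff.1 (ge_of_tendsto' hlim fun n => key n Ψ t ht)

lemma eq_zero_of_hasDerivAt {A : D →ₗ[ℂ] D} (hA : IsEntireSymmetric A) {E : Type*}
    [NormedAddCommGroup E] [NormedSpace ℂ E] {g : D → ℝ → E} {c : ℂ} (hc : ‖c‖ = 1) {C : ℝ}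
    (hg : ∀ Ψ t, HasDerivAt (g Ψ) (c • g (A Ψ) t) t) (hb : ∀ Ψ t, ‖g Ψ t‖ ≤ C * ‖Ψ‖)
    (h0 : ∀ Ψ, g Ψ 0 = 0) (Ψ : D) (t : ℝ) : g Ψ t = 0 := by
  rcases le_total 0 t with ht | ht
  · exact eq_zero_of_hasDerivAt_of_nonneg hA hc hg hb h0 Ψ ht
  · have := eq_zero_of_hasDerivAt_of_nonneg (g := fun Ψ t => g Ψ (-t)) hA (c := -c)
      (by rwa [norm_neg]) (fun Ψ t => ?_) (fun Ψ t => hb Ψ (-t)) (fun Ψ => by simpa using h0 Ψ) Ψ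
      (neg_nonneg.2 ht)
    · simpa using this
    · have h1 := (hg Ψ (-t)).scomp t (hasDerivAt_neg t)
      rw [neg_smul, ← neg_one_smul ℝ (c • _)]
      exact h1

/-- `D` is only seminormed, so weak identities on `D` hold up to null vectors; these disappear in
the completion. -/
lemma Completion.coe_eq_coe_of_inner {x y : D} (h : ∀ Φ : D, ⟪Φ, x⟫_ℂ = ⟪Φ, y⟫_ℂ) :
    (x : Completion D) = (y : Completion D) := by
  have : ‖x - y‖ = 0 := by
    rw [← sq_eq_zero_iff, ← inner_self_eq_norm_sq (𝕜 := ℂ), inner_sub_right, h, sub_self, map_zero]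
  rw [← sub_eq_zero, ← Completion.coe_sub, ← norm_eq_zero, Completion.norm_coe, this]

/-- Vectors of the completion are determined by their scalar products with `D`. -/
lemma Completion.ext_inner {x y : Completion D}
    (h : ∀ Φ : D, ⟪(Φ : Completion D), x⟫_ℂ = ⟪(Φ : Completion D), y⟫_ℂ) : x = y := by
  refine ext_inner_left ℂ fun v => ?_
  refine Completion.induction_on v (isClosed_eq (by fun_prop) (by fun_prop)) h

/-- The coefficients `(i t)ⁿ / n!` of the exponential series. -/
def expCoeff (t : ℝ) (n : ℕ) : ℂ := (Complex.I * t) ^ n / n.factorial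

lemma norm_expCoeff (t : ℝ) (n : ℕ) : ‖expCoeff t n‖ = |t| ^ n / n.factorial := by
  simp [expCoeff]

lemma hasDerivAt_expCoeff_succ (t : ℝ) (n : ℕ) :
    HasDerivAt (fun s => expCoeff s (n + 1)) (Complex.I * expCoeff t n) t := by
  have h1 : HasDerivAt (fun s : ℝ => Complex.I * (s : ℂ)) (Complex.I * 1) t :=
    (Complex.ofRealCLM.hasDerivAt (x := t)).const_mul Complex.I
  have h2 := (h1.pow (n + 1)).div_const (((n + 1).factorial : ℕ) : ℂ)
  convert! h2 using 1
  rw [expCoeff, Nat.factorial_succ, Nat.add_sub_cancel]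
  push_cast
  have h3 : (n.factorial : ℂ) ≠ 0 := by exact_mod_cast n.factorial_ne_zero
  have h4 : (n : ℂ) + 1 ≠ 0 := by exact_mod_cast n.succ_ne_zero
  field_simp

lemma succ_mul_expCoeff_succ (t : ℝ) (n : ℕ) :
    ((n + 1 : ℕ) : ℂ) * expCoeff t (n + 1) = Complex.I * t * expCoeff t n := by
  rw [expCoeff, expCoeff, Nat.factorial_succ]
  push_cast
  have h3 : (n.factorial : ℂ) ≠ 0 := by exact_mod_cast n.factorial_ne_zero
  have h4 : (n : ℂ) + 1 ≠ 0 := by exact_mod_cast n.succ_ne_zero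
  field_simp
  ring

/-- The exponential series `∑ₙ (i t)ⁿ / n! Aⁿ Ψ`. -/
def expSeries (A : D →ₗ[ℂ] D) (t : ℝ) (Ψ : D) : Completion D :=
  ∑' n : ℕ, expCoeff t n • (((A ^ n) Ψ : D) : Completion D)

lemma expSeries_zero (A : D →ₗ[ℂ] D) (Ψ : D) : expSeries A 0 Ψ = Ψ := by
  rw [expSeries, tsum_eq_single 0 fun n hn => by simp [expCoeff, hn]]
  simp [expCoeff]

namespace IsEntireSymmetric

variable {A : D →ₗ[ℂ] D} (hA : IsEntireSymmetric A)

include hA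

lemma summable_norm_expSeries (t : ℝ) (Ψ : D) :
    Summable fun n => ‖expCoeff t n • (((A ^ n) Ψ : D) : Completion D)‖ := by
  refine (hA.summable Ψ |t|).congr fun n => ?_
  rw [norm_smul, norm_expCoeff, Completion.norm_coe]

lemma hasSum_expSeries (t : ℝ) (Ψ : D) :
    HasSum (fun n => expCoeff t n • (((A ^ n) Ψ : D) : Completion D)) (expSeries A t Ψ) :=
  (hA.summable_norm_expSeries t Ψ).of_norm.hasSum

lemma hasDerivAt_expSeries (t : ℝ) (Ψ : D) :
    HasDerivAt (fun s => expSeries A s Ψ) (Complex.I • expSeries A t (A Ψ)) t := by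
  -- The constant term is split off and the rest is differentiated termwise on the ball of radius
  -- `R`, where the series of `A Ψ` at time `R` is a majorant.
  set R := |t| + 1
  set g : ℕ → ℝ → Completion D := fun n s =>
    expCoeff s (n + 1) • (((A ^ (n + 1)) Ψ : D) : Completion D)
  set g' : ℕ → ℝ → Completion D := fun n s =>
    (Complex.I * expCoeff s n) • (((A ^ (n + 1)) Ψ : D) : Completion D)
  have hg : ∀ n s, HasDerivAt (g n) (g' n s) s := fun n s =>
    (hasDerivAt_expCoeff_succ s n).smul_const _
  have h1 : HasDerivAt (fun s => ∑' n, g n s) (∑' n, g' n t) t := by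
    refine hasDerivAt_tsum_of_isPreconnected (hA.summable (A Ψ) R) (t := Metric.ball 0 R)
      Metric.isOpen_ball (convex_ball 0 R).isPreconnected (fun n s _ => hg n s)
      (fun n s hs => ?_) (y₀ := t) ?_ ?_ ?_
    · rw [norm_smul, norm_mul, Complex.norm_I, one_mul, norm_expCoeff, Completion.norm_coe,
        pow_succ A, Module.End.mul_apply]
      have : |s| ≤ R := by simpa using (Metric.mem_ball.1 hs).le
      gcongr
    · simp [R]
    · exact (summable_nat_add_iff (f := fun n =>
        expCoeff t n • (((A ^ n) Ψ : D) : Completion D)) 1).2 (hA.hasSum_expSeries t Ψ).summable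
    · simp [R]
  have h2 : (fun s => expSeries A s Ψ) = fun s => (Ψ : Completion D) + ∑' n, g n s := by
    funext s
    rw [expSeries, (hA.hasSum_expSeries s Ψ).summable.tsum_eq_zero_add]
    simp [expCoeff, g]
  have h3 : ∑' n, g' n t = Complex.I • expSeries A t (A Ψ) := by
    rw [expSeries, ← (hA.hasSum_expSeries t (A Ψ)).summable.tsum_const_smul]
    refine tsum_congr fun n => ?_
    simp only [g']
    rw [smul_smul, pow_succ A, Module.End.mul_apply]
  rw [h2, ← h3]
  exact h1.const_add _

/-- If `w` is in the domain of the adjoint of `B`, with `B* w = w'`, then the scalar products with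
the exponential series of `A` are as expected. -/
lemma inner_expSeries_apply {w w' : Completion D}
    (h : ∀ Φ : D, ⟪((A Φ : D) : Completion D), w⟫_ℂ = ⟪(Φ : Completion D), w'⟫_ℂ) (t : ℝ) (Φ : D) :
    ⟪expSeries A t (A Φ), w⟫_ℂ = ⟪expSeries A t Φ, w'⟫_ℂ := by
  have h1 := ((innerSL ℂ w).hasSum (hA.hasSum_expSeries t (A Φ)))
  have h2 := ((innerSL ℂ w').hasSum (hA.hasSum_expSeries t Φ))
  have e : (fun n => innerSL ℂ w (expCoeff t n • (((A ^ n) (A Φ) : D) : Completion D))) =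
      fun n => innerSL ℂ w' (expCoeff t n • (((A ^ n) Φ : D) : Completion D)) := by
    funext n
    rw [map_smul, map_smul, innerSL_apply_apply, innerSL_apply_apply, ← inner_conj_symm,
      ← Module.End.mul_apply, ← pow_succ, pow_succ', Module.End.mul_apply, h, inner_conj_symm]
  rw [e] at h1
  have h3 := h1.unique h2
  rw [innerSL_apply_apply, innerSL_apply_apply] at h3
  rw [← inner_conj_symm, h3, inner_conj_symm]

lemma inner_coe_expSeries (t : ℝ) (Φ Ψ : D) :
    ⟪((A Φ : D) : Completion D), expSeries A t Ψ⟫_ℂ =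
      ⟪(Φ : Completion D), expSeries A t (A Ψ)⟫_ℂ := by
  have h1 := (innerSL ℂ ((A Φ : D) : Completion D)).hasSum (hA.hasSum_expSeries t Ψ)
  have h2 := (innerSL ℂ (Φ : Completion D)).hasSum (hA.hasSum_expSeries t (A Ψ))
  refine h1.unique ?_
  convert! h2 using 2 with n
  rw [map_smul, map_smul, innerSL_apply_apply, innerSL_apply_apply, Completion.inner_coe,
    Completion.inner_coe, hA.symm, ← Module.End.mul_apply, ← Module.End.mul_apply, ← pow_succ,
    ← pow_succ']

/-- The derivative in time vanishes by symmetry of `A`. The series need not lie in `D`, so `A` is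
moved across through its adjoint: `inner_coe_expSeries` shows that `expSeries A t Ψ` is in the
domain of `A*`, with image `expSeries A t (A Ψ)`. -/
lemma inner_expSeries_expSeries (t : ℝ) (Φ Ψ : D) :
    ⟪expSeries A t Φ, expSeries A t Ψ⟫_ℂ = ⟪Φ, Ψ⟫_ℂ := by
  have hd : ∀ s, HasDerivAt (fun s => ⟪expSeries A s Φ, expSeries A s Ψ⟫_ℂ) 0 s := fun s => by
    have h := (hA.hasDerivAt_expSeries s Φ).inner ℂ (hA.hasDerivAt_expSeries s Ψ)
    convert! h using 1
    rw [inner_smul_left, inner_smul_right, hA.inner_expSeries_apply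
      (fun Φ => hA.inner_coe_expSeries s Φ Ψ)]
    simp
  have := is_const_of_deriv_eq_zero (fun s => (hd s).differentiableAt) (fun s => (hd s).deriv) t 0
  rw [this, expSeries_zero, expSeries_zero, Completion.inner_coe]

lemma norm_expSeries (t : ℝ) (Ψ : D) : ‖expSeries A t Ψ‖ = ‖Ψ‖ := by
  rw [@norm_eq_sqrt_re_inner ℂ, hA.inner_expSeries_expSeries, ← norm_eq_sqrt_re_inner]

omit hA in
/-- The exponential series as an operator on the completion. -/
def exp (hA : IsEntireSymmetric A) (t : ℝ) : Completion D →L[ℂ] Completion D :=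
  LinearMap.extendOfNorm (E := D)
    { toFun := expSeries A t
      map_add' := fun Φ Ψ => (((hA.hasSum_expSeries t Φ).add (hA.hasSum_expSeries t Ψ)).congr_fun
        fun n => by rw [map_add, Completion.coe_add, smul_add]).tsum_eq
      map_smul' := fun c Ψ => (((hA.hasSum_expSeries t Ψ).const_smul c).congr_fun
        fun n => by
          rw [map_smul, Completion.coe_smul, smul_comm]).tsum_eq }
    (Completion.toComplL (𝕜 := ℂ) (E := D)).toLinearMap

lemma exp_coe (t : ℝ) (Ψ : D) : hA.exp t Ψ = expSeries A t Ψ :=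
  LinearMap.extendOfNorm_eq (e := (Completion.toComplL (𝕜 := ℂ) (E := D)).toLinearMap)
    Completion.denseRange_coe ⟨1, fun Ψ => by
      rw [one_mul]
      exact (hA.norm_expSeries t Ψ).trans_le (Completion.norm_coe Ψ).ge⟩ Ψ

lemma norm_exp_apply (t : ℝ) (x : Completion D) : ‖hA.exp t x‖ = ‖x‖ := by
  refine Completion.induction_on x (isClosed_eq (by fun_prop) (by fun_prop)) fun Ψ => ?_
  rw [hA.exp_coe, hA.norm_expSeries, Completion.norm_coe]

lemma hasDerivAt_exp_coe (t : ℝ) (Ψ : D) :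
    HasDerivAt (fun s => hA.exp s Ψ) (Complex.I • hA.exp t (A Ψ : D)) t := by
  simp only [hA.exp_coe]
  exact hA.hasDerivAt_expSeries t Ψ

lemma exp_zero : hA.exp 0 = 1 := by
  refine ContinuousLinearMap.ext fun x => ?_
  refine Completion.induction_on x (isClosed_eq (by fun_prop) (by fun_prop)) fun Ψ => ?_
  rw [hA.exp_coe, expSeries_zero]
  rfl

/-- For fixed `s`, the difference of the two sides on `D` obeys the hierarchy `g_Ψ' = i g_{AΨ}` in
`t`, is bounded by `2 ‖Ψ‖` and vanishes at `t = 0`. -/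
lemma exp_add (s t : ℝ) : hA.exp (s + t) = hA.exp s * hA.exp t := by
  refine ContinuousLinearMap.ext fun x => ?_
  refine Completion.induction_on x (isClosed_eq (by fun_prop) (by fun_prop)) fun Ψ => ?_
  rw [mul_apply_eq_comp, ← sub_eq_zero]
  refine eq_zero_of_hasDerivAt (g := fun Ψ t => hA.exp (s + t) Ψ - hA.exp s (hA.exp t Ψ)) hA
    Complex.norm_I (C := 2) (fun Ψ t => ?_) (fun Ψ t => ?_) (fun Ψ => ?_) Ψ t
  · rw [smul_sub, ← map_smul (hA.exp s)]
    refine HasDerivAt.sub ?_ ?_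
    · exact (hA.hasDerivAt_exp_coe (s + t) Ψ).comp_const_add s t
    · exact ((hA.exp s).restrictScalars ℝ).hasFDerivAt.comp_hasDerivAt t
        (hA.hasDerivAt_exp_coe t Ψ)
  · refine (norm_sub_le _ _).trans_eq ?_
    rw [hA.norm_exp_apply, hA.norm_exp_apply, hA.norm_exp_apply, Completion.norm_coe]
    ring
  · rw [add_zero, hA.exp_zero, one_apply_eq_self, sub_self]

lemma exp_mem_unitary (t : ℝ) : hA.exp t ∈ unitary (Completion D →L[ℂ] Completion D) := by
  have h1 : star (hA.exp t) * hA.exp t = 1 :=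
    (ContinuousLinearMap.norm_map_iff_adjoint_comp_self _).1 (hA.norm_exp_apply t)
  have h2 : hA.exp t * hA.exp (-t) = 1 := by rw [← hA.exp_add, add_neg_cancel, hA.exp_zero]
  refine Unitary.mem_iff.2 ⟨h1, ?_⟩
  rwa [left_inv_eq_right_inv h1 h2]

lemma continuous_exp_apply (x : Completion D) : Continuous fun t => hA.exp t x := by
  refine continuous_of_uniform_approx_of_continuous fun u hu => ?_
  obtain ⟨ε, hε, hεu⟩ := Metric.mem_uniformity_dist.1 hu
  obtain ⟨Ψ, hΨ⟩ := Completion.denseRange_coe.exists_dist_lt x hε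
  refine ⟨fun t => hA.exp t Ψ, continuous_iff_continuousAt.2 fun t =>
    (hA.hasDerivAt_exp_coe t Ψ).continuousAt, fun t => hεu ?_⟩
  rwa [dist_eq_norm, ← map_sub, hA.norm_exp_apply, ← dist_eq_norm]

lemma isUnitaryGroupOf_exp : IsUnitaryGroupOf A hA.exp where
  unitary := hA.exp_mem_unitary
  map_zero := hA.exp_zero
  map_add := hA.exp_add
  continuous := hA.continuous_exp_apply
  generator Ψ := by
    have := hA.hasDerivAt_exp_coe 0 Ψ
    rwa [hA.exp_zero] at this

/-- Uniqueness of the unitary group generated by `A`. -/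
lemma eq_exp {U : ℝ → (Completion D →L[ℂ] Completion D)} (hU : IsUnitaryGroupOf A U) (t : ℝ) :
    U t = hA.exp t := by
  refine ContinuousLinearMap.ext fun x => ?_
  refine Completion.induction_on x (isClosed_eq (by fun_prop) (by fun_prop)) fun Ψ => ?_
  rw [← sub_eq_zero]
  refine eq_zero_of_hasDerivAt (g := fun Ψ t => U t Ψ - hA.exp t Ψ) hA
    Complex.norm_I (C := 2) (fun Ψ t => ?_) (fun Ψ t => ?_) (fun Ψ => ?_) Ψ t
  · rw [smul_sub]
    refine HasDerivAt.sub ?_ (hA.hasDerivAt_exp_coe t Ψ)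
    -- The generator condition concerns time zero only; the group law transports it to time `t`.
    have h1 := ((U t).restrictScalars ℝ).hasFDerivAt.comp_hasDerivAt 0 (hU.generator Ψ)
    have h2 : (fun s => U s (Ψ : Completion D)) = fun s => U t (U (s - t) (Ψ : Completion D)) := by
      funext s
      rw [← mul_apply_eq_comp, ← hU.map_add, add_sub_cancel]
    rw [h2, ← map_smul]
    rw [← sub_self t] at h1
    exact h1.comp_sub_const t t
  · refine (norm_sub_le _ _).trans_eq ?_
    rw [hA.norm_exp_apply, ContinuousLinearMap.norm_map_of_mem_unitary (hU.unitary t),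
      Completion.norm_coe]
    ring
  · rw [hU.map_zero, hA.exp_zero, sub_self]

lemma expI_eq : expI A = hA.exp 1 := by
  have h : ∃ U, IsUnitaryGroupOf A U := ⟨_, hA.isUnitaryGroupOf_exp⟩
  rw [expI, dif_pos h]
  exact hA.eq_exp h.choose_spec 1

end IsEntireSymmetric

end EntireVectors

/-! ### Weyl relations from canonical commutation relations -/

section Commutation

open UniformSpace (Completion)

variable {D : Type*} [SeminormedAddCommGroup D] [InnerProductSpace ℂ D]

namespace IsEntireSymmetric

variable {A B C : D →ₗ[ℂ] D}

/-- This is `B Aⁿ = Aⁿ B + n c Aⁿ⁻¹` in weak form, the commutator being given only under scalar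
products. The truncated exponent at `n = 0` is harmless because of the factor `n`. -/
lemma inner_apply_pow (hA : IsEntireSymmetric A) (hB : IsEntireSymmetric B) {c : ℂ}
    (hc : ∀ Φ Ψ, ⟪Φ, B (A Ψ)⟫_ℂ = ⟪Φ, A (B Ψ)⟫_ℂ + c * ⟪Φ, Ψ⟫_ℂ) (n : ℕ) (Φ Ψ : D) :
    ⟪B Φ, (A ^ n) Ψ⟫_ℂ = ⟪Φ, (A ^ n) (B Ψ)⟫_ℂ + n * c * ⟪Φ, (A ^ (n - 1)) Ψ⟫_ℂ := by
  induction n generalizing Φ with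
  | zero => simp [hB.symm]
  | succ n ih =>
    have h1 : (n : ℂ) * c * ⟪A Φ, (A ^ (n - 1)) Ψ⟫_ℂ = n * c * ⟪Φ, (A ^ n) Ψ⟫_ℂ := by
      rcases n with - | n
      · simp
      · rw [hA.symm, ← Module.End.mul_apply, ← pow_succ', Nat.add_sub_cancel]
    rw [pow_succ', Module.End.mul_apply, hB.symm, hc, ← hA.symm, ← hB.symm, ih, h1, hA.symm,
      Module.End.mul_apply, Nat.add_sub_cancel]
    push_cast
    ring

lemma inner_coe_expSeries_of_comm (hA : IsEntireSymmetric A) (hB : IsEntireSymmetric B) {c : ℂ}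
    (hc : ∀ Φ Ψ, ⟪Φ, B (A Ψ)⟫_ℂ = ⟪Φ, A (B Ψ)⟫_ℂ + c * ⟪Φ, Ψ⟫_ℂ) (t : ℝ) (Φ Ψ : D) :
    ⟪((B Φ : D) : Completion D), expSeries A t Ψ⟫_ℂ =
      ⟪(Φ : Completion D), expSeries A t (B Ψ) + (c * (Complex.I * t)) • expSeries A t Ψ⟫_ℂ := by
  have h1 := (innerSL ℂ ((B Φ : D) : Completion D)).hasSum (hA.hasSum_expSeries t Ψ)
  have h2 := (innerSL ℂ (Φ : Completion D)).hasSum (hA.hasSum_expSeries t (B Ψ))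
  have h3 := ((innerSL ℂ (Φ : Completion D)).hasSum (hA.hasSum_expSeries t Ψ)).mul_left
    (c * (Complex.I * t))
  simp only [map_smul, innerSL_apply_apply, Completion.inner_coe, smul_eq_mul] at h1 h2 h3
  -- These are the commutator terms. The zeroth one vanishes, and after an index shift the factor
  -- `n` cancels against the factorial, leaving `c i t` times the exponential series.
  set f : ℕ → ℂ := fun n => expCoeff t n * (n * c * ⟪Φ, (A ^ (n - 1)) Ψ⟫_ℂ) with hf
  have h4 : HasSum f (c * (Complex.I * t) * ⟪(Φ : Completion D), expSeries A t Ψ⟫_ℂ) := by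
    rw [← hasSum_nat_add_iff' 1]
    simp only [Finset.sum_range_one]
    have h0 : f 0 = 0 := by simp [hf]
    rw [h0, sub_zero]
    refine h3.congr_fun fun n => ?_
    have := succ_mul_expCoeff_succ t n
    simp only [hf, Nat.add_sub_cancel]
    linear_combination c * ⟪Φ, (A ^ n) Ψ⟫_ℂ * this
  rw [inner_add_right, inner_smul_right]
  refine h1.unique ((h2.add h4).congr_fun fun n => ?_)
  rw [hA.inner_apply_pow hB hc, hf]
  ring

/-- The scalar product is that of `Φ` with `e^{itB} e^{itA} Ψ`. Differentiating puts `B` to the left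
of `e^{itA}`; moving it to the right costs `c i t`, hence the term `-c t` after multiplication by
`i`. -/
lemma hasDerivAt_inner_exp_exp (hA : IsEntireSymmetric A) (hB : IsEntireSymmetric B) {c : ℂ}
    (hc : ∀ Φ Ψ, ⟪Φ, B (A Ψ)⟫_ℂ = ⟪Φ, A (B Ψ)⟫_ℂ + c * ⟪Φ, Ψ⟫_ℂ)
    (hABC : ∀ Ψ, ((C Ψ : D) : Completion D) = (B Ψ : D) + (A Ψ : D)) (Φ Ψ : D) (t : ℝ) :
    HasDerivAt (fun t => ⟪hB.exp (-t) Φ, hA.exp t Ψ⟫_ℂ)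
      (Complex.I * ⟪hB.exp (-t) Φ, hA.exp t (C Ψ : D)⟫_ℂ - c * t * ⟪hB.exp (-t) Φ, hA.exp t Ψ⟫_ℂ)
      t := by
  have h1 : HasDerivAt (fun t => hB.exp (-t) Φ) ((-1 : ℝ) • (Complex.I • hB.exp (-t) (B Φ : D))) t :=
    (hB.hasDerivAt_exp_coe (-t) Φ).scomp t (hasDerivAt_neg t)
  have h2 := h1.inner ℂ (hA.hasDerivAt_exp_coe t Ψ)
  have h3 : ⟪hB.exp (-t) (B Φ : D), hA.exp t Ψ⟫_ℂ = ⟪hB.exp (-t) Φ, hA.exp t (B Ψ : D)⟫_ℂ +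
      c * (Complex.I * t) * ⟪hB.exp (-t) Φ, hA.exp t Ψ⟫_ℂ := by
    simp only [hA.exp_coe, hB.exp_coe]
    rw [hB.inner_expSeries_apply (fun Φ => hA.inner_coe_expSeries_of_comm hB hc t Φ Ψ),
      inner_add_right, inner_smul_right]
  refine h2.congr_deriv ?_
  rw [hABC, map_add, inner_add_right, inner_smul_right, neg_one_smul, inner_neg_left,
    inner_smul_left, h3, Complex.conj_I]
  linear_combination (c * t * ⟪hB.exp (-t) Φ, hA.exp t Ψ⟫_ℂ) * Complex.I_mul_I

lemma hasDerivAt_cexp_quadratic (θ t : ℝ) :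
    HasDerivAt (fun t : ℝ => Complex.exp (Complex.I * θ * t ^ 2 / 2))
      (Complex.exp (Complex.I * θ * t ^ 2 / 2) * (Complex.I * θ * t)) t := by
  have h1 : HasDerivAt (fun s : ℝ => (s : ℂ)) 1 t := Complex.ofRealCLM.hasDerivAt
  refine (((h1.pow 2).const_mul (Complex.I * (θ : ℂ))).div_const 2).cexp.congr_deriv ?_
  simp only [Pi.pow_apply]
  ring

lemma norm_cexp_quadratic (θ t : ℝ) : ‖Complex.exp (Complex.I * θ * t ^ 2 / 2)‖ = 1 := by
  have : Complex.I * θ * t ^ 2 / 2 = ((θ * t ^ 2 / 2 : ℝ) : ℂ) * Complex.I := by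
    push_cast
    ring
  rw [this, Complex.norm_exp_ofReal_mul_I]

/-- The quadratic phase is chosen so that its derivative `i θ t` cancels the commutator term. With
`Φ` fixed, the difference of the two sides then obeys the hierarchy for `C` and vanishes at zero. -/
lemma inner_exp_neg_exp (hA : IsEntireSymmetric A) (hB : IsEntireSymmetric B)
    (hC : IsEntireSymmetric C) {θ : ℝ}
    (hc : ∀ Φ Ψ, ⟪Φ, B (A Ψ)⟫_ℂ = ⟪Φ, A (B Ψ)⟫_ℂ + Complex.I * θ * ⟪Φ, Ψ⟫_ℂ)
    (hABC : ∀ Ψ, ((C Ψ : D) : Completion D) = (B Ψ : D) + (A Ψ : D)) (Φ Ψ : D) (t : ℝ) :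
    Complex.exp (Complex.I * θ * t ^ 2 / 2) * ⟪hB.exp (-t) Φ, hA.exp t Ψ⟫_ℂ =
      ⟪(Φ : Completion D), hC.exp t Ψ⟫_ℂ := by
  rw [← sub_eq_zero]
  refine eq_zero_of_hasDerivAt
    (g := fun Ψ t => Complex.exp (Complex.I * θ * t ^ 2 / 2) * ⟪hB.exp (-t) Φ, hA.exp t Ψ⟫_ℂ -
      ⟪(Φ : Completion D), hC.exp t Ψ⟫_ℂ) hC
    Complex.norm_I (C := 2 * ‖Φ‖) (fun Ψ t => ?_) (fun Ψ t => ?_) (fun Ψ => ?_) Ψ t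
  · have h1 := (hasDerivAt_cexp_quadratic θ t).mul (hA.hasDerivAt_inner_exp_exp hB hc hABC Φ Ψ t)
    have h2 := (hasDerivAt_const t (Φ : Completion D)).inner ℂ (hC.hasDerivAt_exp_coe t Ψ)
    refine (h1.sub h2).congr_deriv ?_
    rw [inner_smul_right, inner_zero_left, smul_eq_mul]
    ring
  · refine (norm_sub_le _ _).trans ?_
    have h1 : ‖⟪hB.exp (-t) Φ, hA.exp t Ψ⟫_ℂ‖ ≤ ‖Φ‖ * ‖Ψ‖ := by
      refine (norm_inner_le_norm _ _).trans_eq ?_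
      rw [hA.norm_exp_apply, hB.norm_exp_apply, Completion.norm_coe, Completion.norm_coe]
    have h2 : ‖⟪(Φ : Completion D), hC.exp t Ψ⟫_ℂ‖ ≤ ‖Φ‖ * ‖Ψ‖ := by
      refine (norm_inner_le_norm _ _).trans_eq ?_
      rw [hC.norm_exp_apply, Completion.norm_coe, Completion.norm_coe]
    rw [norm_mul, norm_cexp_quadratic, one_mul]
    linarith
  · rw [neg_zero, hA.exp_zero, hB.exp_zero, hC.exp_zero]
    simp

/-- The Weyl relations. -/
lemma exp_mul_exp (hA : IsEntireSymmetric A) (hB : IsEntireSymmetric B)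
    (hC : IsEntireSymmetric C) {θ : ℝ}
    (hc : ∀ Φ Ψ, ⟪Φ, B (A Ψ)⟫_ℂ = ⟪Φ, A (B Ψ)⟫_ℂ + Complex.I * θ * ⟪Φ, Ψ⟫_ℂ)
    (hABC : ∀ Ψ, ((C Ψ : D) : Completion D) = (B Ψ : D) + (A Ψ : D)) :
    hB.exp 1 * hA.exp 1 = Complex.exp (-(Complex.I / 2) * θ) • hC.exp 1 := by
  refine ContinuousLinearMap.ext fun x => ?_
  refine Completion.induction_on x
    (isClosed_eq (ContinuousLinearMap.continuous _) (ContinuousLinearMap.continuous _)) fun Ψ => ?_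
  refine Completion.ext_inner fun Φ => ?_
  have h1 := ContinuousLinearMap.inner_map_map_of_mem_unitary (hB.exp_mem_unitary 1)
    (hB.exp (-1) Φ) (hA.exp 1 Ψ)
  rw [← mul_apply_eq_comp, ← hB.exp_add, add_neg_cancel, hB.exp_zero, one_apply_eq_self] at h1
  have h2 : -(Complex.I / 2) * θ + Complex.I * θ * ((1 : ℝ) : ℂ) ^ 2 / 2 = 0 := by
    push_cast
    ring
  rw [mul_apply_eq_comp, h1, smul_apply, inner_smul_right,
    ← hA.inner_exp_neg_exp hB hC hc hABC Φ Ψ 1, ← mul_assoc, ← Complex.exp_add, h2,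
    Complex.exp_zero, one_mul]

lemma norm_exp_one_sub_le (hA : IsEntireSymmetric A) (Ψ : D) :
    ‖hA.exp 1 (Ψ : Completion D) - Ψ‖ ≤ ‖A Ψ‖ := by
  have := norm_image_sub_le_of_norm_deriv_le_segment_01' (f := fun t => hA.exp t (Ψ : Completion D))
    (f' := fun t => Complex.I • hA.exp t (A Ψ : D)) (C := ‖A Ψ‖)
    (fun t _ => (hA.hasDerivAt_exp_coe t Ψ).hasDerivWithinAt) fun t _ => by
      rw [norm_smul, Complex.norm_I, one_mul, hA.norm_exp_apply, Completion.norm_coe]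
  simpa [hA.exp_zero] using this

end IsEntireSymmetric

end Commutation

/-! ### The canonical commutation relations on Fock space -/

section FockCCR

open UniformSpace (Completion)

/-- `Equiv.Perm.decomposeFin` lists the indices other than `p` through a transposition, minors list
them in increasing order. The reordering `ρ` is harmless in a permanent, which carries no signs. -/
lemma Fin.exists_perm_swap_zero_succ {n : ℕ} (p : Fin (n + 1)) :
    ∃ ρ : Equiv.Perm (Fin n), ∀ k, Equiv.swap 0 p k.succ = p.succAbove (ρ k) := by
  have hne : ∀ k : Fin n, Equiv.swap 0 p k.succ ≠ p := fun k h => by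
    have h1 := congrArg (Equiv.swap 0 p) h
    rw [Equiv.swap_apply_self, Equiv.swap_apply_right] at h1
    exact Fin.succ_ne_zero k h1
  choose f hf using fun k => Fin.exists_succAbove_eq (hne k)
  have hinj : Function.Injective f := fun k l hkl => by
    have := (hf k).symm.trans ((congrArg p.succAbove hkl).trans (hf l))
    exact Fin.succ_injective _ ((Equiv.swap 0 p).injective this)
  exact ⟨Equiv.ofBijective f (Finite.injective_iff_bijective.1 hinj), fun k => (hf k).symm⟩

/-- Expansion of a permanent along the first row. -/
lemma Matrix.permanent_succ_row_zero {R : Type*} [CommSemiring R] {n : ℕ}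
    (M : Matrix (Fin (n + 1)) (Fin (n + 1)) R) :
    M.permanent = ∑ p, M 0 p * (M.submatrix Fin.succ p.succAbove).permanent := by
  rw [← Matrix.permanent_transpose, Matrix.permanent,
    ← Equiv.Perm.decomposeFin.symm.sum_comp, Fintype.sum_prod_type]
  refine Finset.sum_congr rfl fun p _ => ?_
  obtain ⟨ρ, hρ⟩ := Fin.exists_perm_swap_zero_succ p
  rw [← Matrix.permanent_transpose, Matrix.permanent, Finset.mul_sum]
  refine Fintype.sum_equiv (Equiv.mulLeft ρ) _ _ fun e => ?_
  rw [Fin.prod_univ_succ]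
  simp [hρ]

variable {h : Type*} [NormedAddCommGroup h] [InnerProductSpace ℂ h]

namespace PreFock

/-- The vectors with at most `N` particles. -/
def particlesLE (h : Type*) [NormedAddCommGroup h] [InnerProductSpace ℂ h] (N : ℕ) :
    Submodule ℂ (PreFock h) :=
  Submodule.span ℂ (fockSymbol '' {s : Σ n : ℕ, Fin n → h | s.1 ≤ N})

lemma fockSymbol_mem {s : Σ n : ℕ, Fin n → h} {N : ℕ} (hs : s.1 ≤ N) :
    fockSymbol s ∈ particlesLE h N :=
  Submodule.subset_span ⟨s, hs, rfl⟩

lemma particlesLE_mono {M N : ℕ} (hMN : M ≤ N) : particlesLE h M ≤ particlesLE h N :=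
  Submodule.span_mono (Set.image_mono fun _ hs => le_trans hs hMN)

lemma exists_mem_particlesLE (Ψ : PreFock h) : ∃ N, Ψ ∈ particlesLE h N := by
  refine Finsupp.induction_linear (motive := fun Ψ => ∃ N, (Ψ : PreFock h) ∈ particlesLE h N) Ψ
    ⟨0, Submodule.zero_mem _⟩ (fun Ψ Φ hΨ hΦ => ?_) fun s c => ⟨s.1, ?_⟩
  · obtain ⟨M, hM⟩ := hΨ
    obtain ⟨N, hN⟩ := hΦ
    exact ⟨max M N, Submodule.add_mem _ (particlesLE_mono (le_max_left _ _) hM)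
      (particlesLE_mono (le_max_right _ _) hN)⟩
  · have := Submodule.smul_mem _ c (fockSymbol_mem (le_refl s.1))
    have e : (Finsupp.single s c : PreFock h) = c • fockSymbol s :=
      (Finsupp.smul_single_one s c).symm
    rwa [e]

@[elab_as_elim]
lemma induction_symbol {P : PreFock h → Prop} (Ψ : PreFock h)
    (hsymb : ∀ s, P (fockSymbol s)) (hadd : ∀ Ψ Φ, P Ψ → P Φ → P (Ψ + Φ))
    (hsmul : ∀ (c : ℂ) Ψ, P Ψ → P (c • Ψ)) : P Ψ := by
  obtain ⟨N, hN⟩ := exists_mem_particlesLE Ψ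
  refine Submodule.span_induction (p := fun Ψ _ => P Ψ) ?_ ?_ (fun Ψ Φ _ _ => hadd Ψ Φ)
    (fun c Ψ _ => hsmul c Ψ) hN
  · rintro _ ⟨s, -, rfl⟩
    exact hsymb s
  · have := hsmul 0 _ (hsymb ⟨0, Fin.elim0⟩)
    rwa [zero_smul] at this

lemma inner_fockSymbol (s t : Σ n : ℕ, Fin n → h) :
    ⟪fockSymbol s, fockSymbol t⟫_ℂ = fockKernel s t := by
  change fockForm (Finsupp.single s 1) (Finsupp.single t 1) = _
  rw [fockForm, Finsupp.sum_single_index (by simp), Finsupp.sum_single_index (by simp)]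
  simp

omit [NormedAddCommGroup h] [InnerProductSpace ℂ h] in
lemma creation_fockSymbol (x : h) (s : Σ n : ℕ, Fin n → h) :
    creation x (fockSymbol s) = fockSymbol ⟨s.1 + 1, Fin.cons x s.2⟩ :=
  Finsupp.mapDomain_single

lemma annihilation_fockSymbol (x : h) (s : Σ n : ℕ, Fin n → h) :
    annihilation x (fockSymbol s) = annihilateSymbol x s :=
  (Finsupp.linearCombination_single ℂ 1 s).trans (one_smul ℂ _)

/-- Expanding the permanent along the row of `x` removes one vector of `t` at a time; this is
adjointness of creation and annihilation on symbols. -/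
lemma fockKernel_cons (x : h) (s : Σ n : ℕ, Fin n → h) (t : Σ n : ℕ, Fin n → h) :
    fockKernel ⟨s.1 + 1, Fin.cons x s.2⟩ t = ⟪fockSymbol s, annihilateSymbol x t⟫_ℂ := by
  obtain ⟨n, s⟩ := s
  obtain ⟨m, t⟩ := t
  rcases m with - | m
  · simp [fockKernel, annihilateSymbol]
  · rw [annihilateSymbol, inner_sum]
    simp only [inner_smul_right, inner_fockSymbol]
    by_cases e : n = m
    · subst e
      simp only [fockKernel, dite_true, Fin.cast_eq_self]
      rw [Matrix.permanent_succ_row_zero]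
      refine Finset.sum_congr rfl fun p _ => ?_
      rfl
    · have e' : ¬ n + 1 = m + 1 := by omega
      simp [fockKernel, e]

lemma inner_creation (x : h) (Ψ Φ : PreFock h) :
    ⟪creation x Ψ, Φ⟫_ℂ = ⟪Ψ, annihilation x Φ⟫_ℂ := by
  induction Ψ using induction_symbol with
  | hsymb s =>
    induction Φ using induction_symbol with
    | hsymb t =>
      rw [creation_fockSymbol, annihilation_fockSymbol, inner_fockSymbol, fockKernel_cons]
    | hadd Φ Θ h1 h2 => rw [map_add, inner_add_right, inner_add_right, h1, h2]
    | hsmul c Φ h1 => rw [map_smul, inner_smul_right, inner_smul_right, h1]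
  | hadd Ψ Θ h1 h2 => rw [map_add, inner_add_left, inner_add_left, h1, h2]
  | hsmul c Ψ h1 => rw [map_smul, inner_smul_left, inner_smul_left, h1]

lemma inner_annihilation (x : h) (Ψ Φ : PreFock h) :
    ⟪annihilation x Ψ, Φ⟫_ℂ = ⟪Ψ, creation x Φ⟫_ℂ := by
  rw [← inner_conj_symm, ← inner_creation, inner_conj_symm]

/-- This holds exactly for formal combinations: removing the prepended `y` gives the scalar term,
and removing any other entry leaves `y` in front. -/
lemma annihilation_creation (x y : h) (Ψ : PreFock h) :
    annihilation x (creation y Ψ) = ⟪x, y⟫_ℂ • Ψ + creation y (annihilation x Ψ) := by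
  induction Ψ using induction_symbol with
  | hsymb s =>
    rw [creation_fockSymbol, annihilation_fockSymbol, annihilation_fockSymbol, annihilateSymbol,
      Fin.sum_univ_succ]
    simp only [Fin.cons_zero, Fin.cons_succ, Fin.succAbove_zero]
    congr 1
    obtain ⟨n, s⟩ := s
    rcases n with - | n
    · simp [annihilateSymbol]
    · rw [annihilateSymbol, map_sum]
      refine Finset.sum_congr rfl fun i _ => ?_
      rw [map_smul, creation_fockSymbol]
      congr 3
      funext k
      refine Fin.cases ?_ (fun k => ?_) k <;> simp
  | hadd Ψ Θ h1 h2 =>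
    simp only [map_add, h1, h2, smul_add]
    abel
  | hsmul c Ψ h1 => simp only [map_smul, h1, smul_add, smul_comm c]

lemma annihilation_add (x y : h) (Ψ : PreFock h) :
    annihilation (x + y) Ψ = annihilation x Ψ + annihilation y Ψ := by
  induction Ψ using induction_symbol with
  | hsymb s =>
    simp only [annihilation_fockSymbol]
    obtain ⟨n, s⟩ := s
    rcases n with - | n
    · simp [annihilateSymbol]
    · simp only [annihilateSymbol, inner_add_left, add_smul, Finset.sum_add_distrib]
  | hadd Ψ Θ h1 h2 =>
    simp only [map_add, h1, h2]
    abel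
  | hsmul c Ψ h1 => simp only [map_smul, h1, smul_add]

lemma fockKernel_comp_perm (s : Σ n : ℕ, Fin n → h) (n : ℕ) (y : Fin n → h)
    (π : Equiv.Perm (Fin n)) : fockKernel s ⟨n, y ∘ π⟩ = fockKernel s ⟨n, y⟩ := by
  obtain ⟨m, s⟩ := s
  by_cases e : m = n
  · subst e
    simp only [fockKernel, dite_true, Fin.cast_eq_self]
    exact Matrix.permanent_permute_rows π (Matrix.of fun i j => ⟪s i, y j⟫_ℂ)
  · simp [fockKernel, e]

/-- As formal symbols `x ∨ y` and `y ∨ x` differ; they agree only modulo null vectors, because the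
permanent is invariant under permuting its columns. -/
lemma inner_creation_comm (x y : h) (Φ Ψ : PreFock h) :
    ⟪Φ, creation x (creation y Ψ)⟫_ℂ = ⟪Φ, creation y (creation x Ψ)⟫_ℂ := by
  induction Ψ using induction_symbol with
  | hsymb s =>
    induction Φ using induction_symbol with
    | hsymb t =>
      simp only [creation_fockSymbol, inner_fockSymbol]
      rw [← fockKernel_comp_perm _ _ _ (Equiv.swap 0 1)]
      congr 2
      funext k
      refine Fin.cases ?_ (fun k => Fin.cases ?_ (fun k => ?_) k) k
      · simp
      · simp
      · have h1 : Equiv.swap (0 : Fin (s.1 + 1 + 1)) 1 k.succ.succ = k.succ.succ :=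
          Equiv.swap_apply_of_ne_of_ne (Fin.succ_ne_zero _)
            fun h => Fin.succ_ne_zero k (Fin.succ_injective _ h)
        simp [h1]
    | hadd Φ Θ h1 h2 => rw [inner_add_left, inner_add_left, h1, h2]
    | hsmul c Φ h1 => rw [inner_smul_left, inner_smul_left, h1]
  | hadd Ψ Θ h1 h2 => simp only [map_add, inner_add_right, h1, h2]
  | hsmul c Ψ h1 => simp only [map_smul, inner_smul_right, h1]

lemma inner_annihilation_comm (x y : h) (Φ Ψ : PreFock h) :
    ⟪Φ, annihilation x (annihilation y Ψ)⟫_ℂ = ⟪Φ, annihilation y (annihilation x Ψ)⟫_ℂ := by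
  rw [← inner_creation, ← inner_creation, ← inner_conj_symm, inner_creation_comm, inner_conj_symm,
    inner_creation, inner_creation]

lemma creation_mem {N : ℕ} (x : h) {Ψ : PreFock h} (hΨ : Ψ ∈ particlesLE h N) :
    creation x Ψ ∈ particlesLE h (N + 1) := by
  refine Submodule.span_induction (p := fun Ψ _ => creation x Ψ ∈ particlesLE h (N + 1)) ?_ ?_
    (fun Ψ Φ _ _ h1 h2 => ?_) (fun c Ψ _ h1 => ?_) hΨ
  · rintro _ ⟨s, hs, rfl⟩
    rw [creation_fockSymbol]
    exact fockSymbol_mem (Nat.succ_le_succ hs)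
  · rw [map_zero]
    exact Submodule.zero_mem _
  · rw [map_add]
    exact Submodule.add_mem _ h1 h2
  · rw [map_smul]
    exact Submodule.smul_mem _ _ h1

lemma annihilation_mem {N : ℕ} (x : h) {Ψ : PreFock h} (hΨ : Ψ ∈ particlesLE h (N + 1)) :
    annihilation x Ψ ∈ particlesLE h N := by
  refine Submodule.span_induction (p := fun Ψ _ => annihilation x Ψ ∈ particlesLE h N) ?_ ?_
    (fun Ψ Φ _ _ h1 h2 => ?_) (fun c Ψ _ h1 => ?_) hΨ
  · rintro _ ⟨⟨n, s⟩, hs, rfl⟩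
    rw [annihilation_fockSymbol]
    rcases n with - | n
    · exact Submodule.zero_mem _
    · exact Submodule.sum_mem _ fun i _ => Submodule.smul_mem _ _
        (fockSymbol_mem (Nat.le_of_succ_le_succ hs))
  · rw [map_zero]
    exact Submodule.zero_mem _
  · rw [map_add]
    exact Submodule.add_mem _ h1 h2
  · rw [map_smul]
    exact Submodule.smul_mem _ _ h1

lemma annihilation_eq_zero (x : h) {Ψ : PreFock h} (hΨ : Ψ ∈ particlesLE h 0) :
    annihilation x Ψ = 0 := by
  refine Submodule.span_induction (p := fun Ψ _ => annihilation x Ψ = 0) ?_ (map_zero _)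
    (fun Ψ Φ _ _ h1 h2 => by rw [map_add, h1, h2, add_zero])
    (fun c Ψ _ h1 => by rw [map_smul, h1, smul_zero]) hΨ
  rintro _ ⟨⟨n, s⟩, hs, rfl⟩
  rw [annihilation_fockSymbol]
  obtain rfl : n = 0 := Nat.le_zero.1 hs
  rfl

lemma norm_creation_sq (x : h) (Ψ : PreFock h) :
    ‖creation x Ψ‖ ^ 2 = ‖annihilation x Ψ‖ ^ 2 + ‖x‖ ^ 2 * ‖Ψ‖ ^ 2 := by
  have h1 : ⟪creation x Ψ, creation x Ψ⟫_ℂ =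
      ⟪annihilation x Ψ, annihilation x Ψ⟫_ℂ + ⟪x, x⟫_ℂ * ⟪Ψ, Ψ⟫_ℂ := by
    rw [inner_creation, annihilation_creation, inner_add_right, inner_smul_right,
      ← inner_annihilation, add_comm]
  simp only [inner_self_eq_norm_sq_to_K] at h1
  exact_mod_cast h1

/-- The two bounds feed each other. `norm_creation_sq` passes from annihilation to creation at level
`N`, and `‖aΨ‖² = ⟪Ψ, a* a Ψ⟫` passes from creation at level `N` to annihilation at level `N + 1`.
No orthogonal decomposition by particle number is needed. -/
lemma norm_creation_le_and_norm_annihilation_le (x : h) (N : ℕ) :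
    (∀ Ψ ∈ particlesLE h N, ‖creation x Ψ‖ ≤ √(N + 1) * ‖x‖ * ‖Ψ‖) ∧
      ∀ Ψ ∈ particlesLE h N, ‖annihilation x Ψ‖ ≤ √N * ‖x‖ * ‖Ψ‖ := by
  have step : ∀ N : ℕ, (∀ Ψ ∈ particlesLE h N, ‖annihilation x Ψ‖ ≤ √N * ‖x‖ * ‖Ψ‖) →
      ∀ Ψ ∈ particlesLE h N, ‖creation x Ψ‖ ≤ √(N + 1) * ‖x‖ * ‖Ψ‖ := by
    intro N hN Ψ hΨ
    refine (pow_le_pow_iff_left₀ (norm_nonneg _) (by positivity) two_ne_zero).1 ?_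
    have h1 := pow_le_pow_left₀ (norm_nonneg _) (hN Ψ hΨ) 2
    rw [mul_pow, mul_pow, Real.sq_sqrt (by positivity)] at h1
    rw [norm_creation_sq, mul_pow, mul_pow, Real.sq_sqrt (by positivity)]
    linarith
  have key : ∀ Ψ ∈ particlesLE h N, ‖annihilation x Ψ‖ ≤ √N * ‖x‖ * ‖Ψ‖ := by
    induction N with
    | zero =>
      intro Ψ hΨ
      rw [annihilation_eq_zero x hΨ, norm_zero]
      positivity
    | succ N ih =>
      intro Ψ hΨ
      rcases (norm_nonneg (annihilation x Ψ)).eq_or_lt with h0 | h0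
      · rw [← h0]
        positivity
      have h1 : ‖annihilation x Ψ‖ ^ 2 ≤ ‖Ψ‖ * ‖creation x (annihilation x Ψ)‖ := by
        rw [← inner_self_eq_norm_sq (𝕜 := ℂ), inner_annihilation]
        exact (Complex.re_le_norm _).trans (norm_inner_le_norm _ _)
      have h2 := step N ih _ (annihilation_mem x hΨ)
      push_cast
      refine le_of_mul_le_mul_right ?_ h0
      calc ‖annihilation x Ψ‖ * ‖annihilation x Ψ‖ = ‖annihilation x Ψ‖ ^ 2 := (sq _).symm
        _ ≤ ‖Ψ‖ * (√(N + 1) * ‖x‖ * ‖annihilation x Ψ‖) :=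
          h1.trans (mul_le_mul_of_nonneg_left h2 (norm_nonneg _))
        _ = √(N + 1) * ‖x‖ * ‖Ψ‖ * ‖annihilation x Ψ‖ := by ring
  exact ⟨step N key, key⟩

lemma fieldOp_mem {N : ℕ} (x : h) {Ψ : PreFock h} (hΨ : Ψ ∈ particlesLE h N) :
    fieldOp x Ψ ∈ particlesLE h (N + 1) :=
  Submodule.smul_mem _ _ (Submodule.add_mem _ (creation_mem x hΨ)
    (particlesLE_mono (Nat.le_succ _) (annihilation_mem x (particlesLE_mono (Nat.le_succ _) hΨ))))

lemma norm_fieldOp_le {N : ℕ} (x : h) {Ψ : PreFock h} (hΨ : Ψ ∈ particlesLE h N) :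
    ‖fieldOp x Ψ‖ ≤ 2 * ‖x‖ * √(N + 1) * ‖Ψ‖ := by
  obtain ⟨h1, h2⟩ := norm_creation_le_and_norm_annihilation_le x N
  have h3 : √(N : ℝ) ≤ √(N + 1) := Real.sqrt_le_sqrt (by linarith)
  have h4 : ‖creation x Ψ + annihilation x Ψ‖ ≤ 2 * ‖x‖ * √(N + 1) * ‖Ψ‖ := by
    refine (norm_add_le _ _).trans ((add_le_add (h1 Ψ hΨ) ((h2 Ψ hΨ).trans
      (mul_le_mul_of_nonneg_right (mul_le_mul_of_nonneg_right h3 (norm_nonneg _))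
        (norm_nonneg _)))).trans_eq ?_)
    ring
  have h5 : ‖((√2 : ℝ) : ℂ)⁻¹‖ ≤ 1 := by
    rw [norm_inv, Complex.norm_real, Real.norm_of_nonneg (Real.sqrt_nonneg _)]
    exact inv_le_one_of_one_le₀ (Real.one_le_sqrt.2 one_le_two)
  change ‖((√2 : ℝ) : ℂ)⁻¹ • (creation x Ψ + annihilation x Ψ)‖ ≤ _
  rw [norm_smul]
  exact (mul_le_of_le_one_left (norm_nonneg _) h5).trans h4

lemma norm_fieldOp_pow_le {N : ℕ} (x : h) {Ψ : PreFock h} (hΨ : Ψ ∈ particlesLE h N) (n : ℕ) :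
    (fieldOp x ^ n) Ψ ∈ particlesLE h (N + n) ∧
      ‖(fieldOp x ^ n) Ψ‖ ≤ (2 * ‖x‖) ^ n * (∏ k ∈ Finset.range n, √(N + k + 1)) * ‖Ψ‖ := by
  induction n with
  | zero => simpa using hΨ
  | succ n ih =>
    rw [pow_succ', Module.End.mul_apply]
    refine ⟨fieldOp_mem x ih.1, (norm_fieldOp_le x ih.1).trans ?_⟩
    rw [Finset.prod_range_succ, pow_succ]
    push_cast
    calc 2 * ‖x‖ * √(N + n + 1) * ‖(fieldOp x ^ n) Ψ‖ ≤ 2 * ‖x‖ * √(N + n + 1) *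
        ((2 * ‖x‖) ^ n * (∏ k ∈ Finset.range n, √(N + k + 1)) * ‖Ψ‖) :=
          mul_le_mul_of_nonneg_left ih.2 (by positivity)
      _ = _ := by ring

lemma summable_prod_sqrt (N : ℕ) (R : ℝ) :
    Summable fun n : ℕ => R ^ n / n.factorial * ∏ k ∈ Finset.range n, √(N + k + 1 : ℝ) := by
  refine summable_of_ratio_norm_eventually_le (r := 1 / 2) (by norm_num) ?_
  -- The ratio of consecutive terms is `R √(N + n + 1) / (n + 1)`. Since `N + n + 1 ≤ (N + 1)(n +
  -- 1)`, its absolute value is at most `1/2` once `n ≥ 4 R² (N + 1)`.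
  obtain ⟨m, hm⟩ := exists_nat_ge (4 * R ^ 2 * (N + 1))
  filter_upwards [Filter.eventually_ge_atTop m] with n hn
  have hn' : 4 * R ^ 2 * (N + 1) ≤ n := hm.trans (by exact_mod_cast hn)
  have h1 : |R| * √(N + n + 1) ≤ 1 / 2 * (n + 1) := by
    refine (pow_le_pow_iff_left₀ (by positivity) (by positivity) two_ne_zero).1 ?_
    rw [mul_pow, Real.sq_sqrt (by positivity), sq_abs]
    have h2 : (N + n + 1 : ℝ) ≤ (N + 1) * (n + 1) := by
      nlinarith [mul_nonneg (N.cast_nonneg (α := ℝ)) (n.cast_nonneg (α := ℝ))]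
    have h3 := mul_le_mul_of_nonneg_left h2 (sq_nonneg R)
    have h4 : (0 : ℝ) ≤ n := Nat.cast_nonneg n
    nlinarith
  have h5 : R ^ (n + 1) / (n + 1).factorial * ∏ k ∈ Finset.range (n + 1), √(N + k + 1 : ℝ) =
      R * √(N + n + 1) / (n + 1) *
        (R ^ n / n.factorial * ∏ k ∈ Finset.range n, √(N + k + 1 : ℝ)) := by
    rw [Finset.prod_range_succ, Nat.factorial_succ]
    push_cast
    have : (n.factorial : ℝ) ≠ 0 := by positivity
    field_simp
    ring
  rw [h5, norm_mul]
  refine mul_le_mul_of_nonneg_right ?_ (norm_nonneg _)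
  rw [norm_div, norm_mul, Real.norm_of_nonneg (Real.sqrt_nonneg _), Real.norm_eq_abs,
    Real.norm_of_nonneg (by positivity : (0 : ℝ) ≤ n + 1), div_le_iff₀ (by positivity)]
  exact h1

lemma inner_fieldOp (x : h) (Φ Ψ : PreFock h) : ⟪fieldOp x Φ, Ψ⟫_ℂ = ⟪Φ, fieldOp x Ψ⟫_ℂ := by
  change ⟪((√2 : ℝ) : ℂ)⁻¹ • (creation x Φ + annihilation x Φ), Ψ⟫_ℂ =
    ⟪Φ, ((√2 : ℝ) : ℂ)⁻¹ • (creation x Ψ + annihilation x Ψ)⟫_ℂ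
  rw [inner_smul_left, inner_smul_right, inner_add_left, inner_add_right, inner_creation,
    inner_annihilation, map_inv₀, Complex.conj_ofReal, add_comm]

/-- On vectors of bounded particle number, powers of the field operator grow like `Cⁿ √(n!)` up to
polynomial factors, which the factorial beats for every radius. -/
lemma isEntireSymmetric_fieldOp (x : h) : IsEntireSymmetric (fieldOp x) where
  symm := inner_fieldOp x
  summable Ψ r := by
    obtain ⟨N, hN⟩ := exists_mem_particlesLE Ψ
    refine Summable.of_norm_bounded (((summable_prod_sqrt N (|r| * (2 * ‖x‖))).mul_right ‖Ψ‖))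
      fun n => ?_
    rw [norm_mul, norm_norm, norm_div, norm_pow, Real.norm_eq_abs, Real.norm_natCast, mul_pow]
    calc |r| ^ n / n.factorial * ‖(fieldOp x ^ n) Ψ‖ ≤ |r| ^ n / n.factorial *
        ((2 * ‖x‖) ^ n * (∏ k ∈ Finset.range n, √(N + k + 1)) * ‖Ψ‖) :=
          mul_le_mul_of_nonneg_left (norm_fieldOp_pow_le x hN n).2 (by positivity)
      _ = _ := by ring

lemma inner_fieldOp_fieldOp (x y : h) (Φ Ψ : PreFock h) :
    ⟪Φ, fieldOp x (fieldOp y Ψ)⟫_ℂ =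
      ⟪Φ, fieldOp y (fieldOp x Ψ)⟫_ℂ + Complex.I * (⟪x, y⟫_ℂ).im * ⟪Φ, Ψ⟫_ℂ := by
  have h1 : ∀ x y, fieldOp x (fieldOp y Ψ) = (2⁻¹ : ℂ) • (creation x (creation y Ψ) +
      creation x (annihilation y Ψ) + annihilation x (creation y Ψ) +
      annihilation x (annihilation y Ψ)) := fun x y => by
    change ((√2 : ℝ) : ℂ)⁻¹ • (creation x (((√2 : ℝ) : ℂ)⁻¹ • (creation y Ψ + annihilation y Ψ)) +
      annihilation x (((√2 : ℝ) : ℂ)⁻¹ • (creation y Ψ + annihilation y Ψ))) = _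
    have h2 : ((√2 : ℝ) : ℂ)⁻¹ * ((√2 : ℝ) : ℂ)⁻¹ = 2⁻¹ := by
      rw [← mul_inv, ← Complex.ofReal_mul, Real.mul_self_sqrt zero_le_two]
      norm_num
    rw [map_smul, map_smul, ← smul_add, smul_smul, h2, map_add, map_add]
    abel_nf
  have h3 : ⟪x, y⟫_ℂ - ⟪y, x⟫_ℂ = 2 * Complex.I * (⟪x, y⟫_ℂ).im := by
    rw [← inner_conj_symm y x, Complex.sub_conj]
    push_cast
    ring
  rw [h1 x y, h1 y x, annihilation_creation, annihilation_creation]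
  simp only [inner_smul_right, inner_add_right]
  rw [inner_creation_comm x y, inner_annihilation_comm x y]
  linear_combination (2⁻¹ * ⟪Φ, Ψ⟫_ℂ) * h3

lemma coe_fieldOp_add (x y : h) (Ψ : PreFock h) :
    ((fieldOp (x + y) Ψ : PreFock h) : Fock h) = (fieldOp x Ψ : PreFock h) +
      (fieldOp y Ψ : PreFock h) := by
  rw [← Completion.coe_add]
  refine Completion.coe_eq_coe_of_inner fun Φ => ?_
  change ⟪Φ, ((√2 : ℝ) : ℂ)⁻¹ • (creation (x + y) Ψ + annihilation (x + y) Ψ)⟫_ℂ =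
    ⟪Φ, ((√2 : ℝ) : ℂ)⁻¹ • (creation x Ψ + annihilation x Ψ) +
      ((√2 : ℝ) : ℂ)⁻¹ • (creation y Ψ + annihilation y Ψ)⟫_ℂ
  have h1 : ⟪Φ, creation (x + y) Ψ⟫_ℂ = ⟪Φ, creation x Ψ⟫_ℂ + ⟪Φ, creation y Ψ⟫_ℂ := by
    rw [← inner_annihilation, annihilation_add, inner_add_left, inner_annihilation,
      inner_annihilation]
  simp only [inner_smul_right, inner_add_right, h1, annihilation_add]
  ring

end PreFock

open PreFock

lemma weylF_eq_exp (x : h) : weylF x = (isEntireSymmetric_fieldOp x).exp 1 :=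
  (isEntireSymmetric_fieldOp x).expI_eq

lemma weylF_mem_unitary (x : h) : weylF x ∈ unitary (Fock h →L[ℂ] Fock h) := by
  rw [weylF_eq_exp]
  exact (isEntireSymmetric_fieldOp x).exp_mem_unitary 1

lemma norm_weylF_apply (x : h) (Ψ : Fock h) : ‖weylF x Ψ‖ = ‖Ψ‖ :=
  ContinuousLinearMap.norm_map_of_mem_unitary (weylF_mem_unitary x) Ψ

/-- The Weyl relations on Fock space. -/
lemma weylF_mul (x y : h) :
    weylF x * weylF y = Complex.exp (-(Complex.I / 2) * (⟪x, y⟫_ℂ).im) • weylF (x + y) := by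
  simp only [weylF_eq_exp]
  exact (isEntireSymmetric_fieldOp y).exp_mul_exp (isEntireSymmetric_fieldOp x)
    (isEntireSymmetric_fieldOp (x + y)) (inner_fieldOp_fieldOp x y) (coe_fieldOp_add x y)

/-- On a finite particle vector `Φ`, `‖W_F(x) Φ - Φ‖ ≤ ‖φ_F(x) Φ‖` is linear in `‖x‖` at fixed
particle number; unitarity extends the convergence to all vectors. -/
lemma tendsto_weylF_zero (Ψ : Fock h) :
    Filter.Tendsto (fun x : h => weylF x Ψ) (𝓝 0) (𝓝 Ψ) := by
  rw [Metric.tendsto_nhds]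
  intro ε hε
  obtain ⟨Φ, hΦ⟩ := Completion.denseRange_coe.exists_dist_lt Ψ (by positivity : 0 < ε / 3)
  obtain ⟨N, hN⟩ := exists_mem_particlesLE Φ
  have h1 : Filter.Tendsto (fun x : h => 2 * ‖x‖ * √(N + 1) * ‖Φ‖) (𝓝 0) (𝓝 0) := by
    have : Continuous fun x : h => 2 * ‖x‖ * √((N : ℝ) + 1) * ‖Φ‖ := by fun_prop
    simpa using this.tendsto 0
  filter_upwards [h1.eventually_lt_const (by positivity : 0 < ε / 3)] with x hx
  have h2 : dist (weylF x Ψ) (weylF x Φ) < ε / 3 := by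
    rwa [dist_eq_norm, ← map_sub, norm_weylF_apply, ← dist_eq_norm]
  have h3 : dist (weylF x Φ) Φ < ε / 3 := by
    rw [dist_eq_norm, weylF_eq_exp]
    exact (((isEntireSymmetric_fieldOp x).norm_exp_one_sub_le Φ).trans
      (norm_fieldOp_le x hN)).trans_lt hx
  have h4 := dist_triangle4 (weylF x Ψ) (weylF x Φ) Φ Ψ
  rw [dist_comm (Φ : Fock h)] at h4
  linarith

/-- The Weyl operators depend strongly continuously on the one-particle vector. -/
lemma continuous_weylF_apply (Ψ : Fock h) : Continuous fun x : h => weylF x Ψ := by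
  refine continuous_iff_continuousAt.2 fun y => ?_
  have h1 : Filter.Tendsto (fun x : h => x - y) (𝓝 y) (𝓝 0) := by
    have : Continuous fun x : h => x - y := by fun_prop
    simpa using this.tendsto y
  -- By the Weyl relations `W_F(x)` is a phase tending to `1` times `W_F(y) W_F(x - y)`, so
  -- continuity at `0` suffices.
  have h2 := ((weylF y).continuous.tendsto _).comp ((tendsto_weylF_zero Ψ).comp h1)
  have h3 : Filter.Tendsto (fun x : h => Complex.exp (Complex.I / 2 * (⟪y, x - y⟫_ℂ).im))
      (𝓝 y) (𝓝 1) := by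
    have : Continuous fun x : h => Complex.exp (Complex.I / 2 * (⟪y, x - y⟫_ℂ).im) := by fun_prop
    simpa using this.tendsto y
  have h4 := h3.smul h2
  rw [one_smul] at h4
  refine h4.congr fun x => ?_
  have h5 := congrArg (fun T : Fock h →L[ℂ] Fock h => T Ψ) (weylF_mul y (x - y))
  simp only [mul_apply_eq_comp, smul_apply, add_sub_cancel] at h5
  change Complex.exp (Complex.I / 2 * (⟪y, x - y⟫_ℂ).im) • weylF y (weylF (x - y) Ψ) = _
  rw [h5, smul_smul, ← Complex.exp_add]
  have : Complex.I / 2 * (⟪y, x - y⟫_ℂ).im + -(Complex.I / 2) * (⟪y, x - y⟫_ℂ).im = 0 := by ring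
  rw [this, Complex.exp_zero, one_smul]

end FockCCR

/-! ### Representations of the Weyl relations extend to the CCR algebra -/

section CCRRepresentation

variable {V : Type*} [AddCommGroup V]

lemma le_of_pow_le_mul_pow {a t : ℝ} (ht : 0 ≤ t) (d : ℕ)
    (h : ∀ n : ℕ, a ^ n ≤ t ^ n * ((n : ℝ) + 1) ^ d) : a ≤ t := by
  by_contra! hlt
  rcases ht.eq_or_lt with rfl | ht
  · have := h 1
    simp at this
    linarith
  set q := a / t
  have hq : 1 < q := (one_lt_div ht).2 hlt
  have hq0 : 0 < q := zero_lt_one.trans hq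
  have h1 := ((tendsto_pow_const_div_const_pow_of_one_lt d hq).comp (Filter.tendsto_add_atTop_nat 1))
  obtain ⟨n, hn⟩ := (h1.eventually_lt_const (inv_pos.2 hq0)).exists
  simp only [Function.comp_apply] at hn
  rw [div_lt_iff₀ (by positivity), pow_succ, mul_comm (q ^ n), inv_mul_cancel_left₀ hq0.ne'] at hn
  have h2 := h n
  rw [← div_le_iff₀' (by positivity), ← div_pow] at h2
  push_cast at hn
  exact absurd (h2.trans_lt hn) (lt_irrefl _)

/-- The sets of all sums `∑ kᵥ v`, `v ∈ T`, with natural numbers `kᵥ ≤ n`. -/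
def sumBox [DecidableEq V] (T : Finset V) (n : ℕ) : Finset V :=
  (Fintype.piFinset fun _ : T => Finset.range (n + 1)).image fun k => ∑ v : T, k v • (v : V)

lemma card_sumBox_le [DecidableEq V] (T : Finset V) (n : ℕ) :
    ((sumBox T n).card : ℝ) ≤ ((n : ℝ) + 1) ^ T.card := by
  have : (sumBox T n).card ≤ (n + 1) ^ T.card := by
    refine Finset.card_image_le.trans_eq ?_
    simp
  exact_mod_cast this

lemma sumBox_nonempty [DecidableEq V] (T : Finset V) (n : ℕ) : (sumBox T n).Nonempty :=
  ⟨_, Finset.mem_image_of_mem _ (Fintype.mem_piFinset.2 fun _ =>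
    Finset.mem_range.2 (Nat.succ_pos n) : (fun _ => 0) ∈ _)⟩

lemma add_mem_sumBox [DecidableEq V] {T : Finset V} {n : ℕ} {u v : V} (hu : u ∈ sumBox T n)
    (hv : v ∈ T) : u + v ∈ sumBox T (n + 1) := by
  obtain ⟨k, hk, rfl⟩ := Finset.mem_image.1 hu
  refine Finset.mem_image.2 ⟨k + Pi.single ⟨v, hv⟩ 1, Fintype.mem_piFinset.2 fun w => ?_, ?_⟩
  · have h1 := Finset.mem_range.1 (Fintype.mem_piFinset.1 hk w)
    rw [Finset.mem_range, Pi.add_apply]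
    have h2 : (Pi.single (⟨v, hv⟩ : T) 1 : T → ℕ) w ≤ 1 := by
      rw [Pi.single_apply]
      split_ifs <;> simp
    omega
  · simp only [Pi.add_apply, add_smul, Finset.sum_add_distrib]
    congr 1
    rw [Finset.sum_eq_single ⟨v, hv⟩ (fun w _ hw => by rw [Pi.single_eq_of_ne hw, zero_smul])
      (by simp)]
    simp

/-! ### Weyl operators on `ℓ²(V)` and density of their span -/

section RegularRepresentation

variable [Module ℝ V] (s : V →ₗ[ℝ] V →ₗ[ℝ] ℝ)

lemma weylOp_apply (v : V) (ψ : lp (fun _ : V => ℂ) 2) (w : V) :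
    weylOp s v ψ w = Complex.exp (-(Complex.I / 2) * (s v w : ℝ)) * ψ (w - v) := rfl

lemma weylOp_zero : weylOp s 0 = 1 := by
  ext ψ w
  simp [weylOp_apply]

lemma weylOp_mul (hs : ∀ v, s v v = 0) (v w : V) :
    weylOp s v * weylOp s w = Complex.exp (-(Complex.I / 2) * (s v w : ℝ)) • weylOp s (v + w) := by
  have hvw : s w v = -s v w := by
    have := hs (v + w)
    simp only [map_add, LinearMap.add_apply, hs] at this
    linarith
  ext ψ u
  change weylOp s v (weylOp s w ψ) u = Complex.exp _ * weylOp s (v + w) ψ u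
  rw [weylOp_apply, weylOp_apply, weylOp_apply, ← mul_assoc, ← mul_assoc, ← Complex.exp_add,
    ← Complex.exp_add, sub_sub, map_sub, hvw, map_add, LinearMap.add_apply]
  congr 2
  push_cast
  ring

lemma norm_weylOp_apply_le (v : V) (ψ : lp (fun _ : V => ℂ) 2) : ‖weylOp s v ψ‖ ≤ ‖ψ‖ :=
  ((weylOp s v).le_of_opNorm_le (LinearMap.mkContinuous_norm_le _ zero_le_one _) ψ).trans_eq
    (one_mul _)

lemma star_weylOp (hs : ∀ v, s v v = 0) (v : V) : star (weylOp s v) = weylOp s (-v) := by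
  have h1 : ∀ v, weylOp s v * weylOp s (-v) = 1 := fun v => by
    rw [weylOp_mul s hs, map_neg, hs, add_neg_cancel, weylOp_zero]
    simp
  have h2 : ∀ ψ, ‖weylOp s v ψ‖ = ‖ψ‖ := fun ψ => by
    refine le_antisymm (norm_weylOp_apply_le s v ψ) ?_
    have h3 := norm_weylOp_apply_le s (-v) (weylOp s v ψ)
    have h4 := h1 (-v)
    rw [neg_neg] at h4
    rwa [← mul_apply_eq_comp, h4] at h3
  have h5 : star (weylOp s v) * weylOp s v = 1 :=
    (ContinuousLinearMap.norm_map_iff_adjoint_comp_self (weylOp s v)).1 h2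
  exact left_inv_eq_right_inv h5 (h1 v)

/-- By the Weyl relations the span is already closed under products and adjoints. -/
lemma adjoin_weylOp_le_span (hs : ∀ v, s v v = 0) {a : lp (fun _ : V => ℂ) 2 →L[ℂ] lp (fun _ : V => ℂ) 2}
    (ha : a ∈ StarAlgebra.adjoin ℂ (Set.range (weylOp s))) :
    a ∈ Submodule.span ℂ (Set.range (weylOp s)) := by
  induction ha using StarAlgebra.adjoin_induction with
  | mem x hx => exact Submodule.subset_span hx
  | algebraMap r =>
    rw [Algebra.algebraMap_eq_smul_one, ← weylOp_zero s]
    exact Submodule.smul_mem _ _ (Submodule.subset_span ⟨0, rfl⟩)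
  | add x y _ _ hx hy => exact Submodule.add_mem _ hx hy
  | mul x y _ _ hx hy =>
    have h1 := Submodule.mul_mem_mul hx hy
    rw [Submodule.span_mul_span] at h1
    refine Submodule.span_le.2 ?_ h1
    rintro _ ⟨_, ⟨v, rfl⟩, _, ⟨w, rfl⟩, rfl⟩
    change weylOp s v * weylOp s w ∈ Submodule.span ℂ (Set.range (weylOp s))
    rw [weylOp_mul s hs]
    exact Submodule.smul_mem _ _ (Submodule.subset_span ⟨v + w, rfl⟩)
  | star x _ hx =>
    refine Submodule.span_induction
      (p := fun x _ => star x ∈ Submodule.span ℂ (Set.range (weylOp s))) ?_ ?_ ?_ ?_ hx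
    · rintro _ ⟨v, rfl⟩
      rw [star_weylOp s hs]
      exact Submodule.subset_span ⟨-v, rfl⟩
    · rw [star_zero]
      exact Submodule.zero_mem _
    · intro x y _ _ h1 h2
      rw [star_add]
      exact Submodule.add_mem _ h1 h2
    · intro c x _ h1
      rw [star_smul]
      exact Submodule.smul_mem _ _ h1

lemma coe_linearCombination_W (f : V →₀ ℂ) :
    ((Finsupp.linearCombination ℂ (CCR.W s) f : CCR s) :
      lp (fun _ : V => ℂ) 2 →L[ℂ] lp (fun _ : V => ℂ) 2) =
      Finsupp.linearCombination ℂ (weylOp s) f := by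
  have := Finsupp.apply_linearCombination ℂ (CCR s).toSubalgebra.val.toLinearMap (CCR.W s) f
  exact this

/-- Finite linear combinations of Weyl operators are dense in the CCR algebra. -/
lemma denseRange_linearCombination_W (hs : ∀ v, s v v = 0) :
    DenseRange (Finsupp.linearCombination ℂ (CCR.W s)) := by
  intro x
  rw [closure_subtype]
  have h1 : (x : lp (fun _ : V => ℂ) 2 →L[ℂ] lp (fun _ : V => ℂ) 2) ∈
      closure (StarAlgebra.adjoin ℂ (Set.range (weylOp s)) : Set _) := x.2
  refine closure_mono (fun a ha => ?_) h1
  have h2 := adjoin_weylOp_le_span s hs ha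
  rw [← Finsupp.range_linearCombination] at h2
  obtain ⟨f, rfl⟩ := h2
  exact ⟨_, ⟨f, rfl⟩, coe_linearCombination_W s f⟩

@[elab_as_elim]
lemma CCR.induction (hs : ∀ v, s v v = 0) {P : CCR s → Prop} (hP : IsClosed {x | P x})
    (hW : ∀ v, P (CCR.W s v)) (hadd : ∀ x y, P x → P y → P (x + y))
    (hsmul : ∀ (c : ℂ) x, P x → P (c • x)) (x : CCR s) : P x := by
  refine (denseRange_linearCombination_W s hs).induction_on x hP fun f => ?_
  induction f using Finsupp.induction_linear with
  | zero =>
    have := hsmul 0 _ (hW 0)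
    rwa [zero_smul, ← map_zero (Finsupp.linearCombination ℂ (CCR.W s))] at this
  | add f g h1 h2 =>
    rw [map_add]
    exact hadd _ _ h1 h2
  | single v c =>
    rw [Finsupp.linearCombination_single]
    exact hsmul _ _ (hW v)

end RegularRepresentation

end CCRRepresentation

/-! ### Maximality of the regular norm and extension of representations -/

section CCRExtension

variable {V : Type*} [AddCommGroup V] [Module ℝ V] (s : V →ₗ[ℝ] V →ₗ[ℝ] ℝ)

lemma linearCombination_weylOp_apply (c : V →₀ ℂ) (ψ : lp (fun _ : V => ℂ) 2) (u : V) :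
    Finsupp.linearCombination ℂ (weylOp s) c ψ u =
      c.sum fun v a => a * Complex.exp (-(Complex.I / 2) * (s v u : ℝ)) * ψ (u - v) := by
  rw [Finsupp.linearCombination_apply, Finsupp.sum, Finsupp.sum, sum_apply, lp.coeFn_sum,
    Finset.sum_apply]
  refine Finset.sum_congr rfl fun v _ => ?_
  rw [mul_assoc]
  rfl

omit [AddCommGroup V] [Module ℝ V] in
lemma memℓp_two_of_support {f : V → ℂ} {S : Finset V} (hf : ∀ u ∉ S, f u = 0) : Memℓp f 2 := by
  have h2 : 0 < (2 : ENNReal).toReal := by norm_num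
  rw [memℓp_gen_iff h2]
  exact summable_of_ne_finset_zero (s := S) fun u hu => by simp [hf u hu]

lemma CCR.norm_coe (x : CCR s) :
    ‖x‖ = ‖(x : lp (fun _ : V => ℂ) 2 →L[ℂ] lp (fun _ : V => ℂ) 2)‖ := rfl

lemma norm_linearCombination_W (c : V →₀ ℂ) :
    ‖Finsupp.linearCombination ℂ (CCR.W s) c‖ = ‖Finsupp.linearCombination ℂ (weylOp s) c‖ :=
  (CCR.norm_coe s _).trans (congrArg norm (coe_linearCombination_W s c))

lemma CCR.W_mul {s : V →ₗ[ℝ] V →ₗ[ℝ] ℝ} (hs : ∀ v, s v v = 0) (v w : V) :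
    CCR.W s v * CCR.W s w = Complex.exp (-(Complex.I / 2) * (s v w : ℝ)) • CCR.W s (v + w) :=
  Subtype.ext (weylOp_mul s hs v w)

lemma CCR.W_zero : CCR.W s 0 = 1 := Subtype.ext (weylOp_zero s)

lemma CCR.star_W {s : V →ₗ[ℝ] V →ₗ[ℝ] ℝ} (hs : ∀ v, s v v = 0) (v : V) : star (CCR.W s v) = CCR.W s (-v) :=
  Subtype.ext (star_weylOp s hs v)

variable {K : Type*} [NormedAddCommGroup K] [InnerProductSpace ℂ K]

/-- The norm of `T ⊗ 1` on `ℓ²(V) ⊗ K` is at most the norm of `T`. -/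
lemma sum_norm_sq_le_of_support (c : V →₀ ℂ) {Ψ : V → K} {S' : Finset V}
    (hΨ : ∀ u ∉ S', Ψ u = 0) (S : Finset V) :
    ∑ u ∈ S, ‖c.sum fun v a => (a * Complex.exp (-(Complex.I / 2) * (s v u : ℝ))) • Ψ (u - v)‖ ^ 2
      ≤ ‖Finsupp.linearCombination ℂ (weylOp s) c‖ ^ 2 * ∑ u ∈ S', ‖Ψ u‖ ^ 2 := by
  set T := Finsupp.linearCombination ℂ (weylOp s) c with hT
  -- Finitely many values span a finite-dimensional space. In an orthonormal basis of it, `Ψ`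
  -- becomes finitely many functions in `ℓ²(V)`, and `T` acts on each coordinate separately.
  set E : Submodule ℂ K := Submodule.span ℂ (Ψ '' S') with hE
  have : FiniteDimensional ℂ E := FiniteDimensional.span_of_finite ℂ (S'.finite_toSet.image Ψ)
  set b := stdOrthonormalBasis ℂ E
  have hΨE : ∀ u, Ψ u ∈ E := fun u => by
    by_cases hu : u ∈ S'
    · exact Submodule.subset_span ⟨u, hu, rfl⟩
    · rw [hΨ u hu]
      exact E.zero_mem
  have hpars : ∀ x ∈ E, ‖x‖ ^ 2 = ∑ k, ‖⟪(b k : K), x⟫_ℂ‖ ^ 2 := fun x hx =>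
    (b.sum_sq_norm_inner_right ⟨x, hx⟩).symm
  have hsupp : ∀ k, ∀ u ∉ S', ⟪(b k : K), Ψ u⟫_ℂ = 0 := fun k u hu => by
    rw [hΨ u hu, inner_zero_right]
  set ψ : Fin (Module.finrank ℂ E) → lp (fun _ : V => ℂ) 2 := fun k =>
    ⟨fun u => ⟪(b k : K), Ψ u⟫_ℂ, memℓp_two_of_support (hsupp k)⟩
  have h2 : 0 < (2 : ENNReal).toReal := by norm_num
  have hψ : ∀ k, ‖ψ k‖ ^ 2 = ∑ u ∈ S', ‖⟪(b k : K), Ψ u⟫_ℂ‖ ^ 2 := fun k => by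
    have h3 := lp.norm_rpow_eq_tsum h2 (ψ k)
    simp only [ENNReal.toReal_ofNat, Real.rpow_ofNat] at h3
    rw [h3, tsum_eq_sum (s := S') fun u hu => ?_]
    change ‖⟪(b k : K), Ψ u⟫_ℂ‖ ^ 2 = 0
    rw [hsupp k u hu, norm_zero]
    norm_num
  have hTψ : ∀ k u, T (ψ k) u = ⟪(b k : K),
      c.sum fun v a => (a * Complex.exp (-(Complex.I / 2) * (s v u : ℝ))) • Ψ (u - v)⟫_ℂ := by
    intro k u
    rw [hT, linearCombination_weylOp_apply, Finsupp.sum, Finsupp.sum, inner_sum]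
    refine Finset.sum_congr rfl fun v _ => ?_
    rw [inner_smul_right]
  calc ∑ u ∈ S, ‖c.sum fun v a => (a * Complex.exp (-(Complex.I / 2) * (s v u : ℝ))) • Ψ (u - v)‖ ^ 2
      = ∑ k, ∑ u ∈ S, ‖T (ψ k) u‖ ^ 2 := by
        rw [Finset.sum_comm]
        refine Finset.sum_congr rfl fun u _ => ?_
        have h3 : (c.sum fun v a => (a * Complex.exp (-(Complex.I / 2) * (s v u : ℝ))) •
            Ψ (u - v)) ∈ E := Submodule.sum_mem _ fun v _ => Submodule.smul_mem _ _ (hΨE _)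
        rw [hpars _ h3]
        refine Finset.sum_congr rfl fun k _ => ?_
        rw [hTψ]
    _ ≤ ∑ k, ‖T‖ ^ 2 * ‖ψ k‖ ^ 2 := by
        refine Finset.sum_le_sum fun k _ => ?_
        have h3 := lp.sum_rpow_le_norm_rpow h2 (T (ψ k)) S
        simp only [ENNReal.toReal_ofNat, Real.rpow_ofNat] at h3
        rw [← mul_pow]
        exact h3.trans (pow_le_pow_left₀ (norm_nonneg _) (T.le_opNorm _) 2)
    _ = ‖T‖ ^ 2 * ∑ u ∈ S', ‖Ψ u‖ ^ 2 := by
        rw [← Finset.mul_sum]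
        congr 1
        simp only [hψ]
        rw [Finset.sum_comm]
        exact Finset.sum_congr rfl fun u _ => (hpars _ (hΨE u)).symm

variable [CompleteSpace K]

/-- A unitary representation of the Weyl relations. -/
structure IsWeylRepresentation (U : V → K →L[ℂ] K) : Prop where
  unitary : ∀ v, U v ∈ unitary (K →L[ℂ] K)
  mul : ∀ v w, U v * U w = Complex.exp (-(Complex.I / 2) * (s v w : ℝ)) • U (v + w)

variable {s} {U : V → K →L[ℂ] K} (hU : IsWeylRepresentation s U)

include hU

/-- The regular representation has the largest norm, since `V` is amenable: the sets `sumBox` grow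
polynomially. -/
lemma IsWeylRepresentation.norm_linearCombination_le (hs : ∀ v, s v v = 0) (c : V →₀ ℂ) :
    ‖Finsupp.linearCombination ℂ U c‖ ≤ ‖Finsupp.linearCombination ℂ (weylOp s) c‖ := by
  classical
  set T := Finsupp.linearCombination ℂ (weylOp s) c with hT
  set A := Finsupp.linearCombination ℂ U c with hA
  refine ContinuousLinearMap.opNorm_le_bound _ (norm_nonneg _) fun ψ => ?_
  -- The negatives are used so that `u ∈ B n` and `v` in the support of `c` give `u - v ∈ B (n +
  -- 1)`.
  set B : ℕ → Finset V := sumBox (c.support.image fun v => -v) with hB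
  have hskew : ∀ v w, s w v = -s v w := fun v w => by
    have := hs (v + w)
    simp only [map_add, LinearMap.add_apply, hs] at this
    linarith
  have hnorm : ∀ v x, ‖U v x‖ = ‖x‖ := fun v x =>
    ContinuousLinearMap.norm_map_of_mem_unitary (hU.unitary v) x
  have step : ∀ n, ((B n).card : ℝ) * ‖A ψ‖ ^ 2 ≤ (‖T‖ * ‖ψ‖) ^ 2 * (B (n + 1)).card := by
    intro n
    -- Untruncated, `u ↦ U (-u) ψ` intertwines `T` with `A`: by the Weyl relations the image at `u`
    -- is `U (-u) (A ψ)`. The truncation to `B (n + 1)` does not affect points of `B n`.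
    set Ψ : V → K := fun u => if u ∈ B (n + 1) then U (-u) ψ else 0 with hΨ
    have h1 := sum_norm_sq_le_of_support s c (Ψ := Ψ) (S' := B (n + 1))
      (fun u hu => if_neg hu) (B n)
    have h2 : ∑ u ∈ B (n + 1), ‖Ψ u‖ ^ 2 = (B (n + 1)).card * ‖ψ‖ ^ 2 := by
      rw [← nsmul_eq_mul, ← Finset.sum_const]
      refine Finset.sum_congr rfl fun u hu => ?_
      simp only [hΨ, if_pos hu, hnorm]
    have h3 : ∀ u ∈ B n,
        (c.sum fun v a => (a * Complex.exp (-(Complex.I / 2) * (s v u : ℝ))) • Ψ (u - v)) =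
          U (-u) (A ψ) := by
      intro u hu
      rw [hA, Finsupp.linearCombination_apply, Finsupp.sum, Finsupp.sum, sum_apply, map_sum]
      refine Finset.sum_congr rfl fun v hv => ?_
      have h4 : u - v ∈ B (n + 1) := by
        rw [sub_eq_add_neg]
        exact add_mem_sumBox hu (Finset.mem_image_of_mem _ hv)
      have h5 := congrArg (fun T : K →L[ℂ] K => T ψ) (hU.mul (-u) v)
      simp only [mul_apply_eq_comp, smul_apply] at h5
      rw [smul_apply, map_smul, h5, smul_smul]
      simp only [hΨ, if_pos h4]
      rw [map_neg, LinearMap.neg_apply, ← hskew, neg_sub, neg_add_eq_sub]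
    rw [Finset.sum_congr rfl fun u hu => by rw [h3 u hu, hnorm], Finset.sum_const, nsmul_eq_mul,
      h2] at h1
    refine h1.trans_eq ?_
    ring
  -- Iterating the comparison leaves only the cardinality of `B n`, whose polynomial growth cannot
  -- affect the exponential rate.
  have hpow : ∀ n : ℕ, (‖A ψ‖ ^ 2) ^ n ≤ ((‖T‖ * ‖ψ‖) ^ 2) ^ n * (B n).card := by
    intro n
    induction n with
    | zero =>
      rw [pow_zero, pow_zero, one_mul]
      exact_mod_cast Finset.card_pos.2 (sumBox_nonempty _ 0)
    | succ n ih =>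
      calc (‖A ψ‖ ^ 2) ^ (n + 1) ≤ ((‖T‖ * ‖ψ‖) ^ 2) ^ n * (B n).card * ‖A ψ‖ ^ 2 := by
            rw [pow_succ]
            exact mul_le_mul_of_nonneg_right ih (sq_nonneg _)
        _ ≤ ((‖T‖ * ‖ψ‖) ^ 2) ^ n * ((‖T‖ * ‖ψ‖) ^ 2 * (B (n + 1)).card) := by
            rw [mul_assoc]
            exact mul_le_mul_of_nonneg_left (step n) (by positivity)
        _ = _ := by ring
  have h6 : ‖A ψ‖ ^ 2 ≤ (‖T‖ * ‖ψ‖) ^ 2 :=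
    le_of_pow_le_mul_pow (sq_nonneg _) (c.support.image fun v => -v).card fun n =>
      (hpow n).trans (mul_le_mul_of_nonneg_left (card_sumBox_le _ n) (by positivity))
  exact (pow_le_pow_iff_left₀ (norm_nonneg _) (by positivity) two_ne_zero).1 h6

lemma IsWeylRepresentation.exists_continuousLinearMap (hs : ∀ v, s v v = 0) :
    ∃ π : CCR s →L[ℂ] (K →L[ℂ] K), ∀ v, π (CCR.W s v) = U v := by
  refine ⟨(Finsupp.linearCombination ℂ U).extendOfNorm (Finsupp.linearCombination ℂ (CCR.W s)),
    fun v => ?_⟩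
  have h1 := LinearMap.extendOfNorm_eq (f := Finsupp.linearCombination ℂ U)
    (denseRange_linearCombination_W s hs) ⟨1, fun c => by
      rw [one_mul, norm_linearCombination_W s]
      exact hU.norm_linearCombination_le hs c⟩ (Finsupp.single v 1)
  rwa [Finsupp.linearCombination_single, Finsupp.linearCombination_single, one_smul,
    one_smul] at h1

lemma IsWeylRepresentation.apply_zero (hs : ∀ v, s v v = 0) : U 0 = 1 := by
  have h1 := hU.mul 0 0
  rw [hs, Complex.ofReal_zero, mul_zero, Complex.exp_zero, one_smul, add_zero] at h1
  have h2 := (Unitary.mem_iff.1 (hU.unitary 0)).1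
  rw [← one_mul (U 0), ← h2, mul_assoc, h1]

lemma IsWeylRepresentation.star_apply (hs : ∀ v, s v v = 0) (v : V) : star (U v) = U (-v) := by
  have h1 := hU.mul v (-v)
  rw [map_neg, hs, neg_zero, Complex.ofReal_zero, mul_zero, Complex.exp_zero, one_smul,
    add_neg_cancel, hU.apply_zero hs] at h1
  exact left_inv_eq_right_inv (Unitary.mem_iff.1 (hU.unitary v)).1 h1

set_option maxHeartbeats 1000000 in
lemma IsWeylRepresentation.map_W_mul_of_map_W (hs : ∀ v, s v v = 0)
    {π : CCR s →L[ℂ] (K →L[ℂ] K)} (hπ : ∀ v, π (CCR.W s v) = U v) (v : V) (y : CCR s) :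
    π (CCR.W s v * y) = U v * π y := by
  induction y using CCR.induction s hs with
  | hP =>
    exact isClosed_eq (π.continuous.comp (continuous_const_mul _))
      ((continuous_const_mul _).comp π.continuous)
  | hW w => rw [CCR.W_mul hs, ContinuousLinearMap.map_smul, hπ, hπ, hU.mul]
  | hadd x y h1 h2 =>
    rw [mul_add, ContinuousLinearMap.map_add, ContinuousLinearMap.map_add, mul_add, h1, h2]
  | hsmul c x h1 =>
    have h2 : CCR.W s v * c • x = c • (CCR.W s v * x) := Algebra.mul_smul_comm c _ _
    have h3 : U v * c • π x = c • (U v * π x) := Algebra.mul_smul_comm c _ _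
    rw [h2, π.map_smul c (CCR.W s v * x), π.map_smul c x, h3, h1]

set_option maxHeartbeats 1000000 in
lemma IsWeylRepresentation.map_mul_of_map_W (hs : ∀ v, s v v = 0) {π : CCR s →L[ℂ] (K →L[ℂ] K)}
    (hπ : ∀ v, π (CCR.W s v) = U v) (x y : CCR s) : π (x * y) = π x * π y := by
  induction x using CCR.induction s hs with
  | hP =>
    exact isClosed_eq (π.continuous.comp (continuous_mul_const _))
      ((continuous_mul_const _).comp π.continuous)
  | hW v => rw [hU.map_W_mul_of_map_W hs hπ, hπ]
  | hadd x z h1 h2 =>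
    rw [add_mul, ContinuousLinearMap.map_add, ContinuousLinearMap.map_add, add_mul, h1, h2]
  | hsmul c x h1 =>
    have h2 : c • x * y = c • (x * y) := Algebra.smul_mul_assoc c _ _
    have h3 : c • π x * π y = c • (π x * π y) := Algebra.smul_mul_assoc c _ _
    rw [h2, π.map_smul c (x * y), π.map_smul c x, h3, h1]

lemma IsWeylRepresentation.map_star_of_map_W (hs : ∀ v, s v v = 0) {π : CCR s →L[ℂ] (K →L[ℂ] K)}
    (hπ : ∀ v, π (CCR.W s v) = U v) (x : CCR s) : π (star x) = star (π x) := by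
  induction x using CCR.induction s hs with
  | hP =>
    have h1 : Continuous fun x : CCR s => star x :=
      Continuous.subtype_mk (continuous_star.comp continuous_subtype_val) _
    exact isClosed_eq (π.continuous.comp h1) (continuous_star.comp π.continuous)
  | hW v => rw [CCR.star_W hs, hπ, hπ, hU.star_apply hs]
  | hadd x y h1 h2 =>
    have h3 : star (x + y) = star x + star y := Subtype.ext (star_add _ _)
    rw [h3, ContinuousLinearMap.map_add, ContinuousLinearMap.map_add, star_add, h1, h2]
  | hsmul c x h1 =>
    have h3 : star (c • x) = star c • star x := Subtype.ext (star_smul _ _)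
    rw [h3, ContinuousLinearMap.map_smul, ContinuousLinearMap.map_smul, star_smul, h1]

/-- Every unitary representation of the Weyl relations extends to the CCR algebra. -/
lemma IsWeylRepresentation.exists_starAlgHom (hs : ∀ v, s v v = 0) :
    ∃ π : CCR s →⋆ₐ[ℂ] (K →L[ℂ] K), Continuous π ∧ ∀ v, π (CCR.W s v) = U v := by
  obtain ⟨π, hπ⟩ := hU.exists_continuousLinearMap hs
  have hone : π 1 = 1 := by rw [← CCR.W_zero s, hπ, hU.apply_zero hs]
  have hc : ∀ r : ℂ, π (algebraMap ℂ (CCR s) r) = algebraMap ℂ (K →L[ℂ] K) r := fun r => by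
    rw [Algebra.algebraMap_eq_smul_one, Algebra.algebraMap_eq_smul_one, ContinuousLinearMap.map_smul, hone]
  exact ⟨{ toFun := π
           map_one' := hone
           map_mul' := hU.map_mul_of_map_W hs hπ
           map_zero' := ContinuousLinearMap.map_zero π
           map_add' := ContinuousLinearMap.map_add π
           commutes' := hc
           map_star' := hU.map_star_of_map_W hs hπ }, π.continuous, hπ⟩

end CCRExtension

/-! ### The Kay-Wald representation -/

/-- If the image of a generating set commutes with a `*`-closed set of operators, then so does the
image of the generated closed `*`-algebra. -/
lemma commute_map_of_mem_topologicalClosure_adjoin {A B : Type*} [Ring A] [StarRing A]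
    [Algebra ℂ A] [StarModule ℂ A] [TopologicalSpace A] [IsTopologicalSemiring A]
    [ContinuousStar A] [Ring B] [StarRing B] [Algebra ℂ B] [TopologicalSpace B] [T2Space B]
    [IsTopologicalSemiring B] {π : A →⋆ₐ[ℂ] B} (hc : Continuous π) {S : Set A} {C : Set B}
    (hC : ∀ T ∈ C, star T ∈ C) (h : ∀ x ∈ S, ∀ T ∈ C, π x * T = T * π x) {x : A}
    (hx : x ∈ (StarAlgebra.adjoin ℂ S).topologicalClosure) {T : B} (hT : T ∈ C) :
    π x * T = T * π x := by
  have key : ∀ x ∈ StarAlgebra.adjoin ℂ S, ∀ T ∈ C, π x * T = T * π x := by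
    intro x hx
    induction hx using StarAlgebra.adjoin_induction with
    | mem x hx => exact h x hx
    | algebraMap r =>
      intro T _
      rw [AlgHomClass.commutes]
      exact Algebra.commutes r T
    | add x y _ _ hx hy =>
      intro T hT
      rw [map_add, add_mul, mul_add, hx T hT, hy T hT]
    | mul x y _ _ hx hy =>
      intro T hT
      rw [map_mul, mul_assoc, hy T hT, ← mul_assoc, hx T hT, mul_assoc]
    | star x _ hx =>
      intro T hT
      -- Commutation of `x` with `star T` is the adjoint of commutation of `star x` with `T`; this
      -- is where `C` must be stable under `star`.
      have h1 := congrArg star (hx _ (hC T hT))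
      rw [star_mul, star_mul, star_star] at h1
      rw [map_star]
      exact h1.symm
  have hcl : IsClosed {x : A | π x * T = T * π x} :=
    isClosed_eq ((continuous_mul_const T).comp hc) ((continuous_const_mul T).comp hc)
  exact closure_minimal (fun y hy => key y hy T hT) hcl hx

namespace BulkBoundary

variable {X Xbd : Type*} [AddCommGroup X] [Module ℝ X] [TopologicalSpace X]
  [AddCommGroup Xbd] [Module ℝ Xbd] [TopologicalSpace Xbd] {F : BulkBoundary X Xbd}

lemma σform_apply (v w : F.Cpl) : F.σform v w = 2 * ⟪v, F.b w⟫_ℝ := F.σcpl_eq v w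

lemma σform_self (v : F.Cpl) : F.σform v v = 0 := by
  have h := F.inner_b v v
  rw [real_inner_comm] at h
  rw [σform_apply]
  linarith

namespace KayWald

variable (K : F.KayWald)

-- The rescaling `c = 2` works since `1 - (1 + |b|) / 2 = (1 - |b|) / 2` is a contraction. As `j`
-- commutes with `|b|`, it commutes with the root.
include K in
lemma sqrtPlus_spec : (∀ x, sqrtPlus F (sqrtPlus F x) = x + opAbs F.b x) ∧
    ∀ x, sqrtPlus F (K.j x) = K.j (sqrtPlus F x) := by
  have hS := (opAbs_spec F.norm_b_le).1
  obtain ⟨-, h1, h2⟩ := posSqrt_spec (A := 1 + opAbs F.b) (c := 2) (fun x y => by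
    have h3 : ⟪opAbs F.b x, y⟫_ℝ = ⟪x, opAbs F.b y⟫_ℝ := hS.1 x y
    change ⟪x + opAbs F.b x, y⟫_ℝ = ⟪x, y + opAbs F.b y⟫_ℝ
    rw [inner_add_left, inner_add_right, h3]) two_pos (by
      have h4 : (1 : F.Cpl →L[ℝ] F.Cpl) - (2 : ℝ)⁻¹ • (1 + opAbs F.b) =
          (2 : ℝ)⁻¹ • (1 - opAbs F.b) := by module
      rw [h4, norm_smul]
      have h5 := (norm_sub_le (1 : F.Cpl →L[ℝ] F.Cpl) (opAbs F.b)).trans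
        (add_le_add ContinuousLinearMap.norm_id_le (norm_opAbs_le F.norm_b_le))
      norm_num at h5 ⊢
      linarith)
  exact ⟨fun x => congrArg (fun T : F.Cpl →L[ℝ] F.Cpl => T x) h1, fun x =>
    (congrArg (fun T : F.Cpl →L[ℝ] F.Cpl => T x) (h2 K.j ((Commute.one_right _).add_right
      (ContinuousLinearMap.ext fun x => (K.abs_j x).symm))).eq).symm⟩

include K in
lemma sqrtMinus_spec : (∀ x, sqrtMinus F (sqrtMinus F x) = x - opAbs F.b x) ∧
    ∀ x, sqrtMinus F (K.j x) = K.j (sqrtMinus F x) := by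
  have hS := (opAbs_spec F.norm_b_le).1
  obtain ⟨-, h1, h2⟩ := posSqrt_spec (A := 1 - opAbs F.b) (c := 1) (fun x y => by
    have h3 : ⟪opAbs F.b x, y⟫_ℝ = ⟪x, opAbs F.b y⟫_ℝ := hS.1 x y
    change ⟪x - opAbs F.b x, y⟫_ℝ = ⟪x, y - opAbs F.b y⟫_ℝ
    rw [inner_sub_left, inner_sub_right, h3]) one_pos (by
      rw [inv_one, one_smul, sub_sub_cancel]
      exact norm_opAbs_le F.norm_b_le)
  exact ⟨fun x => congrArg (fun T : F.Cpl →L[ℝ] F.Cpl => T x) h1, fun x =>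
    (congrArg (fun T : F.Cpl →L[ℝ] F.Cpl => T x) (h2 K.j ((Commute.one_right _).sub_right
      (ContinuousLinearMap.ext fun x => (K.abs_j x).symm))).eq).symm⟩

lemma im_inner_space (L : KahlerStructure F.Cpl) (x y : F.Cpl) :
    (⟪L.toC x, L.toC y⟫_ℂ).im = -⟪x, L.j y⟫_ℝ := by
  change ((⟪x, y⟫_ℝ : ℂ) - Complex.I * (⟪x, L.j y⟫_ℝ : ℂ)).im = _
  simp

/-- The two summands contribute `-⟪v, (1 + |b|) j w⟫` and `+⟪v, (1 - |b|) j w⟫`, the sign being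
reversed by conjugation. Their sum is `-2 ⟪v, j |b| w⟫ = 2 ⟪v, b w⟫`. -/
lemma im_inner_vec (v w : F.Cpl) : (⟪K.vec v, K.vec w⟫_ℂ).im = F.σform v w := by
  obtain ⟨hp, hpj⟩ := sqrtPlus_spec K
  obtain ⟨hm, hmj⟩ := sqrtMinus_spec K
  have h1 : F.b w = -K.j (opAbs F.b w) := congrArg (fun T : F.Cpl →L[ℝ] F.Cpl => T w) K.polar
  have h2 : ⟪sqrtPlus F v, K.j (sqrtPlus F w)⟫_ℝ = ⟪v, K.j w⟫_ℝ + ⟪v, K.j (opAbs F.b w)⟫_ℝ := by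
    rw [← hpj, sqrtPlus, posSqrt_isSymmetric]
    change ⟪v, sqrtPlus F (sqrtPlus F (K.j w))⟫_ℝ = _
    rw [hp, inner_add_right, K.abs_j]
  have h3 : ⟪sqrtMinus F v, K.j (sqrtMinus F w)⟫_ℝ = ⟪v, K.j w⟫_ℝ - ⟪v, K.j (opAbs F.b w)⟫_ℝ := by
    rw [← hmj, sqrtMinus, posSqrt_isSymmetric]
    change ⟪v, sqrtMinus F (sqrtMinus F (K.j w))⟫_ℝ = _
    rw [hm, inner_sub_right, K.abs_j]
  rw [WithLp.prod_inner_apply, Complex.add_im]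
  change (⟪K.toKahlerStructure.toC (sqrtPlus F v), K.toKahlerStructure.toC (sqrtPlus F w)⟫_ℂ).im +
    (⟪K.toKahlerStructure.conj.toC (sqrtMinus F v),
      K.toKahlerStructure.conj.toC (sqrtMinus F w)⟫_ℂ).im = _
  have h4 : K.toKahlerStructure.conj.j (sqrtMinus F w) = -K.j (sqrtMinus F w) := rfl
  rw [im_inner_space, im_inner_space, h4, inner_neg_right, h2, h3, σform_apply, h1,
    inner_neg_right]
  ring

lemma vec_add (v w : F.Cpl) : K.vec (v + w) = K.vec v + K.vec w := by
  unfold vec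
  rw [← WithLp.toLp_add]
  congr 1
  refine Prod.ext ?_ (Subtype.ext ?_)
  · exact map_add (sqrtPlus F) v w
  · exact map_add (sqrtMinus F) v w

lemma continuous_vec : Continuous K.vec := by
  refine (WithLp.prod_continuous_toLp 2 _ _).comp (Continuous.prodMk ?_ ?_)
  · exact (sqrtPlus F).continuous
  · exact Continuous.subtype_mk (sqrtMinus F).continuous _

lemma isWeylRepresentation : IsWeylRepresentation F.σform K.weyl where
  unitary v := weylF_mem_unitary _
  mul v w := by
    rw [weyl, weyl, weyl, weylF_mul, K.im_inner_vec, K.vec_add]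

lemma continuous_weyl_apply (Ψ : K.Space) : Continuous fun v => K.weyl v Ψ :=
  (continuous_weylF_apply Ψ).comp K.continuous_vec

/-- Operators commuting with `e^{i φ_KW(v)}` for `v` in a set do so for `v` in its closure. -/
lemma weyl_mul_comm_of_mem_closure {T : K.Space →L[ℂ] K.Space} {S : Set F.Cpl}
    (hT : ∀ v ∈ S, K.weyl v * T = T * K.weyl v) {v : F.Cpl} (hv : v ∈ closure S) :
    K.weyl v * T = T * K.weyl v := by
  refine ContinuousLinearMap.ext fun Ψ => ?_
  have hc : IsClosed {v | K.weyl v (T Ψ) = T (K.weyl v Ψ)} :=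
    isClosed_eq (K.continuous_weyl_apply _) (T.continuous.comp (K.continuous_weyl_apply Ψ))
  exact closure_minimal (fun w hw => congrArg (fun R : K.Space →L[ℂ] K.Space => R Ψ) (hT w hw)) hc hv

end KayWald

/-! ### Density of boundary vectors and comparison of commutants -/

section Boundary

variable [IsTopologicalAddGroup X] [BarrelledSpace ℝ X] (F)

/-- The map `∂'` is linear. -/
def bdryDualLinear : Xbd →ₗ[ℝ] F.Cpl where
  toFun := F.bdryDual
  map_add' f g := ext_inner_right ℝ fun u => by
    rw [inner_add_left, F.inner_bdryDual, F.inner_bdryDual, F.inner_bdryDual, map_add]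
  map_smul' c f := ext_inner_right ℝ fun u => by
    rw [real_inner_smul_left, F.inner_bdryDual, F.inner_bdryDual, map_smul]
    rfl

/-- The closure is a double orthogonal complement. Orthogonality of `u` to every `∂' f` says that
`∂` annihilates the restriction of `η^cpl u`, and injectivity turns this into orthogonality of `u`
to the bulk. -/
lemma emb_mem_closure_range_bdryDual
    (hyp : ∀ u : WeakDual ℝ X, F.bdry (restrictDual F.bulk u) = 0 → ∀ w ∈ F.bulk, u w = 0)
    {w : X} (hw : w ∈ F.bulk) : F.emb w ∈ closure (Set.range F.bdryDual) := by
  change F.emb w ∈ (LinearMap.range F.bdryDualLinear).topologicalClosure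
  rw [← Submodule.orthogonal_orthogonal_eq_closure, Submodule.mem_orthogonal]
  intro u hu
  refine hyp (F.ηcpl u) (DFunLike.ext _ _ fun f => ?_) w hw
  rw [← F.inner_bdryDual]
  exact (Submodule.mem_orthogonal _ _).1 hu _ ⟨f, rfl⟩

variable {F} (K : F.KayWald)

/-- The generating set is closed under adjoints, because `W(∂' f)* = W(∂' (-f))` by linearity of
`∂'`. -/
lemma star_mem_centralizer_weyl_bdryDual {T : K.Space →L[ℂ] K.Space}
    (hT : T ∈ Set.centralizer (Set.range fun f : Xbd => K.weyl (F.bdryDual f))) :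
    star T ∈ Set.centralizer (Set.range fun f : Xbd => K.weyl (F.bdryDual f)) := by
  rintro _ ⟨f, rfl⟩
  have h1 : F.bdryDual f = -F.bdryDual (-f) :=
    (neg_eq_iff_eq_neg.1 (F.bdryDualLinear.map_neg f).symm)
  have h2 := hT _ ⟨-f, rfl⟩
  have h3 := congrArg star h2
  rw [star_mul, star_mul] at h3
  simp only at h3 ⊢
  rw [h1, ← K.isWeylRepresentation.star_apply σform_self]
  exact h3.symm

lemma commute_map_bulkAlgebra
    (hyp : ∀ u : WeakDual ℝ X, F.bdry (restrictDual F.bulk u) = 0 → ∀ w ∈ F.bulk, u w = 0)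
    {π : F.Algebra →⋆ₐ[ℂ] (K.Space →L[ℂ] K.Space)} (hc : Continuous π)
    (hπ : ∀ v : F.Cpl, π (CCR.W F.σform v) = K.weyl v) {x : F.Algebra} (hx : x ∈ F.bulkAlgebra)
    {T : K.Space →L[ℂ] K.Space}
    (hT : T ∈ Set.centralizer (Set.range fun f : Xbd => K.weyl (F.bdryDual f))) :
    π x * T = T * π x := by
  refine commute_map_of_mem_topologicalClosure_adjoin hc
    (fun T => star_mem_centralizer_weyl_bdryDual K) ?_ hx hT
  rintro _ ⟨_, ⟨w, hw, rfl⟩, rfl⟩ T hT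
  rw [hπ]
  refine K.weyl_mul_comm_of_mem_closure ?_ (F.emb_mem_closure_range_bdryDual hyp hw)
  rintro _ ⟨f, rfl⟩
  exact hT _ ⟨f, rfl⟩

end Boundary

end BulkBoundary

end

theorem theorem2p6 {X Xbd : Type*}
    [AddCommGroup X] [Module ℝ X] [TopologicalSpace X] [IsTopologicalAddGroup X]
    [ContinuousSMul ℝ X] [BarrelledSpace ℝ X]
    [AddCommGroup Xbd] [Module ℝ Xbd] [TopologicalSpace Xbd] [IsTopologicalAddGroup Xbd]
    [ContinuousSMul ℝ Xbd]
    (F : BulkBoundary X Xbd)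
    (hyp1 : Continuous F.η)
    (hyp2 : ∀ u : WeakDual ℝ X, F.bdry (restrictDual F.bulk u) = 0 → ∀ w ∈ F.bulk, u w = 0)
    (hker : Even (Module.finrank ℝ F.kerσ) ∨ ¬ FiniteDimensional ℝ F.kerσ) :
    Nonempty F.KayWald ∧
    ∀ K : F.KayWald, ∃ π : F.Algebra →⋆ₐ[ℂ] (K.Space →L[ℂ] K.Space),
      (∀ v : F.Cpl, π (CCR.W F.σform v) = K.weyl v) ∧
      Set.centralizer (Set.centralizer (π '' (F.bulkAlgebra : Set F.Algebra))) ⊆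
        BulkBoundary.boundaryVN K := by
  refine ⟨F.nonempty_kayWald hker, fun K => ?_⟩
  obtain ⟨π, hc, hπ⟩ := K.isWeylRepresentation.exists_starAlgHom BulkBoundary.σform_self
  -- Commutants reverse inclusions, so it suffices that every operator commuting with the boundary
  -- Weyl operators commutes with the represented bulk algebra.
  refine ⟨π, hπ, Set.centralizer_subset fun T hT => ?_⟩
  rintro _ ⟨x, hx, rfl⟩
  exact BulkBoundary.commute_map_bulkAlgebra K hyp2 hc hπ hx hT
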